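/- **Security of location-hiding encryption.** *Scheme.* Let $N,n,t\ge 1$ be integers, $\lambda\ge 0$ a salt length (security parameter), $\mathcal P$ a finite nonempty set of PINs, $\mathbb G=\langle g\rangle$ a cyclic group of prime order $p$, $\mathbb F$ a finite field with $n$ fixed distinct nonzero points $x_1,\dots,x_n$, and $\mathsf{AE}$ an arbitrary (possibly randomized) authenticated encryption scheme with key space $\mathbb F$ and message space $\{0,1\}^*$. Let $\mathsf{Hash}:\{0,1\}^\lambda\times\mathcal P\to[N]^n$ and $\mathsf{Hash}':\mathbb G\to\mathbb F$ be hash functions, modelled as random oracles (uniformly random functions). A key pair is $(\mathsf{sk},\mathsf{pk})=(x,g^x)$ with $x$ uniform in $\mathbb Z_p$. To encrypt $\mathsf{msg}$ under $\mathsf{pk}_1,\dots,\mathsf{pk}_N$, a salt and a PIN: put $(i_1,\dots,i_n)=\mathsf{Hash}(\mathsf{salt},\mathsf{pin})$; choose $k\in\mathbb F$ uniformly; split $k$ by $t$-out-of-$n$ Shamir sharing, i.e. $k_j=f(x_j)$ for a uniformly random polynomial $f$ of degree less than $t$ with $f(0)=k$; encrypt the shares with hashed ElGamal, $C_j=(g^{r_j},\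 \mathsf{Hash}'(\mathsf{pk}_{i_j}^{r_j})+k_j)$ with $r_j$ uniform in $\mathbb Z_p$; the ciphertext is $(M,C_1,\dots,C_n)$ with $M\leftarrow\mathsf{AE.Encrypt}(k,\mathsf{msg})$. *Security game with bit $\beta$.* The challenger draws $N$ key pairs, a uniform salt and a uniform PIN, and sends the public keys to the adversary $\mathcal A$, who chooses two messages $\mathsf{msg}_0,\mathsf{msg}_1$ of equal length. The challenger sends the salt and an encryption of $\mathsf{msg}_\beta$. Then $\mathcal A$ may adaptively make up to $N/16$ corruption queries (send $i\in[N]$, receive $\mathsf{sk}_i$), and finally outputs a bit. $\mathcal A$ may query both random oracles at any time. $\mathsf{LHEncAdv}[\mathcal A]$ is the absolute difference of the probabilities that $\mathcal A$ outputs $1$ for $\beta=0$ and for $\beta=1$. *Assumption games.* $\mathsf{CDHAdv}[\mathcal B]$ is the probability that $\mathcal B(g^a,g^b)=g^{ab}$ for uniform $a,b\in\mathbb Z_p$. $\mathsf{AEAdv}[\mathcal B]$ is the absolute difference of the probabilities that $\mathcal B$ outputs $1$ for $\beta=0$ and $\beta=1$ in this game: a uniform key $k$ is drawn; a query $(m_0,m_1)$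 of two messages of equal length is answered by $\mathsf{AE.Encrypt}(k,m_\beta)$; a decryption query for a ciphertext that was not an answer before is answered by its decryption under $k$ if $\beta=0$ and rejected if $\beta=1$. *Algorithms* are probabilistic loop-free programs with branching, over a memory of arrays of bit strings (equivalently, probabilistic oracle circuits; the model is non-uniform). The scheme's group, exponent, field and authenticated-encryption operations, and uniform sampling, are unit-cost primitives on bit-string representations. The *cost* of a program is its total number of instructions, those of both branches of every conditional included and every instruction weighted by its number of operands; so it bounds both code length and running time. **Theorem.** (1) *Concrete bound.* There are absolute constants $c,d$ such that the following holds for all parameters with $t=n/2$, $N>e\cdot n$ and $|\mathcal P|<2^{n/2}$. For every adversary $\mathcal A$ that makes at most $Q$ queries to $\mathsf{Hash}'$, there are a CDH adversary $\mathcal B_{\mathsf{CDH}}$ and an adversary $\mathcal B_{\mathsf{AE}}$ against $\mathsf{AE}$, both without access to the random oracles and each of cost at most $c\,(N+n+\lambda)^d\cdot\mathrm{cost}(\mathcal A)$, the latter making at most one encryption query and no decryption query, such that $$\mathsf{LHEncAdv}[\mathcal A]\le 2^{-N/4}+N\cdot Q\cdot\mathsf{CDHAdv}[\mathcal B_{\mathsf{CDH}}]+\frac{3N}{n|\mathcal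 P|}+\mathsf{AEAdv}[\mathcal B_{\mathsf{AE}}].$$ (2) *Asymptotic security.* Consider a family of such parameters, indexed by the security parameter $\lambda$ (the salt length), with $t=n/2$, $N>e\cdot n$, $|\mathcal P|<2^{n/2}$ for every $\lambda$, and with $N$ and $n$ polynomially bounded in $\lambda$. Suppose that all CDH adversaries of cost polynomial in $\lambda$ have negligible advantage, and likewise all adversaries of polynomial cost against $\mathsf{AE}$. Then the scheme is secure with corruption threshold $1/16$: every adversary $\mathcal A$ of polynomial cost satisfies $\mathsf{LHEncAdv}[\mathcal A](\lambda)\le O(N/|\mathcal P|)+\mathrm{negl}(\lambda)$. -/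

import Mathlib

open Asymptotics

noncomputable section

/-! ### Strings, codes, uniform distributions -/

/-- Bit strings, the only data that algorithms handle. -/
abbrev Str := List Bool

/-- The uniform distribution on a finite nonempty type. -/
def unif (α : Type) [Finite α] [Nonempty α] : PMF α :=
  @PMF.uniformOfFintype α (Fintype.ofFinite α) _

/-- Decoding a string with respect to an injective encoding; `none` if the string encodes nothing. -/
def decode {α : Type} (e : α ↪ Str) (s : Str) : Option α := Function.partialInv e s

theorem natBits_injective : Function.Injective Nat.bits := fun a b h =>
  (Nat.digits_inj_iff (b := 2)).1 (by rw [Nat.digits_two_eq_bits, Nat.digits_two_eq_bits, h])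

/-- Indices `0, …, N - 1` in binary. -/
def idxCode (N : ℕ) : Fin N ↪ Str :=
  ⟨fun i => Nat.bits i.val, fun _ _ h => Fin.ext (natBits_injective h)⟩

/-- Exponents modulo `p` in binary. -/
def sclCode (p : ℕ) [NeZero p] : ZMod p ↪ Str :=
  ⟨fun x => Nat.bits x.val, fun _ _ h => ZMod.val_injective p (natBits_injective h)⟩

/-- A bit vector as a string. -/
def saltCode (l : ℕ) : (Fin l → Bool) ↪ Str := ⟨List.ofFn, List.ofFn_injective⟩

/-! ### Probabilistic programs and their cost

A program works on a memory of bit-string arrays. It has no loops, and its cost counts every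
instruction in it, in both branches of a conditional. So the cost bounds the running time as well as
the length of the code (it is the size of a probabilistic oracle circuit); a computation with a
bounded loop is written with the loop unrolled. -/

/-- Memory: `m a [s₁, …, sₖ]` is the content of the cell of array `a` with index `(s₁, …, sₖ)`.
The register `a` is the cell with the empty index. -/
abbrev Mem (V : Type) := V → List Str → Str

/-- All cells hold the empty string. -/
def Mem.empty (V : Type) : Mem V := fun _ _ => []

open Classical in
/-- Write `s` into the cell of `a` with index `i`. -/
def Mem.set {V : Type} (m : Mem V) (a : V) (i : List Str) (s : Str) : Mem V :=
  fun b j => if b = a ∧ j = i then s else m b j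

/-- The contents of a list of registers. -/
def Mem.regs {V : Type} (m : Mem V) (xs : List V) : List Str := xs.map fun x => m x []

/-- Write strings into registers, one after the other. -/
def Mem.setRegs {V : Type} (m : Mem V) (xs : List V) (ss : List Str) : Mem V :=
  (xs.zip ss).foldl (fun m' q => m'.set q.1 [] q.2) m

/-- Programs with array names `V`, primitive operations `P` and oracle queries `O`. -/
inductive Prog (V P O : Type) : Type
  /-- do nothing -/
  | skip : Prog V P O
  /-- first the one, then the other -/
  | seq (c d : Prog V P O) : Prog V P O
  /-- put the bit `b` in front of register `x` -/
  | push (b : Bool) (x : V) : Prog V P O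
  /-- delete the first bit of register `x` -/
  | pop (x : V) : Prog V P O
  /-- `x[i₁, …] := y[j₁, …]`, where the indices are the contents of the registers in the lists -/
  | move (x : V) (is : List V) (y : V) (js : List V) : Prog V P O
  /-- branch on whether the first bit of register `x` is `1` -/
  | ifHead (x : V) (c d : Prog V P O) : Prog V P O
  /-- branch on whether the registers `x` and `y` are equal -/
  | ifEq (x y : V) (c d : Prog V P O) : Prog V P O
  /-- primitive operation on the registers `args`, result to register `dst` -/
  | prim (f : P) (args : List V) (dst : V) : Prog V P O
  /-- oracle query with arguments from `args`, answers to `dsts` -/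
  | query (q : O) (args dsts : List V) : Prog V P O

namespace Prog

/-- The cost of a program: every instruction counts one, plus one for each operand list entry. -/
def cost {V P O : Type} : Prog V P O → ℕ
  | skip => 1
  | seq c d => c.cost + d.cost
  | push _ _ => 1
  | pop _ => 1
  | move _ is _ js => 1 + is.length + js.length
  | ifHead _ c d => 1 + c.cost + d.cost
  | ifEq _ _ c d => 1 + c.cost + d.cost
  | prim _ args _ => 1 + args.length
  | query _ args dsts => 1 + args.length + dsts.length

/-- The number of instructions of a program that put the query `q`. It bounds the number of such
queries in any run. -/
def calls {V P O : Type} [DecidableEq O] (q : O) : Prog V P O → ℕ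
  | seq c d => c.calls q + d.calls q
  | ifHead _ c d => c.calls q + d.calls q
  | ifEq _ _ c d => c.calls q + d.calls q
  | query q' _ _ => if q' = q then 1 else 0
  | _ => 0

open Classical in
/-- Running a program: `prim` gives the meaning of the primitive operations and `oracle` that of the
queries, with an oracle state in `σ`. -/
def run {V P O σ : Type} (prim : P → List Str → PMF Str)
    (oracle : O → List Str → σ → PMF (List Str × σ)) :
    Prog V P O → Mem V → σ → PMF (Mem V × σ)
  | skip, m, st => PMF.pure (m, st)
  | seq c d, m, st => (c.run prim oracle m st).bind fun r => d.run prim oracle r.1 r.2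
  | push b x, m, st => PMF.pure (m.set x [] (b :: m x []), st)
  | pop x, m, st => PMF.pure (m.set x [] (m x []).tail, st)
  | move x is y js, m, st => PMF.pure (m.set x (m.regs is) (m y (m.regs js)), st)
  | ifHead x c d, m, st =>
      if (m x []).head? = some true then c.run prim oracle m st else d.run prim oracle m st
  | ifEq x y c d, m, st =>
      if m x [] = m y [] then c.run prim oracle m st else d.run prim oracle m st
  | .prim f args dst, m, st => (prim f (m.regs args)).map fun s => (m.set dst [] s, st)
  | query q args dsts, m, st =>
      (oracle q (m.regs args) st).map fun r => (m.setRegs dsts r.1, r.2)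

end Prog

/-! ### Authenticated encryption, and the parameters of the scheme -/

/-- An authenticated encryption scheme with key space `K` and message space `{0,1}^*`. -/
structure AEScheme (K : Type) where
  /-- encryption, possibly randomized -/
  enc : K → Str → PMF Str
  /-- decryption; `none` means rejection -/
  dec : K → Str → Option Str
  correct : ∀ k m c, c ∈ (enc k m).support → dec k c = some m

/-- The parameters of the location-hiding encryption scheme with hashed ElGamal encryption. -/
structure LHEParams where
  /-- universe size: the number of key pairs -/
  N : ℕ
  [N_ne : NeZero N]
  /-- cluster size -/
  n : ℕ
  n_pos : 0 < n
  /-- recovery threshold of the secret sharing -/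
  t : ℕ
  t_pos : 0 < t
  /-- salt length, the security parameter -/
  saltLen : ℕ
  /-- PIN space -/
  Pin : Type
  [pin_finite : Finite Pin]
  [pin_nonempty : Nonempty Pin]
  /-- the cyclic group of prime order -/
  G : Type
  [grp : CommGroup G]
  p : ℕ
  [p_prime : Fact p.Prime]
  card_G : Nat.card G = p
  /-- generator of `G` -/
  g : G
  g_gen : ∀ x : G, x ∈ Subgroup.zpowers g
  /-- the field of the secret sharing, key space of the authenticated encryption -/
  F : Type
  [fld : Field F]
  [F_finite : Finite F]
  /-- the evaluation points of the secret sharing: distinct and nonzero -/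
  point : Fin n → F
  point_injective : Function.Injective point
  point_ne_zero : ∀ j, point j ≠ 0
  AE : AEScheme F
  /-- bit-string representations -/
  encG : G ↪ Str
  encF : F ↪ Str
  encPin : Pin ↪ Str

attribute [instance] LHEParams.N_ne LHEParams.pin_finite LHEParams.pin_nonempty LHEParams.grp
  LHEParams.p_prime LHEParams.fld LHEParams.F_finite

namespace LHEParams

variable (S : LHEParams)

instance finiteG : Finite S.G :=
  Nat.finite_of_card_ne_zero (by rw [S.card_G]; exact S.p_prime.out.ne_zero)

/-- Salts: bit strings of length `saltLen`. -/
abbrev Salt : Type := Fin S.saltLen → Bool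

/-! ### The scheme -/

/-- The public key `g^x` of the secret key `x`. Key generation draws `x` uniformly modulo `p`. -/
def pubKey (x : ZMod S.p) : S.G := S.g ^ x.val

/-- Hashed ElGamal encryption of `m` to the public key `X` with nonce `r` and hash function `H'`:
`(g^r, H'(X^r) + m)`. -/
def elgamalEnc (H' : S.G → S.F) (X : S.G) (r : ZMod S.p) (m : S.F) : S.G × S.F :=
  (S.g ^ r.val, H' (X ^ r.val) + m)

/-- `t`-out-of-`n` Shamir secret sharing of `k`: the values at the evaluation points of
`k + a₁ X + ⋯ + a_{t-1} X^{t-1}` with uniform coefficients `aᵢ`. -/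
def shamirShare (k : S.F) : PMF (Fin S.n → S.F) :=
  (unif (Fin (S.t - 1) → S.F)).map fun a j =>
    k + ∑ i : Fin (S.t - 1), a i * S.point j ^ (i.val + 1)

/-- Ciphertexts `(M, C₁, …, Cₙ)`. -/
abbrev Ciphertext : Type := Str × (Fin S.n → S.G × S.F)

/-- Encryption of `msg` under the public keys `pk`, a salt and a PIN, with `H` and `H'` for the two
hash functions: the location `H(salt, pin)` is the list of the keys that are used. -/
def encrypt (H : S.Salt × S.Pin → Fin S.n → Fin S.N) (H' : S.G → S.F) (pk : Fin S.N → S.G)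
    (salt : S.Salt) (pin : S.Pin) (msg : Str) : PMF S.Ciphertext := do
  let k ← unif S.F
  let share ← S.shamirShare k
  let r ← unif (Fin S.n → ZMod S.p)
  let M ← S.AE.enc k msg
  return (M, fun j => S.elgamalEnc H' (pk (H (salt, pin) j)) (r j) (share j))

end LHEParams

/-! ### Primitive operations -/

/-- The sorts of objects that have a representation as strings. -/
inductive Kind
  | grp | fld | scl | pin | salt | idx

/-- The primitive operations of all algorithms. -/
inductive Prim (n : ℕ)
  /-- a fair coin -/
  | coin
  /-- a uniform object of the given sort -/
  | sample (κ : Kind)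
  /-- test whether a string represents an object of the given sort -/
  | valid (κ : Kind)
  /-- the generator of the group, and the evaluation points of the secret sharing -/
  | gen | point (j : Fin n)
  | grpMul | grpInv | grpPow
  | fldAdd | fldMul | fldNeg | fldInv
  | sclAdd | sclMul | sclNeg | sclInv
  | aeEnc | aeDec

/-- A unary operation on codes; the empty string on arguments that cannot be decoded. -/
def strOp₁ {α β : Type} (eα : α ↪ Str) (eβ : β ↪ Str) (f : α → β) : List Str → Str
  | [a] => match decode eα a with
    | some x => eβ (f x)
    | none => []
  | _ => []

/-- A binary operation on codes; the empty string on arguments that cannot be decoded. -/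
def strOp₂ {α β γ : Type} (eα : α ↪ Str) (eβ : β ↪ Str) (eγ : γ ↪ Str) (f : α → β → γ) :
    List Str → Str
  | [a, b] => match decode eα a, decode eβ b with
    | some x, some y => eγ (f x y)
    | _, _ => []
  | _ => []

/-- Whether a string is in the range of the code: `1`, or the empty string. -/
def strValid {α : Type} (e : α ↪ Str) : List Str → Str
  | [a] => if (decode e a).isSome then [true] else []
  | _ => []

namespace LHEParams

variable (S : LHEParams)

/-- A uniform object of a given sort, encoded. -/
def sampleSem : Kind → PMF Str
  | .grp => (unif S.G).map S.encG
  | .fld => (unif S.F).map S.encF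
  | .scl => (unif (ZMod S.p)).map (sclCode S.p)
  | .pin => (unif S.Pin).map S.encPin
  | .salt => (unif S.Salt).map (saltCode S.saltLen)
  | .idx => (unif (Fin S.N)).map (idxCode S.N)

/-- The test for the codes of a given sort. -/
def validSem : Kind → List Str → Str
  | .grp => strValid S.encG
  | .fld => strValid S.encF
  | .scl => strValid (sclCode S.p)
  | .pin => strValid S.encPin
  | .salt => strValid (saltCode S.saltLen)
  | .idx => strValid (idxCode S.N)

/-- The meaning of the primitive operations. -/
def primSem : Prim S.n → List Str → PMF Str
  | .coin, _ => (unif Bool).map fun b => [b]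
  | .sample κ, _ => S.sampleSem κ
  | .valid κ, as => PMF.pure (S.validSem κ as)
  | .gen, _ => PMF.pure (S.encG S.g)
  | .point j, _ => PMF.pure (S.encF (S.point j))
  | .grpMul, as => PMF.pure (strOp₂ S.encG S.encG S.encG (· * ·) as)
  | .grpInv, as => PMF.pure (strOp₁ S.encG S.encG (·⁻¹) as)
  | .grpPow, as => PMF.pure (strOp₂ S.encG (sclCode S.p) S.encG (fun X r => X ^ r.val) as)
  | .fldAdd, as => PMF.pure (strOp₂ S.encF S.encF S.encF (· + ·) as)
  | .fldMul, as => PMF.pure (strOp₂ S.encF S.encF S.encF (· * ·) as)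
  | .fldNeg, as => PMF.pure (strOp₁ S.encF S.encF (-·) as)
  | .fldInv, as => PMF.pure (strOp₁ S.encF S.encF (·⁻¹) as)
  | .sclAdd, as => PMF.pure (strOp₂ (sclCode S.p) (sclCode S.p) (sclCode S.p) (· + ·) as)
  | .sclMul, as => PMF.pure (strOp₂ (sclCode S.p) (sclCode S.p) (sclCode S.p) (· * ·) as)
  | .sclNeg, as => PMF.pure (strOp₁ (sclCode S.p) (sclCode S.p) (-·) as)
  | .sclInv, as => PMF.pure (strOp₁ (sclCode S.p) (sclCode S.p) (·⁻¹) as)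
  | .aeEnc, [a, m] => match decode S.encF a with
    | some k => S.AE.enc k m
    | none => PMF.pure []
  | .aeDec, [a, c] => match decode S.encF a with
    | some k => PMF.pure ((S.AE.dec k c).getD [])
    | none => PMF.pure []
  | _, _ => PMF.pure []

end LHEParams

/-! ### The location-hiding encryption security game -/

/-- The queries of an adversary against location-hiding encryption: to the random oracle
`{0,1}^l × Pin → [N]^n`, to the random oracle `G → F`, and corruptions. -/
inductive LHEQuery
  | hash | hash' | corrupt

/-- Bookkeeping of the challenger: the number of corruptions that are still allowed, and the number
of queries to the oracle `G → F` so far. -/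
structure LHEState where
  corruptLeft : ℕ
  hash'Count : ℕ

/-- An adversary against location-hiding encryption. The program `choose` gets the public keys in
the array `pkIn` and leaves two messages in `msg₀`, `msg₁`. The program `guess` continues with its
memory and with the salt and the ciphertext, and leaves its output bit in `out`. -/
structure LHEAdversary (S : LHEParams) where
  V : Type
  pkIn : V
  msg₀ : V
  msg₁ : V
  saltIn : V
  /-- for the component `M` of the ciphertext -/
  bodyIn : V
  /-- for the two components of the `C_j` -/
  headIn : V
  padIn : V
  out : V
  choose : Prog V (Prim S.n) LHEQuery
  guess : Prog V (Prim S.n) LHEQuery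

/-- The cost of an adversary. -/
def LHEAdversary.cost {S : LHEParams} (A : LHEAdversary S) : ℕ := A.choose.cost + A.guess.cost

/-- Write a vector into an array, the `i`-th entry into the cell with index `i` (in binary). -/
def Mem.setVec {V : Type} (m : Mem V) (a : V) {k : ℕ} (v : Fin k → Str) : Mem V :=
  (List.finRange k).foldl (fun m' i => m'.set a [idxCode k i] (v i)) m

namespace LHEParams

variable (S : LHEParams)

/-- The challenger's answers to queries, for given hash functions and secret keys. Ill-formed
queries, and corruptions beyond the allowed number, get no answer. -/
def lheOracle (H : S.Salt × S.Pin → Fin S.n → Fin S.N) (H' : S.G → S.F)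
    (sk : Fin S.N → ZMod S.p) : LHEQuery → List Str → LHEState → PMF (List Str × LHEState)
  | .hash, [a, b], st => match decode (saltCode S.saltLen) a, decode S.encPin b with
    | some salt, some pin => PMF.pure (List.ofFn fun j => idxCode S.N (H (salt, pin) j), st)
    | _, _ => PMF.pure ([], st)
  | .hash', as, st =>
      PMF.pure (match as with
        | [a] => match decode S.encG a with
          | some z => [S.encF (H' z)]
          | none => []
        | _ => [],
        { st with hash'Count := st.hash'Count + 1 })
  | .corrupt, [a], st => match decode (idxCode S.N) a, st.corruptLeft with
    | some i, c + 1 => PMF.pure ([sclCode S.p (sk i)], { st with corruptLeft := c })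
    | _, _ => PMF.pure ([], st)
  | _, _, st => PMF.pure ([], st)

/-- The security experiment with bit `β` in the random-oracle model: the hash functions are
uniformly random functions. The result is the adversary's output bit together with the number of
its queries to the oracle `G → F`. At most `N/16` corruptions are answered, all after the challenge.
The two messages must have the same length; otherwise the output is `0`. -/
def lheExperiment (A : LHEAdversary S) (β : Bool) : PMF (Bool × ℕ) := do
  let sk ← unif (Fin S.N → ZMod S.p)
  let H ← unif (S.Salt × S.Pin → Fin S.n → Fin S.N)
  let H' ← unif (S.G → S.F)
  let salt ← unif S.Salt
  let pin ← unif S.Pin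
  let pk : Fin S.N → S.G := fun i => S.pubKey (sk i)
  let m₀ := (Mem.empty A.V).setVec A.pkIn fun i => S.encG (pk i)
  let r₁ ← A.choose.run S.primSem (S.lheOracle H H' sk) m₀ ⟨0, 0⟩
  let msg : Bool → Str := fun b => if b then r₁.1 A.msg₁ [] else r₁.1 A.msg₀ []
  if (msg false).length ≠ (msg true).length then
    return (false, r₁.2.hash'Count)
  else
    let ct ← S.encrypt H H' pk salt pin (msg β)
    let m₂ := ((((r₁.1.set A.saltIn [] (saltCode S.saltLen salt)).set A.bodyIn [] ct.1).setVec
      A.headIn fun j => S.encG (ct.2 j).1).setVec A.padIn fun j => S.encF (ct.2 j).2)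
    let r₂ ← A.guess.run S.primSem (S.lheOracle H H' sk) m₂ ⟨S.N / 16, r₁.2.hash'Count⟩
    return (decide ((r₂.1 A.out []).head? = some true), r₂.2.hash'Count)

/-- The adversary makes at most `Q` queries to the random oracle `G → F`, in every run. -/
def QueryBound (A : LHEAdversary S) (Q : ℕ) : Prop :=
  ∀ β, ∀ r ∈ (S.lheExperiment A β).support, r.2 ≤ Q

/-- The probability that the adversary outputs `1` in the experiment with bit `β`. -/
def lheProb (A : LHEAdversary S) (β : Bool) : ℝ :=
  (((S.lheExperiment A β).map Prod.fst) true).toReal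

/-- The advantage of an adversary against the location-hiding encryption scheme. -/
def lheAdv (A : LHEAdversary S) : ℝ := |S.lheProb A false - S.lheProb A true|

end LHEParams

/-! ### Computational Diffie–Hellman -/

/-- A CDH adversary: gets `g^a`, `g^b` in two registers and leaves a group element in `out`. It has
no oracles. -/
structure CDHAdversary (S : LHEParams) where
  V : Type
  xIn : V
  yIn : V
  out : V
  prog : Prog V (Prim S.n) Empty

/-- The cost of an adversary. -/
def CDHAdversary.cost {S : LHEParams} (B : CDHAdversary S) : ℕ := B.prog.cost

/-- The CDH experiment: whether the output is `g^(ab)`, for uniform `a`, `b`. -/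
def LHEParams.cdhExperiment (S : LHEParams) (B : CDHAdversary S) : PMF Bool := do
  let a ← unif (ZMod S.p)
  let b ← unif (ZMod S.p)
  let m := ((Mem.empty B.V).set B.xIn [] (S.encG (S.g ^ a.val))).set B.yIn []
    (S.encG (S.g ^ b.val))
  let r ← B.prog.run (σ := Unit) S.primSem (fun q _ _ => q.elim) m ()
  return decide (r.1 B.out [] = S.encG (S.g ^ (a * b).val))

/-- The advantage of a CDH adversary. -/
def LHEParams.cdhAdv (S : LHEParams) (B : CDHAdversary S) : ℝ := (S.cdhExperiment B true).toReal

/-! ### Security of authenticated encryption -/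

/-- The queries of an adversary against authenticated encryption: left-or-right encryption and
decryption. -/
inductive AEQuery
  | lr | dec
  deriving DecidableEq

/-- An adversary against authenticated encryption; it leaves its output bit in `out`. -/
structure AEAdversary (S : LHEParams) where
  V : Type
  out : V
  prog : Prog V (Prim S.n) AEQuery

/-- The cost of an adversary. -/
def AEAdversary.cost {S : LHEParams} (B : AEAdversary S) : ℕ := B.prog.cost

open Classical in
/-- The challenger in the experiment with bit `β` and key `k`; its state is the list of the
ciphertexts that it has produced. A query `lr m₀ m₁` with messages of equal length is answered by an
encryption of `m_β`. A query `dec c` for a ciphertext that the challenger has not produced is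
answered by the decryption of `c` if `β = 0`, and is rejected if `β = 1` (or if the decryption
rejects). Thus the game covers confidentiality and ciphertext integrity. -/
def LHEParams.aeOracle (S : LHEParams) (k : S.F) (β : Bool) :
    AEQuery → List Str → List Str → PMF (List Str × List Str)
  | .lr, [m₀, m₁], st =>
      if m₀.length = m₁.length then
        (S.AE.enc k (if β then m₁ else m₀)).map fun c => ([c], c :: st)
      else PMF.pure ([], st)
  | .dec, [c], st =>
      if β = false ∧ c ∉ st then PMF.pure ((S.AE.dec k c).toList, st) else PMF.pure ([], st)
  | _, _, st => PMF.pure ([], st)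

/-- The experiment with bit `β`; its result is the adversary's output bit. -/
def LHEParams.aeExperiment (S : LHEParams) (B : AEAdversary S) (β : Bool) : PMF Bool := do
  let k ← unif S.F
  let r ← B.prog.run S.primSem (S.aeOracle k β) (Mem.empty B.V) []
  return decide ((r.1 B.out []).head? = some true)

/-- The advantage of an adversary against the authenticated encryption scheme. -/
def LHEParams.aeAdv (S : LHEParams) (B : AEAdversary S) : ℝ :=
  |(S.aeExperiment B false true).toReal - (S.aeExperiment B true true).toReal|

/-! ### Asymptotic security -/

/-- Bounded by a polynomial in the security parameter. -/
def PolyBounded (f : ℕ → ℕ) : Prop := ∃ q : Polynomial ℕ, ∀ l, f l ≤ q.eval l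

/-- Negligible functions of the security parameter. -/
def Negligible (f : ℕ → ℝ) : Prop := SuperpolynomialDecay Filter.atTop (fun l : ℕ => (l : ℝ)) f

/-- CDH is hard: every adversary of polynomial cost has negligible advantage. -/
def CDHHard (S : ℕ → LHEParams) : Prop :=
  ∀ B : ∀ l, CDHAdversary (S l), PolyBounded (fun l => (B l).cost) →
    Negligible fun l => (S l).cdhAdv (B l)

/-- The authenticated encryption is secure: every adversary of polynomial cost has negligible
advantage. -/
def AESecure (S : ℕ → LHEParams) : Prop :=
  ∀ B : ∀ l, AEAdversary (S l), PolyBounded (fun l => (B l).cost) →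
    Negligible fun l => (S l).aeAdv (B l)

/-- The location-hiding encryption is secure with corruption threshold `1/16`: every adversary of
polynomial cost has advantage at most `O(N/|Pin|)` plus a negligible function. -/
def LHESecure (S : ℕ → LHEParams) : Prop :=
  ∀ A : ∀ l, LHEAdversary (S l), PolyBounded (fun l => (A l).cost) →
    ∃ (C : ℝ) (ν : ℕ → ℝ), Negligible ν ∧
      ∀ l, (S l).lheAdv (A l) ≤ C * ((S l).N / Nat.card (S l).Pin) + ν l

/-- The conditions on the parameters: `t = n/2`, `N > e n` and `|Pin| < 2^(n/2)`. -/
structure LHEParams.Admissible (S : LHEParams) : Prop where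
  threshold : S.n = 2 * S.t
  universe_gt : Real.exp 1 * S.n < S.N
  pin_lt : (Nat.card S.Pin : ℝ) < (2 : ℝ) ^ ((S.n : ℝ) / 2)

end

/-!
# Security of location-hiding encryption

The experiment is rewritten as an average, over all random choices, of a game `core` in which keys,
hash functions, salt and challenge are fixed. Expectations are computed by the functional `wp`, and
those after a run of a program by `Prog.ev`. The challenger of this game is instrumented: it records
the queries to the hash function `G → F` and the corrupted keys, and it stops answering after `Q`
queries, which an adversary with query bound `Q` does not notice (`lheExperiment_eq_avg`).

*Hiding the shares.* The challenge consists of the shares of the key, masked by the pads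
`h (pk ^ r)`. A run depends only on the values of `h` at the recorded queries. Translating `h` off these
queries, together with the polynomial of the secret sharing, is a measure-preserving change of
variables. If the pads are distinct and fewer than `t` of them were queried, then a polynomial
interpolates any required translation at the queried positions. So the key can be replaced by zero
(`shiftGame_const_le`), or the masked shares by uniform ones, except on a bad event: two pads
coincide, or `t` of them are queried; the probability of the second part may be taken with uniform
masked shares.

*The bad event* (`avg_badBound_le`). Pads coincide with probability at most `2 n² / p`. If `t` pads
are queried, then either the key of one of them is not corrupted, or `t` keys at the location of the
challenge are. In the first case the query solves a Diffie–Hellman instance that is planted in this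
public key and in this part of the challenge (`avg_hitEv_le`). In the second case the location is
covered by the corrupted set. With uniform masked shares the view of the adversary is independent of
the PIN, so this happens with probability less than `m / |Pin|`, unless some set of `N / 16` keys
covers the locations of `m` PINs; by a union bound, for `m` about `3 N / (2 n)` this has probability
at most `2 ^ (3 N / 8 - 3 N / 4)` over the choice of the hash function (`pr_crowded_le`,
`card_smallSets_le`).

*Reductions.* With shares of zero, the key of the authenticated encryption is used only for one
encryption, and the game becomes an attack on the authenticated encryption
(`aeExperiment_aeAdversary`). The reductions have no random oracles: they run the adversary,
unchanged but for the queries, and sample both hash functions lazily, with tables in their memory.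
`Rep` relates the memory of the simulator to the tables and to the state of the challenger, and
`ev_lift` says that the simulation has the same effect as the game averaged over the hash functions
that extend the tables.

*The final bound* (`concrete_bound`). The CDH adversary is the best one among the reductions for the
various queries, positions and messages and an exhaustive search for discrete logarithms less than
`4 n²`. The search pays for the coincidences of pads, since its advantage is at least
`min (4 n² / p) 1`. The factor `N` leaves room for both because `2 n < N`.
-/

open scoped ENNReal

/-! ### Codes -/

theorem decode_eq_some {α : Type} (e : α ↪ Str) (s : Str) (x : α) :
    decode e s = some x ↔ e x = s :=
  e.injective.isPartialInv x s

@[simp] theorem decode_apply {α : Type} (e : α ↪ Str) (x : α) : decode e (e x) = some x :=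
  (decode_eq_some e _ x).2 rfl

/-! ### Expectations -/

/-- The expectation of `f` under `p` (the weakest preexpectation of `f`). The probability of an
event is the expectation of its indicator. -/
noncomputable def wp {α : Type} (p : PMF α) (f : α → ℝ≥0∞) : ℝ≥0∞ := ∑' a, p a * f a

section wp
variable {α β γ : Type}

theorem wp_pure (a : α) (f : α → ℝ≥0∞) : wp (PMF.pure a) f = f a := by
  classical
  unfold wp
  rw [tsum_eq_single a]
  · simp
  · intro b hb; simp [hb]

theorem wp_bind (p : PMF α) (g : α → PMF β) (f : β → ℝ≥0∞) :
    wp (p.bind g) f = wp p fun a => wp (g a) f := by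
  unfold wp
  simp only [PMF.bind_apply, ← ENNReal.tsum_mul_right, ← ENNReal.tsum_mul_left]
  rw [ENNReal.tsum_comm]
  simp only [mul_assoc]

theorem wp_map (p : PMF α) (g : α → β) (f : β → ℝ≥0∞) :
    wp (p.map g) f = wp p fun a => f (g a) := by
  rw [← PMF.bind_pure_comp, wp_bind]
  simp [wp_pure]

theorem wp_const (p : PMF α) (c : ℝ≥0∞) : wp p (fun _ => c) = c := by
  simp [wp, ENNReal.tsum_mul_right, p.tsum_coe]

theorem wp_mono {p : PMF α} {f g : α → ℝ≥0∞} (h : ∀ a, f a ≤ g a) : wp p f ≤ wp p g :=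
  ENNReal.tsum_le_tsum fun a => by gcongr; exact h a

theorem wp_congr {p : PMF α} {f g : α → ℝ≥0∞} (h : ∀ a, f a = g a) : wp p f = wp p g := by
  rw [funext h]

theorem wp_congr_support {p : PMF α} {f g : α → ℝ≥0∞} (h : ∀ a ∈ p.support, f a = g a) :
    wp p f = wp p g := by
  refine tsum_congr fun a => ?_
  by_cases ha : p a = 0
  · simp [ha]
  · rw [h a ((p.mem_support_iff a).2 ha)]

theorem wp_add (p : PMF α) (f g : α → ℝ≥0∞) :
    wp p (fun a => f a + g a) = wp p f + wp p g := by
  simp only [wp, mul_add]; exact ENNReal.tsum_add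

theorem wp_sum {ι : Type} (p : PMF α) (s : Finset ι) (f : ι → α → ℝ≥0∞) :
    wp p (fun a => ∑ i ∈ s, f i a) = ∑ i ∈ s, wp p (f i) := by
  classical
  induction s using Finset.induction_on with
  | empty => simp [wp_const]
  | insert i s hi ih => simp [Finset.sum_insert hi, wp_add, ih]

theorem wp_comm (p : PMF α) (q : PMF β) (f : α → β → ℝ≥0∞) :
    (wp p fun a => wp q fun b => f a b) = wp q fun b => wp p fun a => f a b := by
  unfold wp
  simp only [← ENNReal.tsum_mul_left]
  rw [ENNReal.tsum_comm]
  refine tsum_congr fun b => tsum_congr fun a => ?_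
  ring

theorem wp_le_const {p : PMF α} {f : α → ℝ≥0∞} {c : ℝ≥0∞} (h : ∀ a, f a ≤ c) : wp p f ≤ c :=
  (wp_mono h).trans (wp_const p c).le

theorem wp_zero (p : PMF α) : wp p (fun _ => 0) = 0 := wp_const p 0

theorem apply_true_eq_wp (p : PMF Bool) : p true = wp p fun b => if b then 1 else 0 := by
  simp [wp, tsum_fintype]

theorem unif_eq [Fintype α] [Nonempty α] : unif α = PMF.uniformOfFintype α := by
  unfold unif
  congr 1
  exact Subsingleton.elim _ _

theorem wp_unif [Fintype α] [Nonempty α] (f : α → ℝ≥0∞) :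
    wp (unif α) f = (∑ a, f a) / Fintype.card α := by
  rw [unif_eq, wp, tsum_fintype]
  simp only [PMF.uniformOfFintype_apply, ENNReal.div_eq_inv_mul, Finset.mul_sum]

theorem wp_unif_equiv [Finite α] [Nonempty α] [Finite β] [Nonempty β] (e : α ≃ β)
    (f : β → ℝ≥0∞) : wp (unif β) f = wp (unif α) fun a => f (e a) := by
  have := Fintype.ofFinite α
  have := Fintype.ofFinite β
  rw [wp_unif, wp_unif, Fintype.card_congr e, Equiv.sum_comp e f]

theorem wp_unif_prod [Finite α] [Nonempty α] [Finite β] [Nonempty β] (f : α × β → ℝ≥0∞) :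
    wp (unif (α × β)) f = wp (unif α) fun a => wp (unif β) fun b => f (a, b) := by
  have := Fintype.ofFinite α
  have := Fintype.ofFinite β
  simp only [wp_unif, Fintype.sum_prod_type, Fintype.card_prod, Nat.cast_mul]
  simp only [ENNReal.div_eq_inv_mul, ← Finset.mul_sum]
  rw [ENNReal.mul_inv (by simp) (by simp), mul_assoc]

/-- One coordinate of a uniform function may be drawn afresh. -/
theorem wp_unif_resample {ι : Type} [DecidableEq ι] [Finite ι] [Finite β] [Nonempty β] (i : ι)
    (f : (ι → β) → ℝ≥0∞) :
    wp (unif (ι → β)) f =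
      wp (unif β) fun x => wp (unif (ι → β)) fun v => f (Function.update v i x) := by
  rw [wp_unif_equiv (Equiv.funSplitAt i β).symm, wp_unif_prod]
  refine wp_congr fun x => ?_
  rw [wp_unif_equiv (Equiv.funSplitAt i β).symm (fun v => f (Function.update v i x)),
    wp_unif_prod]
  have : ∀ (y : β) (b : {j // j ≠ i} → β),
      Function.update ((Equiv.funSplitAt i β).symm (y, b)) i x
        = (Equiv.funSplitAt i β).symm (x, b) := by
    intro y b
    funext j
    by_cases hj : j = i
    · subst hj; simp [Equiv.funSplitAt, Equiv.piSplitAt]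
    · simp [Equiv.funSplitAt, Equiv.piSplitAt, hj]
  simp only [this, wp_const]

/-- Translation invariance of the uniform distribution on a finite group. -/
theorem wp_unif_add [AddGroup α] [Finite α] (d : α) (f : α → ℝ≥0∞) :
    wp (unif α) f = wp (unif α) fun a => f (a + d) :=
  wp_unif_equiv (Equiv.addRight d) f

end wp

/-! ### Runs of programs -/

namespace Prog
section
variable {V P O σ : Type} (prim : P → List Str → PMF Str)
  (oracle : O → List Str → σ → PMF (List Str × σ))

/-- The expectation of `f` after a run of a program. -/
noncomputable def ev (c : Prog V P O) (m : Mem V) (st : σ) (f : Mem V → σ → ℝ≥0∞) : ℝ≥0∞ :=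
  wp (c.run prim oracle m st) fun r => f r.1 r.2

variable (m : Mem V) (st : σ) (f : Mem V → σ → ℝ≥0∞)

@[simp] theorem ev_skip : ev prim oracle skip m st f = f m st := by simp [ev, run, wp_pure]
@[simp] theorem ev_seq (c d : Prog V P O) : ev prim oracle (seq c d) m st f =
    ev prim oracle c m st fun m' st' => ev prim oracle d m' st' f := by simp [ev, run, wp_bind]
@[simp] theorem ev_push (b : Bool) (x : V) : ev prim oracle (push b x) m st f =
    f (m.set x [] (b :: m x [])) st := by simp [ev, run, wp_pure]
@[simp] theorem ev_pop (x : V) : ev prim oracle (pop x) m st f =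
    f (m.set x [] (m x []).tail) st := by simp [ev, run, wp_pure]
@[simp] theorem ev_move (x : V) (is : List V) (y : V) (js : List V) :
    ev prim oracle (move x is y js) m st f = f (m.set x (m.regs is) (m y (m.regs js))) st := by
  simp [ev, run, wp_pure]
@[simp] theorem ev_ifHead (x : V) (c d : Prog V P O) : ev prim oracle (ifHead x c d) m st f =
    if (m x []).head? = some true then ev prim oracle c m st f else ev prim oracle d m st f := by
  simp only [ev, run]; split <;> rfl
open Classical in
@[simp] theorem ev_ifEq (x y : V) (c d : Prog V P O) : ev prim oracle (ifEq x y c d) m st f =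
    if m x [] = m y [] then ev prim oracle c m st f else ev prim oracle d m st f := by
  simp only [ev, run]; split <;> rfl
@[simp] theorem ev_prim (p : P) (args : List V) (dst : V) :
    ev prim oracle (.prim p args dst) m st f =
      wp (prim p (m.regs args)) fun s => f (m.set dst [] s) st := by
  simp [ev, run, wp_map]
@[simp] theorem ev_query (q : O) (args dsts : List V) :
    ev prim oracle (query q args dsts) m st f =
      wp (oracle q (m.regs args) st) fun r => f (m.setRegs dsts r.1) r.2 := by
  simp [ev, run, wp_map]
end

variable {V P O σ σ' : Type} {prim : P → List Str → PMF Str}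

theorem ev_congr {oracle : O → List Str → σ → PMF (List Str × σ)} {c : Prog V P O} {m : Mem V}
    {st : σ} {f g : Mem V → σ → ℝ≥0∞} (h : ∀ m st, f m st = g m st) :
    ev prim oracle c m st f = ev prim oracle c m st g := wp_congr fun _ => h _ _

theorem ev_mono {oracle : O → List Str → σ → PMF (List Str × σ)} {c : Prog V P O} {m : Mem V}
    {st : σ} {f g : Mem V → σ → ℝ≥0∞} (h : ∀ m st, f m st ≤ g m st) :
    ev prim oracle c m st f ≤ ev prim oracle c m st g := wp_mono fun _ => h _ _

/-- If answers to queries never restore a lost property of the oracle state, then no run does. -/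
theorem ev_eq_zero {oracle : O → List Str → σ → PMF (List Str × σ)} {good : σ → Prop}
    (habs : ∀ q as s, ¬ good s → ∀ r ∈ (oracle q as s).support, ¬ good r.2) :
    ∀ (c : Prog V P O) (m : Mem V) (s : σ) (f : Mem V → σ → ℝ≥0∞),
      (∀ m s, ¬ good s → f m s = 0) → ¬ good s → ev prim oracle c m s f = 0 := by
  intro c
  induction c with
  | skip => intro m s f hf hs; simp [hf _ _ hs]
  | seq c d ihc ihd =>
      intro m s f hf hs
      rw [ev_seq]
      exact ihc m s _ (fun m s hs => ihd m s f hf hs) hs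
  | push b x => intro m s f hf hs; simp [hf _ _ hs]
  | pop x => intro m s f hf hs; simp [hf _ _ hs]
  | move x is y js => intro m s f hf hs; simp [hf _ _ hs]
  | ifHead x c d ihc ihd =>
      intro m s f hf hs
      simp only [ev_ifHead, ihc m s f hf hs, ihd m s f hf hs, ite_self]
  | ifEq x y c d ihc ihd =>
      intro m s f hf hs
      simp only [ev_ifEq, ihc m s f hf hs, ihd m s f hf hs, ite_self]
  | prim p args dst => intro m s f hf hs; simp [hf _ _ hs, wp_zero]
  | query q args dsts =>
      intro m s f hf hs
      rw [ev_query, wp_congr_support (g := fun _ => 0), wp_zero]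
      intro r hr
      exact hf _ _ (habs _ _ _ hs r hr)

/-- Two oracles that agree, up to a projection of their states, as long as a property of the state
is not lost, give the same expectation to every function that vanishes when it is lost. -/
theorem ev_eq_of_good {oracle : O → List Str → σ → PMF (List Str × σ)}
    {oracle' : O → List Str → σ' → PMF (List Str × σ')} (π : σ' → σ) {good : σ → Prop}
    (habs : ∀ q as s, ¬ good s → ∀ r ∈ (oracle q as s).support, ¬ good r.2)
    (hstep : ∀ q as s' (f : List Str → σ → ℝ≥0∞), (∀ a s, ¬ good s → f a s = 0) →
      wp (oracle q as (π s')) (fun r => f r.1 r.2) =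
        wp (oracle' q as s') fun r => f r.1 (π r.2)) :
    ∀ (c : Prog V P O) (m : Mem V) (s' : σ') (f : Mem V → σ → ℝ≥0∞),
      (∀ m s, ¬ good s → f m s = 0) →
      ev prim oracle c m (π s') f = ev prim oracle' c m s' fun m s => f m (π s) := by
  intro c
  induction c with
  | skip => intro m s f hf; simp
  | seq c d ihc ihd =>
      intro m s f hf
      rw [ev_seq, ev_seq, ihc m s _ fun m s hs => ev_eq_zero habs d m s f hf hs]
      exact ev_congr fun m s => ihd m s f hf
  | push b x => intro m s f hf; simp
  | pop x => intro m s f hf; simp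
  | move x is y js => intro m s f hf; simp
  | ifHead x c d ihc ihd => intro m s f hf; simp only [ev_ifHead, ihc m s f hf, ihd m s f hf]
  | ifEq x y c d ihc ihd => intro m s f hf; simp only [ev_ifEq, ihc m s f hf, ihd m s f hf]
  | prim p args dst => intro m s f hf; simp
  | query q args dsts =>
      intro m s f hf
      rw [ev_query, ev_query]
      exact hstep q _ s (fun a s => f (m.setRegs dsts a) s) fun a s hs => hf _ _ hs

/-- A property of the oracle state that answers to queries preserve may be assumed at the end of a
run if it holds at the beginning. -/
theorem ev_congr_inv {oracle : O → List Str → σ → PMF (List Str × σ)} {I : σ → Prop}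
    (hI : ∀ q as s, I s → ∀ r ∈ (oracle q as s).support, I r.2) :
    ∀ (c : Prog V P O) (m : Mem V) (s : σ) (f g : Mem V → σ → ℝ≥0∞),
      (∀ m s, I s → f m s = g m s) → I s → ev prim oracle c m s f = ev prim oracle c m s g := by
  intro c
  induction c with
  | skip => intro m s f g h hs; simp [h _ _ hs]
  | seq c d ihc ihd =>
      intro m s f g h hs
      rw [ev_seq, ev_seq]
      exact ihc m s _ _ (fun m s hs => ihd m s f g h hs) hs
  | push b x => intro m s f g h hs; simp [h _ _ hs]
  | pop x => intro m s f g h hs; simp [h _ _ hs]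
  | move x is y js => intro m s f g h hs; simp [h _ _ hs]
  | ifHead x c d ihc ihd =>
      intro m s f g h hs; simp only [ev_ifHead, ihc m s f g h hs, ihd m s f g h hs]
  | ifEq x y c d ihc ihd =>
      intro m s f g h hs; simp only [ev_ifEq, ihc m s f g h hs, ihd m s f g h hs]
  | prim p args dst => intro m s f g h hs; simp [h _ _ hs]
  | query q args dsts =>
      intro m s f g h hs
      rw [ev_query, ev_query]
      exact wp_congr_support fun r hr => h _ _ (hI _ _ _ hs r hr)

end Prog

noncomputable section

/-! ### The instrumented challenger -/

/-- State of the instrumented challenger over `N` keys: the number of corruptions still allowed, the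
number of queries to the oracle `G → F`, the answered ones among these queries, and the set of
corrupted keys. -/
structure ISt (N : ℕ) where
  left : ℕ
  count : ℕ
  log : List Str
  cor : Finset (Fin N)

/-- What the original challenger knows of the state. -/
def ISt.proj {N : ℕ} (st : ISt N) : LHEState := ⟨st.left, st.count⟩

namespace LHEParams

variable (S : LHEParams)

/-- The answer to a query to the oracle for locations. -/
def hashAns (H : S.Salt × S.Pin → Fin S.n → Fin S.N) : List Str → List Str
  | [a, b] => match decode (saltCode S.saltLen) a, decode S.encPin b with
    | some salt, some pin => List.ofFn fun j => idxCode S.N (H (salt, pin) j)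
    | _, _ => []
  | _ => []

/-- The answer to a query to the oracle `G → F`. -/
def hash'Ans (h : S.G → S.F) : List Str → List Str
  | [a] => match decode S.encG a with
    | some z => [S.encF (h z)]
    | none => []
  | _ => []

/-- The answer to a corruption. -/
def corruptAns (sk : Fin S.N → ZMod S.p) (st : ISt S.N) : List Str → List Str × ISt S.N
  | [a] => match decode (idxCode S.N) a, st.left with
    | some i, c + 1 => ([sclCode S.p (sk i)], { st with left := c, cor := insert i st.cor })
    | _, _ => ([], st)
  | _ => ([], st)

/-- Answers and state updates of the instrumented challenger. It answers only the first `Q` queries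
to the oracle `G → F`, and records them. -/
def iStep (Q : ℕ) (H : S.Salt × S.Pin → Fin S.n → Fin S.N) (h : S.G → S.F)
    (sk : Fin S.N → ZMod S.p) : LHEQuery → List Str → ISt S.N → List Str × ISt S.N
  | .hash, as, st => (S.hashAns H as, st)
  | .hash', as, st =>
      if st.count < Q then
        (S.hash'Ans h as, { st with count := st.count + 1, log := st.log ++ [as.headD []] })
      else ([], { st with count := st.count + 1 })
  | .corrupt, as, st => S.corruptAns sk st as

/-- The instrumented challenger as an oracle. -/
def iOracle (Q : ℕ) (H : S.Salt × S.Pin → Fin S.n → Fin S.N) (h : S.G → S.F)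
    (sk : Fin S.N → ZMod S.p) (q : LHEQuery) (as : List Str) (st : ISt S.N) :
    PMF (List Str × ISt S.N) :=
  PMF.pure (S.iStep Q H h sk q as st)

variable {S}

theorem corruptAns_cases (sk : Fin S.N → ZMod S.p) (st : ISt S.N) (as : List Str) :
    S.corruptAns sk st as = ([], st) ∨ ∃ i c, st.left = c + 1 ∧ S.corruptAns sk st as =
      ([sclCode S.p (sk i)], { st with left := c, cor := insert i st.cor }) := by
  unfold corruptAns
  split
  · split
    · rename_i i c _ h; exact Or.inr ⟨i, c, h, rfl⟩
    · exact Or.inl rfl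
  · exact Or.inl rfl

theorem lheOracle_hash (H : S.Salt × S.Pin → Fin S.n → Fin S.N) (h : S.G → S.F)
    (sk : Fin S.N → ZMod S.p) (as : List Str) (st : LHEState) :
    S.lheOracle H h sk .hash as st = PMF.pure (S.hashAns H as, st) := by
  rcases as with _ | ⟨a, _ | ⟨b, _ | _⟩⟩ <;> try rfl
  simp only [lheOracle, hashAns]
  split <;> simp_all

theorem lheOracle_hash' (H : S.Salt × S.Pin → Fin S.n → Fin S.N) (h : S.G → S.F)
    (sk : Fin S.N → ZMod S.p) (as : List Str) (st : LHEState) :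
    S.lheOracle H h sk .hash' as st =
      PMF.pure (S.hash'Ans h as, { st with hash'Count := st.hash'Count + 1 }) := by
  rcases as with _ | ⟨a, _ | ⟨b, _⟩⟩ <;> try rfl

theorem lheOracle_corrupt (H : S.Salt × S.Pin → Fin S.n → Fin S.N) (h : S.G → S.F)
    (sk : Fin S.N → ZMod S.p) (as : List Str) (st : ISt S.N) :
    S.lheOracle H h sk .corrupt as st.proj =
      PMF.pure ((S.corruptAns sk st as).1, (S.corruptAns sk st as).2.proj) := by
  rcases as with _ | ⟨a, _ | ⟨b, _⟩⟩ <;> try rfl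
  simp only [lheOracle, corruptAns, ISt.proj]
  split <;> simp_all

/-- A query to the oracle `G → F` counts at most once, whatever its form. -/
theorem lheOracle_count_le (H : S.Salt × S.Pin → Fin S.n → Fin S.N) (h : S.G → S.F)
    (sk : Fin S.N → ZMod S.p) (q : LHEQuery) (as : List Str) (s : LHEState)
    (r : List Str × LHEState) (hr : r ∈ (S.lheOracle H h sk q as s).support) :
    s.hash'Count ≤ r.2.hash'Count ∧ r.2.hash'Count ≤ s.hash'Count + 1 := by
  cases q with
  | hash => rw [lheOracle_hash, PMF.support_pure] at hr; cases hr; exact ⟨le_rfl, Nat.le_succ _⟩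
  | hash' => rw [lheOracle_hash', PMF.support_pure] at hr; cases hr; exact ⟨Nat.le_succ _, le_rfl⟩
  | corrupt =>
      rw [show s = (ISt.proj (N := S.N) ⟨s.corruptLeft, s.hash'Count, [], ∅⟩) from rfl,
        lheOracle_corrupt, PMF.support_pure] at hr
      cases hr
      rcases corruptAns_cases sk ⟨s.corruptLeft, s.hash'Count, [], ∅⟩ as with
        h | ⟨i, c, _, h⟩ <;> rw [h] <;> exact ⟨le_rfl, Nat.le_succ _⟩

/-- As long as at most `Q` queries are made, the instrumented challenger is the original one. -/
theorem ev_lheOracle {V : Type} (Q : ℕ) (H : S.Salt × S.Pin → Fin S.n → Fin S.N) (h : S.G → S.F)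
    (sk : Fin S.N → ZMod S.p) (c : Prog V (Prim S.n) LHEQuery) (m : Mem V) (st : ISt S.N)
    (f : Mem V → LHEState → ℝ≥0∞) (hf : ∀ m s, Q < s.hash'Count → f m s = 0) :
    c.ev S.primSem (S.lheOracle H h sk) m st.proj f =
      c.ev S.primSem (S.iOracle Q H h sk) m st fun m s => f m s.proj := by
  refine Prog.ev_eq_of_good (good := fun s => s.hash'Count ≤ Q) ISt.proj ?_ ?_ c m st f
    fun m s hs => hf m s (not_le.1 hs)
  · intro q as s hs r hr
    have key := (lheOracle_count_le H h sk q as s r hr).1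
    omega
  · intro q as s f hf
    rw [iOracle, wp_pure]
    cases q with
    | hash => rw [lheOracle_hash, wp_pure]; rfl
    | hash' =>
        rw [lheOracle_hash', wp_pure]
        simp only [iStep]
        by_cases hs : s.count < Q
        · simp only [hs, if_true]; rfl
        · rw [if_neg hs, hf, hf] <;> simp [ISt.proj] <;> omega
    | corrupt => rw [lheOracle_corrupt, wp_pure]; rfl

/-- Recorded queries and corrupted keys are never forgotten: what holds of all of them after a query
held before it. -/
theorem iOracle_good (Q : ℕ) (H : S.Salt × S.Pin → Fin S.n → Fin S.N)
    (h : S.G → S.F) (sk : Fin S.N → ZMod S.p) {P : S.G → Prop} {P' : Fin S.N → Prop}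
    (q : LHEQuery) (as : List Str) (s : ISt S.N)
    (r : List Str × ISt S.N) (hr : r ∈ (S.iOracle Q H h sk q as s).support)
    (hr' : (∀ z, S.encG z ∈ r.2.log → P z) ∧ ∀ i ∈ r.2.cor, P' i) :
    (∀ z, S.encG z ∈ s.log → P z) ∧ ∀ i ∈ s.cor, P' i := by
  rw [iOracle, PMF.support_pure] at hr
  cases hr
  cases q with
  | hash => exact hr'
  | hash' =>
      simp only [iStep] at hr'
      split at hr'
      · exact ⟨fun z hz => hr'.1 z (by simp [hz]), hr'.2⟩
      · exact hr'
  | corrupt =>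
      simp only [iStep] at hr'
      rcases corruptAns_cases sk s as with h | ⟨i, c, _, h⟩ <;> rw [h] at hr'
      · exact hr'
      · exact ⟨hr'.1, fun i hi => hr'.2 i (by simp [hi])⟩

/-- Runs depend only on the values of the hash function `G → F` at the recorded queries, and on the
secret keys that were corrupted. -/
theorem ev_iOracle_congr {V : Type} (Q : ℕ) (H : S.Salt × S.Pin → Fin S.n → Fin S.N)
    {h h' : S.G → S.F} {sk sk' : Fin S.N → ZMod S.p} (c : Prog V (Prim S.n) LHEQuery) (m : Mem V)
    (st : ISt S.N) (f : Mem V → ISt S.N → ℝ≥0∞)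
    (hf : ∀ m s, ¬ ((∀ z, S.encG z ∈ s.log → h z = h' z) ∧ ∀ i ∈ s.cor, sk i = sk' i) →
      f m s = 0) :
    c.ev S.primSem (S.iOracle Q H h sk) m st f = c.ev S.primSem (S.iOracle Q H h' sk') m st f := by
  refine Prog.ev_eq_of_good (σ' := ISt S.N) id
    (good := fun s => (∀ z, S.encG z ∈ s.log → h z = h' z) ∧ ∀ i ∈ s.cor, sk i = sk' i)
    ?_ ?_ c m st f hf
  · exact fun q as s hs r hr hr' => hs (iOracle_good Q H h sk q as s r hr hr')
  · intro q as s f hf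
    simp only [iOracle, wp_pure, id]
    cases q with
    | hash => rfl
    | hash' =>
        simp only [iStep]
        by_cases hs : s.count < Q
        · simp only [if_pos hs]
          by_cases hg : (∀ z, S.encG z ∈ s.log ++ [as.headD []] → h z = h' z) ∧
              ∀ i ∈ s.cor, sk i = sk' i
          · congr 1
            rcases as with _ | ⟨a, _ | ⟨b, _⟩⟩ <;> try rfl
            simp only [hash'Ans]
            cases hd : decode S.encG a with
            | none => rfl
            | some z =>
                have : S.encG z = a := (decode_eq_some _ _ _).1 hd
                simp only [hg.1 z (by simp [this])]
          · rw [hf _ _ hg, hf _ _ hg]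
        · simp only [if_neg hs]
    | corrupt =>
        simp only [iStep, corruptAns]
        split
        · split
          · rename_i i c _ _
            by_cases hg : (∀ z, S.encG z ∈ s.log → h z = h' z) ∧
              ∀ l ∈ insert i s.cor, sk l = sk' l
            · rw [hg.2 i (by simp)]
            · exact (hf _ ⟨_, _, _, _⟩ hg).trans (hf _ ⟨_, _, _, _⟩ hg).symm
          · rfl
        · rfl

/-- At the end of a run, at most `Q` queries are recorded, and corrupted keys and corruptions that
are left are at most `k` together, if this was so at the beginning. -/
theorem ev_iOracle_congr_inv {V : Type} (Q k : ℕ) (H : S.Salt × S.Pin → Fin S.n → Fin S.N)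
    (h : S.G → S.F) (sk : Fin S.N → ZMod S.p) (c : Prog V (Prim S.n) LHEQuery) (m : Mem V)
    (st : ISt S.N) (f g : Mem V → ISt S.N → ℝ≥0∞)
    (hfg : ∀ m s, (s.log.length ≤ min s.count Q ∧ s.cor.card + s.left ≤ k) → f m s = g m s)
    (hst : st.log.length ≤ min st.count Q ∧ st.cor.card + st.left ≤ k) :
    c.ev S.primSem (S.iOracle Q H h sk) m st f = c.ev S.primSem (S.iOracle Q H h sk) m st g := by
  refine Prog.ev_congr_inv ?_ c m st f g hfg hst
  intro q as s hs r hr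
  rw [iOracle, PMF.support_pure] at hr
  cases hr
  cases q with
  | hash => exact hs
  | hash' =>
      simp only [iStep]
      split
      · refine ⟨?_, hs.2⟩
        simp only [List.length_append, List.length_cons, List.length_nil]
        omega
      · exact ⟨by simp only; omega, hs.2⟩
  | corrupt =>
      simp only [iStep]
      rcases corruptAns_cases sk s as with h | ⟨i, c, hl, h⟩ <;> rw [h]
      · exact hs
      · have := Finset.card_insert_le i s.cor
        exact ⟨hs.1, by simp only; omega⟩

end LHEParams
end

noncomputable section

/-! ### The security game around fixed random choices -/

namespace LHEParams

variable {S : LHEParams}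

/-- The adversary's memory after the challenge. -/
def inject (A : LHEAdversary S) (m : Mem A.V) (salt : S.Salt) (M : Str) (R : Fin S.n → S.G)
    (u : Fin S.n → S.F) : Mem A.V :=
  (((m.set A.saltIn [] (saltCode S.saltLen salt)).set A.bodyIn [] M).setVec
      A.headIn fun j => S.encG (R j)).setVec A.padIn fun j => S.encF (u j)

/-- The length test of the game. -/
def lenEq (A : LHEAdversary S) (m : Mem A.V) : Bool :=
  decide ((m A.msg₀ []).length = (m A.msg₁ []).length)

/-- The expectation of `φ` at the end of a game in which everything but the randomness of the
adversary and of the encryption `encM` of one of the messages is fixed: the public keys `pk`, the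
answers `sk` to corruptions, the hash functions, the salt, the group elements `R` and the field
elements `u` of the challenge. The first argument of `φ` is the result of the length test; if the
test fails, the game goes on all the same. -/
def core (A : LHEAdversary S) (Q : ℕ) (encM : Str → Str → PMF Str) (pk : Fin S.N → S.G)
    (sk : Fin S.N → ZMod S.p) (H : S.Salt × S.Pin → Fin S.n → Fin S.N) (h : S.G → S.F)
    (salt : S.Salt) (R : Fin S.n → S.G) (u : Fin S.n → S.F)
    (φ : Bool → Mem A.V → ISt S.N → ℝ≥0∞) : ℝ≥0∞ :=
  A.choose.ev S.primSem (S.iOracle Q H h sk)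
    ((Mem.empty A.V).setVec A.pkIn fun i => S.encG (pk i)) ⟨0, 0, [], ∅⟩ fun m₁ st₁ =>
      wp (encM (m₁ A.msg₀ []) (m₁ A.msg₁ [])) fun M =>
        A.guess.ev S.primSem (S.iOracle Q H h sk) (inject A m₁ salt M R u)
          { st₁ with left := S.N / 16 } (φ (lenEq A m₁))

section core
variable (A : LHEAdversary S) (Q : ℕ) (encM : Str → Str → PMF Str) (pk : Fin S.N → S.G)
    (sk : Fin S.N → ZMod S.p) (H : S.Salt × S.Pin → Fin S.n → Fin S.N) (h : S.G → S.F)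
    (salt : S.Salt) (R : Fin S.n → S.G) (u : Fin S.n → S.F)
    (φ ψ : Bool → Mem A.V → ISt S.N → ℝ≥0∞)

theorem core_add : core A Q encM pk sk H h salt R u (fun e m st => φ e m st + ψ e m st) =
    core A Q encM pk sk H h salt R u φ + core A Q encM pk sk H h salt R u ψ := by
  simp only [core, Prog.ev, wp_add]

theorem core_sum {ι : Type} (s : Finset ι) (φ : ι → Bool → Mem A.V → ISt S.N → ℝ≥0∞) :
    core A Q encM pk sk H h salt R u (fun e m st => ∑ i ∈ s, φ i e m st) =
    ∑ i ∈ s, core A Q encM pk sk H h salt R u (φ i) := by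
  simp only [core, Prog.ev, wp_sum]

theorem core_zero : core A Q encM pk sk H h salt R u (fun _ _ _ => 0) = 0 := by
  simp only [core, Prog.ev, wp_const]

variable {φ ψ}

theorem core_mono (hφ : ∀ e m st, φ e m st ≤ ψ e m st) :
    core A Q encM pk sk H h salt R u φ ≤ core A Q encM pk sk H h salt R u ψ :=
  Prog.ev_mono fun _ _ => wp_mono fun _ => Prog.ev_mono fun _ _ => hφ _ _ _

theorem core_le_one (hφ : ∀ e m st, φ e m st ≤ 1) : core A Q encM pk sk H h salt R u φ ≤ 1 :=
  wp_le_const fun _ => wp_le_const fun _ => wp_le_const fun _ => hφ _ _ _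

/-- The probability of passing the length test does not depend on the challenge. -/
theorem core_const (f : Bool → ℝ≥0∞) (encM' : Str → Str → PMF Str) (R' : Fin S.n → S.G)
    (u' : Fin S.n → S.F) :
    core A Q encM pk sk H h salt R u (fun e _ _ => f e) =
      core A Q encM' pk sk H h salt R' u' (fun e _ _ => f e) := by
  simp only [core, Prog.ev, wp_const]

/-- Encryption schemes that agree when the length test has a certain result are exchangeable in
games that are won only then. -/
theorem core_congr_enc (b : Bool) (encM' : Str → Str → PMF Str)
    (hM : ∀ m₀ m₁, decide (m₀.length = m₁.length) = b → encM m₀ m₁ = encM' m₀ m₁)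
    (hφ : ∀ e m st, e ≠ b → φ e m st = 0) :
    core A Q encM pk sk H h salt R u φ = core A Q encM' pk sk H h salt R u φ := by
  refine Prog.ev_congr fun m₁ st₁ => ?_
  by_cases hb : lenEq A m₁ = b
  · rw [hM _ _ hb]
  · simp only [Prog.ev, hφ _ _ _ hb, wp_const]

/-- Locality: the game depends only on the values of the hash function `G → F` at the recorded
queries, and on the secret keys that were corrupted. -/
theorem core_congr_local {h' : S.G → S.F} {sk' : Fin S.N → ZMod S.p}
    (hφ : ∀ e m s, ¬ ((∀ z, S.encG z ∈ s.log → h z = h' z) ∧ ∀ i ∈ s.cor, sk i = sk' i) →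
      φ e m s = 0) :
    core A Q encM pk sk H h salt R u φ = core A Q encM pk sk' H h' salt R u φ := by
  have key : ∀ m st f, (∀ m s, ¬ ((∀ z, S.encG z ∈ s.log → h z = h' z) ∧
      ∀ i ∈ s.cor, sk i = sk' i) → f m s = 0) → ¬ ((∀ z, S.encG z ∈ st.log → h z = h' z) ∧
      ∀ i ∈ st.cor, sk i = sk' i) → A.guess.ev S.primSem (S.iOracle Q H h sk) m st f = 0 := by
    intro m st f hf hst
    refine Prog.ev_eq_zero (good := fun s => (∀ z, S.encG z ∈ s.log → h z = h' z) ∧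
      ∀ i ∈ s.cor, sk i = sk' i) ?_ _ m st f hf hst
    exact fun q as s hs r hr hr' => hs (iOracle_good Q H h sk q as s r hr hr')
  refine (ev_iOracle_congr Q H A.choose _ _ _ ?_).trans (Prog.ev_congr fun m₁ st₁ => ?_)
  · intro m₁ st₁ hst
    simp only [key _ { st₁ with left := S.N / 16 } _ (hφ _) hst, wp_const]
  · exact wp_congr fun M => ev_iOracle_congr Q H A.guess _ _ _ (hφ _)

/-- At the end of the game, at most `Q` queries are recorded, and at most `N / 16` keys corrupted.
-/
theorem core_congr_inv
    (hφ : ∀ e m s, s.log.length ≤ Q → s.cor.card ≤ S.N / 16 → φ e m s = ψ e m s) :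
    core A Q encM pk sk H h salt R u φ = core A Q encM pk sk H h salt R u ψ := by
  refine ev_iOracle_congr_inv Q 0 H h sk _ _ _ _ _ (fun m₁ st₁ hst => ?_) (by simp)
  refine wp_congr fun M => ev_iOracle_congr_inv Q (S.N / 16) H h sk _ _ _ _ _
    (fun m s hs => hφ _ _ _ ?_ ?_) ?_
  · omega
  · omega
  · exact ⟨hst.1, by have := hst.2; simp only; omega⟩

end core

/-! ### The experiment -/

/-- The nonconstant part of the polynomial of Shamir's secret sharing, at the `j`-th point. -/
def poly (a : Fin (S.t - 1) → S.F) (j : Fin S.n) : S.F :=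
  ∑ i : Fin (S.t - 1), a i * S.point j ^ (i.val + 1)

/-- The arguments of the hash function in the hashed ElGamal encryption. -/
def padArg (sk : Fin S.N → ZMod S.p) (loc : Fin S.n → Fin S.N) (r : Fin S.n → ZMod S.p)
    (j : Fin S.n) : S.G := S.pubKey (sk (loc j)) ^ (r j).val

open Classical in
/-- The indicator of the event that the adversary passes the length test and outputs `1`. -/
def outOne (A : LHEAdversary S) (e : Bool) (m : Mem A.V) (_ : ISt S.N) : ℝ≥0∞ :=
  if e ∧ (m A.out []).head? = some true then 1 else 0

/-- Encryption of the message that the bit `β` selects. -/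
def encSel (k : S.F) (β : Bool) (m₀ m₁ : Str) : PMF Str := S.AE.enc k (if β then m₁ else m₀)

/-- The expectation of `φ` in the game with the key `k` of the authenticated encryption and the
additional terms `δ` in the second components of the ElGamal ciphertexts; the shares are shares of
zero. A constant `δ` turns them into shares of that constant. -/
def shiftGame (A : LHEAdversary S) (Q : ℕ) (β : Bool) (sk : Fin S.N → ZMod S.p)
    (H : S.Salt × S.Pin → Fin S.n → Fin S.N) (salt : S.Salt) (pin : S.Pin)
    (r : Fin S.n → ZMod S.p) (k : S.F) (δ : Fin S.n → S.F)
    (φ : Bool → Mem A.V → ISt S.N → ℝ≥0∞) : ℝ≥0∞ :=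
  wp (unif (S.G → S.F)) fun h => wp (unif (Fin (S.t - 1) → S.F)) fun a =>
    core A Q (encSel k β) (fun i => S.pubKey (sk i)) sk H h salt (fun j => S.g ^ (r j).val)
      (fun j => h (padArg sk (H (salt, pin)) r j) + (δ j + poly a j)) φ

/-- The average over the random choices that are common to all games. -/
def avg (S : LHEParams) (f : (Fin S.N → ZMod S.p) → (S.Salt × S.Pin → Fin S.n → Fin S.N) →
    S.Salt → S.Pin → (Fin S.n → ZMod S.p) → S.F → ℝ≥0∞) : ℝ≥0∞ :=
  wp (unif _) fun sk => wp (unif _) fun H => wp (unif _) fun salt => wp (unif _) fun pin =>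
    wp (unif _) fun r => wp (unif _) fun k => f sk H salt pin r k

theorem monad_bind_eq {α β : Type} (p : PMF α) (f : α → PMF β) : (p >>= f) = p.bind f := rfl
theorem monad_pure_eq {α : Type} (a : α) : (pure a : PMF α) = PMF.pure a := rfl

/-- The expectation of `f` in the security experiment with the instrumented challenger. -/
def cappedGame (A : LHEAdversary S) (Q : ℕ) (β : Bool) (f : Bool → ℕ → ℝ≥0∞) : ℝ≥0∞ :=
  wp (unif _) fun sk => wp (unif _) fun H => wp (unif _) fun h => wp (unif _) fun salt =>
    wp (unif _) fun pin => A.choose.ev S.primSem (S.iOracle Q H h sk)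
      ((Mem.empty A.V).setVec A.pkIn fun i => S.encG (S.pubKey (sk i))) ⟨0, 0, [], ∅⟩
        fun m₁ st₁ =>
      if lenEq A m₁ then
        wp (S.encrypt H h (fun i => S.pubKey (sk i)) salt pin
            (if β then m₁ A.msg₁ [] else m₁ A.msg₀ [])) fun ct =>
          A.guess.ev S.primSem (S.iOracle Q H h sk)
            (inject A m₁ salt ct.1 (fun j => (ct.2 j).1) fun j => (ct.2 j).2)
            { st₁ with left := S.N / 16 }
            fun m st => f (decide ((m A.out []).head? = some true)) st.count
      else f false st₁.count

/-- The capped challenger may replace the original one as long as only runs with at most `Q` queries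
count. -/
theorem wp_lheExperiment (A : LHEAdversary S) (Q : ℕ) (β : Bool) (f : Bool → ℕ → ℝ≥0∞)
    (hf : ∀ b c, Q < c → f b c = 0) :
    wp (S.lheExperiment A β) (fun r => f r.1 r.2) = cappedGame A Q β f := by
  unfold lheExperiment cappedGame
  simp only [monad_bind_eq, monad_pure_eq, wp_bind]
  refine wp_congr fun sk => wp_congr fun H => wp_congr fun h => wp_congr fun salt =>
    wp_congr fun pin => ?_
  have zero : ∀ (m : Mem A.V) (s : LHEState) (f : Mem A.V → LHEState → ℝ≥0∞),
      (∀ m s, Q < s.hash'Count → f m s = 0) → Q < s.hash'Count →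
      A.guess.ev S.primSem (S.lheOracle H h sk) m s f = 0 := fun m s f hf hs =>
    Prog.ev_eq_zero (good := fun s => s.hash'Count ≤ Q)
      (fun q as s hs r hr => by have := (lheOracle_count_le H h sk q as s r hr).1; omega)
      A.guess m s f (fun m s hs => hf m s (not_le.1 hs)) (not_le.2 hs)
  refine (ev_lheOracle Q H h sk A.choose
    ((Mem.empty A.V).setVec A.pkIn fun i => S.encG (S.pubKey (sk i))) ⟨0, 0, [], ∅⟩
    (fun m₁ st₁ => wp (if (if false = true then m₁ A.msg₁ [] else m₁ A.msg₀ []).length ≠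
        (if true = true then m₁ A.msg₁ [] else m₁ A.msg₀ []).length then
          PMF.pure (false, st₁.hash'Count)
        else (S.encrypt H h (fun i => S.pubKey (sk i)) salt pin
          (if β then m₁ A.msg₁ [] else m₁ A.msg₀ [])).bind fun ct =>
            (A.guess.run S.primSem (S.lheOracle H h sk)
              (inject A m₁ salt ct.1 (fun j => (ct.2 j).1) fun j => (ct.2 j).2)
              ⟨S.N / 16, st₁.hash'Count⟩).bind fun r₂ =>
            PMF.pure (decide ((r₂.1 A.out []).head? = some true), r₂.2.hash'Count))
      fun r => f r.1 r.2) ?_).trans (Prog.ev_congr fun m₁ st₁ => ?_)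
  · intro m s hs
    simp only [Bool.false_eq_true, if_false, if_true]
    split
    · rw [wp_pure]; exact hf _ _ hs
    · simp only [wp_bind, wp_pure]
      refine (wp_congr fun c => ?_).trans (wp_zero _)
      exact zero _ ⟨_, _⟩ (fun m s => f (decide ((m A.out []).head? = some true)) s.hash'Count)
        (fun m s hs => hf _ _ hs) hs
  · by_cases hl : (m₁ A.msg₀ []).length = (m₁ A.msg₁ []).length
    · have hl' : lenEq A m₁ = true := by simp [lenEq, hl]
      simp only [hl, hl', ne_eq, not_true_eq_false, if_false, if_true, Bool.false_eq_true, wp_bind,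
        wp_pure]
      refine wp_congr fun ct => ?_
      exact ev_lheOracle Q H h sk A.guess _ { st₁ with left := S.N / 16 }
        (fun m s => f (decide ((m A.out []).head? = some true)) s.hash'Count)
          (fun m s hs => hf _ _ hs)
    · have hl' : lenEq A m₁ = false := by simp [lenEq, hl]
      simp [hl, hl', wp_pure, ISt.proj]

theorem cappedGame_add (A : LHEAdversary S) (Q : ℕ) (β : Bool) (f g : Bool → ℕ → ℝ≥0∞) :
    cappedGame A Q β (fun b c => f b c + g b c) = cappedGame A Q β f + cappedGame A Q β g := by
  simp only [cappedGame, ← wp_add]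
  refine wp_congr fun sk => wp_congr fun H => wp_congr fun h => wp_congr fun salt =>
    wp_congr fun pin => ?_
  rw [Prog.ev, Prog.ev, Prog.ev, ← wp_add]
  refine wp_congr fun r => ?_
  split
  · simp only [Prog.ev, wp_add]
  · rfl

theorem cappedGame_one (A : LHEAdversary S) (Q : ℕ) (β : Bool) :
    cappedGame A Q β (fun _ _ => 1) = 1 := by
  simp only [cappedGame, Prog.ev, wp_const, ite_self]

theorem cappedGame_mono (A : LHEAdversary S) (Q : ℕ) (β : Bool) {f g : Bool → ℕ → ℝ≥0∞}
    (hfg : ∀ b c, f b c ≤ g b c) : cappedGame A Q β f ≤ cappedGame A Q β g := by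
  refine wp_mono fun sk => wp_mono fun H => wp_mono fun h => wp_mono fun salt =>
    wp_mono fun pin => Prog.ev_mono fun m st => ?_
  split
  · exact wp_mono fun ct => Prog.ev_mono fun _ _ => hfg _ _
  · exact hfg _ _

/-- An adversary that respects the query bound does not notice that only `Q` queries are answered.
-/
theorem lheExperiment_eq_cappedGame (A : LHEAdversary S) {Q : ℕ} (hQ : S.QueryBound A Q)
    (β : Bool) : ((S.lheExperiment A β).map Prod.fst) true =
      cappedGame A Q β fun b _ => if b then 1 else 0 := by
  have split : ∀ f : Bool → ℕ → ℝ≥0∞, cappedGame A Q β f =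
      cappedGame A Q β (fun b c => if c ≤ Q then f b c else 0) +
      cappedGame A Q β (fun b c => if c ≤ Q then 0 else f b c) := by
    intro f
    rw [← cappedGame_add]
    congr 1
    funext b c
    split <;> simp
  have real : ∀ f : Bool → ℝ≥0∞, wp (S.lheExperiment A β) (fun r => f r.1) =
      cappedGame A Q β (fun b c => if c ≤ Q then f b else 0) := by
    intro f
    rw [← wp_lheExperiment A Q β _ (fun b c hc => by simp [hc])]
    exact wp_congr_support fun r hr => by simp [hQ β r hr]
  have h1 := real fun _ => 1
  have h2 := split fun _ _ => 1
  rw [wp_const] at h1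
  rw [cappedGame_one, ← h1] at h2
  -- all of the probability is on runs with at most `Q` queries, so nothing is left for the others
  have h0 : cappedGame A Q β (fun b c => if c ≤ Q then 0 else 1) = 0 := by
    have : (1 : ℝ≥0∞) + 0 = 1 + cappedGame A Q β (fun b c => if c ≤ Q then 0 else 1) := by
      rw [add_zero]; exact h2
    exact ((ENNReal.add_right_inj ENNReal.one_ne_top).1 this).symm
  rw [apply_true_eq_wp, wp_map, real (fun b => if b then 1 else 0),
    split fun b _ => if b then 1 else 0]
  have : cappedGame A Q β (fun b c => if c ≤ Q then 0 else if b then 1 else 0) = 0 := by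
    refine le_antisymm (le_of_le_of_eq (cappedGame_mono A Q β fun b c => ?_) h0) bot_le
    split <;> [rfl; (split <;> simp)]
  rw [this, add_zero]

/-- The security experiment in terms of the instrumented challenger. -/
theorem lheExperiment_eq_avg (A : LHEAdversary S) {Q : ℕ} (hQ : S.QueryBound A Q) (β : Bool) :
    ((S.lheExperiment A β).map Prod.fst) true =
      S.avg fun sk H salt pin r k =>
        shiftGame A Q β sk H salt pin r k (fun _ => k) (outOne A) := by
  rw [lheExperiment_eq_cappedGame A hQ]
  unfold cappedGame avg shiftGame
  refine wp_congr fun sk => wp_congr fun H => ?_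
  trans wp (unif (S.G → S.F)) fun h => wp (unif S.Salt) fun salt => wp (unif S.Pin) fun pin =>
      wp (unif (Fin S.n → ZMod S.p)) fun r => wp (unif S.F) fun k =>
      wp (unif (Fin (S.t - 1) → S.F)) fun a =>
        core A Q (encSel k β) (fun i => S.pubKey (sk i)) sk H h salt (fun j => S.g ^ (r j).val)
          (fun j => h (padArg sk (H (salt, pin)) r j) + (k + poly a j)) (outOne A)
  swap
  · exact (wp_comm _ _ _).trans <| wp_congr fun salt => (wp_comm _ _ _).trans <| wp_congr fun pin =>
      (wp_comm _ _ _).trans <| wp_congr fun r => wp_comm _ _ _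
  refine wp_congr fun h => wp_congr fun salt => wp_congr fun pin => ?_
  trans A.choose.ev S.primSem (S.iOracle Q H h sk)
        ((Mem.empty A.V).setVec A.pkIn fun i => S.encG (S.pubKey (sk i))) ⟨0, 0, [], ∅⟩
        fun m₁ st₁ => wp (unif (Fin S.n → ZMod S.p)) fun r => wp (unif S.F) fun k =>
      wp (unif (Fin (S.t - 1) → S.F)) fun a =>
      wp (encSel k β (m₁ A.msg₀ []) (m₁ A.msg₁ [])) fun M =>
        A.guess.ev S.primSem (S.iOracle Q H h sk) (inject A m₁ salt M (fun j => S.g ^ (r j).val)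
          (fun j => h (padArg sk (H (salt, pin)) r j) + (k + poly a j)))
          { st₁ with left := S.N / 16 } (outOne A (lenEq A m₁))
  swap
  · exact (wp_comm _ _ _).trans <| wp_congr fun r => (wp_comm _ _ _).trans <| wp_congr fun k =>
      wp_comm _ _ _
  refine Prog.ev_congr fun m₁ st₁ => ?_
  by_cases hl : lenEq A m₁ = true
  · have hout : outOne A true =
        fun m _ => if (m A.out []).head? = some true then 1 else 0 := by
      funext m st; simp [outOne]
    simp only [hl, if_true, encrypt, monad_bind_eq, monad_pure_eq, wp_bind, wp_pure, shamirShare,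
      wp_map, hout, encSel, decide_eq_true_eq]
    refine Eq.trans ?_ (wp_comm _ _ _)
    refine wp_congr fun k => (wp_comm _ _ _).trans ?_
    rfl
  · simp [hl, outOne, Prog.ev, wp_const]

end LHEParams
end

noncomputable section

/-! ### Hiding the shares -/

namespace LHEParams

variable {S : LHEParams}

/-- The positions of the challenge whose pads were queried. -/
def hits (c : Fin S.n → S.G) (st : ISt S.N) : Finset (Fin S.n) :=
  Finset.univ.filter fun j => S.encG (c j) ∈ st.log

theorem mem_hits {c : Fin S.n → S.G} {st : ISt S.N} {j : Fin S.n} :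
    j ∈ hits c st ↔ S.encG (c j) ∈ st.log := by simp [hits]

theorem poly_add (a b : Fin (S.t - 1) → S.F) (j : Fin S.n) :
    poly (a + b) j = poly a j + poly b j := by
  simp [poly, add_mul, Finset.sum_add_distrib]

/-- Any values at fewer than `t` of the evaluation points can be interpolated, with constant
coefficient zero. -/
theorem exists_poly_eq (J : Finset (Fin S.n)) (hJ : J.card < S.t) (δ : Fin S.n → S.F) :
    ∃ a : Fin (S.t - 1) → S.F, ∀ j ∈ J, poly a j = δ j := by
  classical
  have hinj : Set.InjOn S.point (J : Set (Fin S.n)) := S.point_injective.injOn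
  set L := Lagrange.interpolate J S.point fun j => δ j / S.point j with hL
  have hdeg : L.degree < J.card := Lagrange.degree_interpolate_lt _ hinj
  refine ⟨fun i => L.coeff i, fun j hj => ?_⟩
  have hev : L.eval (S.point j) = δ j / S.point j :=
    Lagrange.eval_interpolate_at_node _ hinj hj
  have hpos : 0 < J.card := Finset.card_pos.2 ⟨j, hj⟩
  have hnat : L.natDegree < S.t - 1 := by
    have : L.natDegree < J.card := by
      by_cases h0 : L = 0
      · simpa [h0] using hpos
      · exact (Polynomial.natDegree_lt_iff_degree_lt h0).2 hdeg
    omega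
  have hsum : poly (fun i => L.coeff i) j = L.eval (S.point j) * S.point j := by
    rw [Polynomial.eval_eq_sum_range' hnat, poly, Finset.sum_mul,
      Finset.sum_range fun i => L.coeff i * S.point j ^ i * S.point j]
    exact Finset.sum_congr rfl fun i _ => by ring
  rw [hsum, hev, div_mul_cancel₀ _ (S.point_ne_zero j)]

section
variable (A : LHEAdversary S) (Q : ℕ) (β : Bool) (sk : Fin S.N → ZMod S.p)
    (H : S.Salt × S.Pin → Fin S.n → Fin S.N) (salt : S.Salt) (pin : S.Pin)
    (r : Fin S.n → ZMod S.p) (k : S.F)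

theorem shiftGame_mono (δ : Fin S.n → S.F) {φ ψ : Bool → Mem A.V → ISt S.N → ℝ≥0∞}
    (hφ : ∀ e m st, φ e m st ≤ ψ e m st) : shiftGame A Q β sk H salt pin r k δ φ ≤
      shiftGame A Q β sk H salt pin r k δ ψ :=
  wp_mono fun _ => wp_mono fun _ => core_mono _ _ _ _ _ _ _ _ _ _ hφ

theorem shiftGame_add (δ : Fin S.n → S.F) (φ ψ : Bool → Mem A.V → ISt S.N → ℝ≥0∞) :
    shiftGame A Q β sk H salt pin r k δ (fun e m st => φ e m st + ψ e m st) =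
      shiftGame A Q β sk H salt pin r k δ φ + shiftGame A Q β sk H salt pin r k δ ψ := by
  simp only [shiftGame, core_add, wp_add]

/-- Translating the hash function and the polynomial translates the challenge; the adversary does
not notice it if the hash function stays the same at its queries. -/
theorem shiftGame_translate (δ δ' : Fin S.n → S.F) (δh : S.G → S.F) (δa : Fin (S.t - 1) → S.F)
    (hδ : ∀ j, δh (padArg sk (H (salt, pin)) r j) + poly δa j = δ' j)
    (φ : Bool → Mem A.V → ISt S.N → ℝ≥0∞)
    (hφ : ∀ e m st, ¬ (∀ z, S.encG z ∈ st.log → δh z = 0) → φ e m st = 0) :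
    shiftGame A Q β sk H salt pin r k (fun j => δ j + δ' j) φ =
      shiftGame A Q β sk H salt pin r k δ φ := by
  symm
  unfold shiftGame
  rw [wp_unif_add δh]
  refine wp_congr fun h => ?_
  rw [wp_unif_add δa]
  refine wp_congr fun a => ?_
  have : (fun j => (h + δh) (padArg sk (H (salt, pin)) r j) + (δ j + poly (a + δa) j)) =
      fun j => h (padArg sk (H (salt, pin)) r j) + (δ j + δ' j + poly a j) := by
    funext j
    rw [← hδ, poly_add, Pi.add_apply]
    ring
  rw [this]
  refine core_congr_local _ _ _ _ _ _ _ _ _ _ fun e m st hst => hφ e m st fun h0 => hst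
    ⟨fun z hz => by rw [Pi.add_apply, h0 z hz, add_zero], fun _ _ => rfl⟩

open Classical in
/-- The challenge may be translated by a constant if no pad is queried, and by any vector if the
pads are distinct and fewer than `t` of them are queried. -/
theorem shiftGame_of_hits (δ δ' : Fin S.n → S.F) (J : Finset (Fin S.n))
    (hJ : (J = ∅ ∧ ∃ s, δ' = fun _ => s) ∨
      (Function.Injective (padArg sk (H (salt, pin)) r) ∧ J.card < S.t))
    (φ : Bool → Mem A.V → ISt S.N → ℝ≥0∞)
    (hφ : ∀ e m st, hits (padArg sk (H (salt, pin)) r) st ≠ J → φ e m st = 0) :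
    shiftGame A Q β sk H salt pin r k (fun j => δ j + δ' j) φ =
      shiftGame A Q β sk H salt pin r k δ φ := by
  set c := padArg sk (H (salt, pin)) r with hc
  rcases hJ with ⟨rfl, s, rfl⟩ | ⟨hinj, hcard⟩
  · refine shiftGame_translate A Q β sk H salt pin r k δ _ (fun z => if ∃ j, c j = z then s else 0)
      0 (fun j => ?_) φ fun e m st hst => hφ e m st fun h0 => hst fun z hz => ?_
    · rw [if_pos ⟨j, rfl⟩]; simp [poly]
    · rw [if_neg]
      rintro ⟨j, rfl⟩
      exact Finset.notMem_empty j (h0 ▸ mem_hits.2 hz)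
  · obtain ⟨a, ha⟩ := exists_poly_eq J hcard δ'
    refine shiftGame_translate A Q β sk H salt pin r k δ _
      (fun z => if h : ∃ j, c j = z then δ' h.choose - poly a h.choose else 0)
      a (fun j => ?_) φ fun e m st hst => hφ e m st fun h0 => hst fun z hz => ?_
    · have h : ∃ j', c j' = c j := ⟨j, rfl⟩
      have : h.choose = j := hinj h.choose_spec
      simp only [← hc]
      rw [dif_pos h, this, sub_add_cancel]
    · split
      · rename_i h
        have hm : h.choose ∈ hits c st := mem_hits.2 (by rw [h.choose_spec]; exact hz)
        rw [ha _ (h0 ▸ hm), sub_self]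
      · rfl

/-- The game with uniform pads, independent of everything else. -/
def unifGame (φ : Bool → Mem A.V → ISt S.N → ℝ≥0∞) : ℝ≥0∞ :=
  wp (unif (S.G → S.F)) fun h => wp (unif (Fin S.n → S.F)) fun u =>
    core A Q (encSel k β) (fun i => S.pubKey (sk i)) sk H h salt (fun j => S.g ^ (r j).val) u φ

/-- The average of the translated games over all translations is the game with uniform pads. -/
theorem wp_shiftGame (φ : Bool → Mem A.V → ISt S.N → ℝ≥0∞) :
    (wp (unif (Fin S.n → S.F)) fun δ => shiftGame A Q β sk H salt pin r k δ φ) =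
      unifGame A Q β sk H salt r k φ := by
  unfold shiftGame unifGame
  rw [wp_comm]
  refine wp_congr fun h => ?_
  rw [wp_comm]
  refine (wp_congr fun a => ?_).trans (wp_const (unif (Fin (S.t - 1) → S.F)) _)
  refine Eq.trans ?_ (wp_unif_add (α := Fin S.n → S.F)
    (fun j => h (padArg sk (H (salt, pin)) r j) + poly a j) _).symm
  refine wp_congr fun δ => ?_
  congr 1
  funext j
  rw [Pi.add_apply]
  ring

/-- Splitting a function of the outcome according to the set of queried pads. -/
theorem shiftGame_split (c : Fin S.n → S.G) (δ : Fin S.n → S.F)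
    (φ : Bool → Mem A.V → ISt S.N → ℝ≥0∞) :
    shiftGame A Q β sk H salt pin r k δ φ = ∑ J : Finset (Fin S.n),
      shiftGame A Q β sk H salt pin r k δ fun e m st => if hits c st = J then φ e m st else 0 := by
  unfold shiftGame
  rw [← wp_sum]
  refine wp_congr fun h => ?_
  rw [← wp_sum]
  refine wp_congr fun a => ?_
  rw [← core_sum]
  congr 1
  funext e m st
  simp

theorem shiftGame_zero (δ : Fin S.n → S.F) :
    shiftGame A Q β sk H salt pin r k δ (fun _ _ _ => 0) = 0 := by
  simp only [shiftGame, core_zero, wp_const]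

/-- If the outcome is such that the shares determine nothing about the key, then it does not matter
whether the shares are shares of the key or of zero. -/
theorem shiftGame_const (s : S.F) (φ : Bool → Mem A.V → ISt S.N → ℝ≥0∞)
    (hφ : ∀ e m st, ¬ (hits (padArg sk (H (salt, pin)) r) st = ∅ ∨
      (Function.Injective (padArg sk (H (salt, pin)) r) ∧
        (hits (padArg sk (H (salt, pin)) r) st).card < S.t)) → φ e m st = 0) :
    shiftGame A Q β sk H salt pin r k (fun _ => s) φ =
      shiftGame A Q β sk H salt pin r k (fun _ => 0) φ := by
  set c := padArg sk (H (salt, pin)) r with hc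
  rw [shiftGame_split _ _ _ _ _ _ _ _ _ c, shiftGame_split _ _ _ _ _ _ _ _ _ c (fun _ => 0)]
  refine Finset.sum_congr rfl fun J _ => ?_
  by_cases hJ : J = ∅ ∨ (Function.Injective c ∧ J.card < S.t)
  · have := shiftGame_of_hits A Q β sk H salt pin r k (fun _ => 0) (fun _ => s) J
      (hJ.imp (fun h => ⟨h, s, rfl⟩) id) (fun e m st => if hits c st = J then φ e m st else 0)
      fun e m st h => if_neg h
    simpa only [zero_add] using this
  · have : (fun e m st => if hits c st = J then φ e m st else 0) = fun _ _ _ => 0 := by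
      funext e m st
      split
      · rename_i h; subst h; exact hφ e m st hJ
      · rfl
    rw [this, shiftGame_zero, shiftGame_zero]

/-- Fewer than `t` queried pads, all of them distinct, leave the challenge uniform. -/
theorem shiftGame_eq_unifGame (hinj : Function.Injective (padArg sk (H (salt, pin)) r))
    (δ : Fin S.n → S.F) (φ : Bool → Mem A.V → ISt S.N → ℝ≥0∞)
    (hφ : ∀ e m st, S.t ≤ (hits (padArg sk (H (salt, pin)) r) st).card → φ e m st = 0) :
    shiftGame A Q β sk H salt pin r k δ φ = unifGame A Q β sk H salt r k φ := by
  set c := padArg sk (H (salt, pin)) r with hc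
  rw [← wp_shiftGame A Q β sk H salt pin r k φ, ← wp_const (unif (Fin S.n → S.F))
    (shiftGame A Q β sk H salt pin r k δ φ)]
  refine wp_congr fun δ' => ?_
  rw [shiftGame_split _ _ _ _ _ _ _ _ _ c, shiftGame_split _ _ _ _ _ _ _ _ _ c δ']
  refine Finset.sum_congr rfl fun J _ => ?_
  by_cases hJ : J.card < S.t
  · have := shiftGame_of_hits A Q β sk H salt pin r k δ (fun j => δ' j - δ j) J
      (Or.inr ⟨hinj, hJ⟩) (fun e m st => if hits c st = J then φ e m st else 0)
      fun e m st h => if_neg h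
    simp only [add_sub_cancel] at this
    exact this.symm
  · have : (fun e m st => if hits c st = J then φ e m st else 0) = fun _ _ _ => 0 := by
      funext e m st
      split
      · rename_i h; subst h; exact hφ e m st (not_lt.1 hJ)
      · rfl
    rw [this, shiftGame_zero, shiftGame_zero]

/-- The indicator of the event that the adversary passes the length test and queries at least `t` of
the pads. -/
def manyHits (c : Fin S.n → S.G) (e : Bool) (_ : Mem A.V) (st : ISt S.N) : ℝ≥0∞ :=
  if e ∧ S.t ≤ (hits c st).card then 1 else 0

/-- The indicator of the event that the adversary passes the length test and queries fewer than `t`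
of the pads. -/
def fewHits (c : Fin S.n → S.G) (e : Bool) (_ : Mem A.V) (st : ISt S.N) : ℝ≥0∞ :=
  if e ∧ (hits c st).card < S.t then 1 else 0

theorem many_add_few (c : Fin S.n → S.G) :
    (fun e m st => manyHits A c e m st + fewHits A c e m st) = fun e _ _ => if e then 1 else 0 := by
  funext e m st
  unfold manyHits fewHits
  cases e <;> by_cases h : S.t ≤ (hits c st).card <;> simp [h, not_lt.2, not_le.1]

/-- With distinct pads, the probability of many queried pads is that of the game with uniform
pads. -/
theorem shiftGame_manyHits (hinj : Function.Injective (padArg sk (H (salt, pin)) r))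
    (δ : Fin S.n → S.F) :
    shiftGame A Q β sk H salt pin r k δ (manyHits A (padArg sk (H (salt, pin)) r)) =
      unifGame A Q β sk H salt r k (manyHits A (padArg sk (H (salt, pin)) r)) := by
  set c := padArg sk (H (salt, pin)) r with hc
  have hfew := shiftGame_eq_unifGame A Q β sk H salt pin r k hinj δ (fewHits A c)
    fun e m st h => if_neg fun h' => absurd h'.2 (not_lt.2 h)
  have htot : shiftGame A Q β sk H salt pin r k δ
      (fun e m st => manyHits A c e m st + fewHits A c e m st) =
      unifGame A Q β sk H salt r k fun e m st => manyHits A c e m st + fewHits A c e m st := by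
    rw [many_add_few]
    refine wp_congr fun h => ?_
    rw [← wp_const (unif (Fin S.n → S.F)) (wp (unif (Fin (S.t - 1) → S.F)) _)]
    refine wp_congr fun u => ?_
    refine (wp_congr fun a => ?_).trans (wp_const (unif (Fin (S.t - 1) → S.F)) _)
    exact core_const _ _ _ _ _ _ _ _ _ _ (fun e => if e then 1 else 0) _ _ _
  have hU : unifGame A Q β sk H salt r k (fun e m st => manyHits A c e m st + fewHits A c e m st) =
      unifGame A Q β sk H salt r k (manyHits A c) + unifGame A Q β sk H salt r k (fewHits A c) := by
    simp only [unifGame, core_add, wp_add]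
  rw [shiftGame_add, hU, hfew] at htot
  refine (ENNReal.add_left_inj ?_).1 htot
  refine ne_top_of_le_ne_top ENNReal.one_ne_top (wp_le_const fun h => wp_le_const fun u =>
    core_le_one _ _ _ _ _ _ _ _ _ _ fun e m st => ?_)
  unfold fewHits
  split <;> simp

open Classical in
/-- The probability that the shares reveal something, in the games with uniform pads, or that the
pads coincide. -/
def badBound : ℝ≥0∞ :=
  (if 0 < Q ∧ ¬ Function.Injective (padArg sk (H (salt, pin)) r) then 1 else 0) +
    unifGame A Q β sk H salt r k (manyHits A (padArg sk (H (salt, pin)) r))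

/-- Shares of `s` and shares of `s'` are distinguishable only if the pads coincide or `t` of them
are queried. -/
theorem shiftGame_const_le (s s' : S.F) :
    shiftGame A Q β sk H salt pin r k (fun _ => s) (outOne A) ≤
      shiftGame A Q β sk H salt pin r k (fun _ => s') (outOne A) +
        badBound A Q β sk H salt pin r k := by
  classical
  set c := padArg sk (H (salt, pin)) r with hc
  let good : ISt S.N → Prop := fun st =>
    hits c st = ∅ ∨ (Function.Injective c ∧ (hits c st).card < S.t)
  have hsplit : outOne A = fun e m st => (if good st then outOne A e m st else 0) +
      if good st then 0 else outOne A e m st := by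
    funext e m st; split <;> simp
  have hgood : shiftGame A Q β sk H salt pin r k (fun _ => s)
      (fun e m st => if good st then outOne A e m st else 0) ≤
      shiftGame A Q β sk H salt pin r k (fun _ => s') (outOne A) := by
    rw [shiftGame_const _ _ _ _ _ _ _ _ _ s _ fun e m st h => if_neg h,
      ← shiftGame_const _ _ _ _ _ _ _ _ _ s' _ fun e m st h => if_neg h]
    exact shiftGame_mono _ _ _ _ _ _ _ _ _ _ fun e m st => by
      split <;> simp
  rw [hsplit, shiftGame_add, ← hsplit]
  refine add_le_add hgood ?_
  have hle : ∀ e m st, outOne A e m st ≤ 1 := fun e m st => by unfold outOne; split <;> simp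
  unfold badBound
  rw [← hc]
  by_cases hinj : Function.Injective c
  · refine le_add_left ?_
    rw [← shiftGame_manyHits A Q β sk H salt pin r k hinj (fun _ => s)]
    refine shiftGame_mono _ _ _ _ _ _ _ _ _ _ fun e m st => ?_
    split
    · exact bot_le
    · rename_i h
      have : S.t ≤ (hits c st).card := by
        by_contra h'
        exact h (Or.inr ⟨hinj, not_le.1 h'⟩)
      cases e
      · simp [outOne]
      · rw [manyHits, if_pos ⟨rfl, this⟩]
        exact hle _ _ _
  · by_cases hQ : 0 < Q
    · rw [if_pos ⟨hQ, hinj⟩]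
      refine le_add_right (wp_le_const fun h => wp_le_const fun a =>
        core_le_one _ _ _ _ _ _ _ _ _ _ fun e m st => ?_)
      split
      · exact zero_le_one
      · exact hle _ _ _
    · refine le_trans (le_of_eq ?_) bot_le
      refine (wp_congr fun h => (wp_congr fun a => ?_).trans (wp_zero _)).trans (wp_zero _)
      rw [core_congr_inv (ψ := fun _ _ _ => 0), core_zero]
      intro e m st hl _
      refine if_pos (Or.inl ?_)
      have : st.log = [] := List.eq_nil_of_length_eq_zero (by omega)
      simp [hits, this]

end

end LHEParams
end

noncomputable section

/-! ### Probabilities of events -/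

section
variable {α : Type}

open Classical in
/-- The probability of an event. -/
def pr (p : PMF α) (E : α → Prop) : ℝ≥0∞ := wp p fun a => if E a then 1 else 0

theorem pr_le_one (p : PMF α) (E : α → Prop) : pr p E ≤ 1 :=
  wp_le_const fun a => by split <;> simp

theorem pr_mono {p : PMF α} {E E' : α → Prop} (h : ∀ a, E a → E' a) : pr p E ≤ pr p E' :=
  wp_mono fun a => by
    by_cases ha : E a
    · simp [ha, h a ha]
    · simp [ha]

theorem pr_exists_le {ι : Type} (p : PMF α) (s : Finset ι) (E : ι → α → Prop) :
    pr p (fun a => ∃ i ∈ s, E i a) ≤ ∑ i ∈ s, pr p (E i) := by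
  classical
  unfold pr
  rw [← wp_sum]
  refine wp_mono fun a => ?_
  split
  · rename_i h
    obtain ⟨i, hi, h⟩ := h
    exact le_trans (by simp [h]) (Finset.single_le_sum
      (f := fun i => if E i a then (1 : ℝ≥0∞) else 0) (fun _ _ => bot_le) hi)
  · exact bot_le

open Classical in
theorem pr_unif [Fintype α] [Nonempty α] (E : α → Prop) :
    pr (unif α) E = (Finset.univ.filter E).card / Fintype.card α := by
  rw [pr, wp_unif, Finset.sum_boole]

theorem pr_unif_eq [Finite α] [Nonempty α] (b : α) :
    pr (unif α) (fun a => a = b) = (Nat.card α : ℝ≥0∞)⁻¹ := by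
  classical
  have := Fintype.ofFinite α
  rw [pr_unif, Finset.filter_eq' Finset.univ b, if_pos (Finset.mem_univ _), Finset.card_singleton,
    Nat.card_eq_fintype_card, Nat.cast_one, one_div]

/-- The values of a uniform function are independent and uniform. -/
theorem pr_unif_forall {ι : Type} [Finite ι] [Finite α] [Nonempty α] (T : Finset ι) (E : α → Prop) :
    pr (unif (ι → α)) (fun v => ∀ i ∈ T, E (v i)) = pr (unif α) E ^ T.card := by
  classical
  induction T using Finset.induction_on with
  | empty => simp [pr, wp_const]
  | insert i T hi ih =>
      rw [Finset.card_insert_of_notMem hi, pow_succ', ← ih]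
      unfold pr
      rw [wp_unif_resample i]
      have hE : ∀ (x : α) (v : ι → α),
          (∀ l ∈ insert i T, E (Function.update v i x l)) ↔ E x ∧ ∀ l ∈ T, E (v l) := by
        intro x v
        rw [Finset.forall_mem_insert, Function.update_self]
        refine and_congr_right fun _ => forall₂_congr fun l hl => ?_
        rw [Function.update_of_ne (ne_of_mem_of_not_mem hl hi)]
      simp only [hE]
      rw [wp, wp, ← ENNReal.tsum_mul_right]
      refine tsum_congr fun x => ?_
      by_cases hx : E x
      · simp only [hx, true_and, if_true, mul_one]
        congr!
      · simp [hx, wp_const]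

end

/-! ### Few clusters are covered by a small set of keys -/

/-- The positions of a cluster that lie in a set of keys. -/
def covered {N n : ℕ} (C : Finset (Fin N)) (loc : Fin n → Fin N) : Finset (Fin n) :=
  Finset.univ.filter fun j => loc j ∈ C

/-- A random cluster of size `2 t` has at least `t` positions in a given small set of keys with
probability at most `2 ^ (-2 t)`. -/
theorem pr_covered_le {N n t : ℕ} [NeZero N] (hn : n = 2 * t) (C : Finset (Fin N))
    (hC : C.card ≤ N / 16) :
    pr (unif (Fin n → Fin N)) (fun loc => t ≤ (covered C loc).card) ≤ (2⁻¹ : ℝ≥0∞) ^ (2 * t) := by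
  classical
  have h1 : pr (unif (Fin n → Fin N)) (fun loc => t ≤ (covered C loc).card) ≤
      ∑ J ∈ (Finset.univ : Finset (Fin n)).powersetCard t,
        pr (unif (Fin n → Fin N)) (fun loc => ∀ j ∈ J, loc j ∈ C) := by
    refine le_trans (pr_mono fun loc h => ?_) (pr_exists_le _ _ _)
    obtain ⟨J, hJ, hcard⟩ := Finset.exists_subset_card_eq h
    exact ⟨J, Finset.mem_powersetCard.2 ⟨Finset.subset_univ _, hcard⟩, fun j hj => by
      simpa [covered] using hJ hj⟩
  have hq : pr (unif (Fin N)) (fun i => i ∈ C) ≤ (2⁻¹ : ℝ≥0∞) ^ 4 := by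
    have huniv : ∀ _ : DecidablePred (· ∈ C), (Finset.univ.filter fun i => i ∈ C) = C := by
      intro _; ext; simp
    rw [pr_unif, huniv, Fintype.card_fin]
    refine ENNReal.div_le_of_le_mul ?_
    rw [← ENNReal.inv_pow, ← ENNReal.div_eq_inv_mul, ENNReal.le_div_iff_mul_le (by simp) (by simp)]
    have : C.card * 16 ≤ N := by omega
    norm_num
    exact_mod_cast this
  refine h1.trans ?_
  have h2 : ∀ J ∈ (Finset.univ : Finset (Fin n)).powersetCard t,
      pr (unif (Fin n → Fin N)) (fun loc => ∀ j ∈ J, loc j ∈ C) ≤ ((2⁻¹ : ℝ≥0∞) ^ 4) ^ t := by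
    intro J hJ
    rw [pr_unif_forall J fun i => i ∈ C, (Finset.mem_powersetCard.1 hJ).2]
    exact pow_le_pow_left' hq t
  refine (Finset.sum_le_card_nsmul _ _ _ h2).trans ?_
  rw [Finset.card_powersetCard, Finset.card_univ, Fintype.card_fin, nsmul_eq_mul]
  have h3 : ((n.choose t : ℕ) : ℝ≥0∞) ≤ 2 ^ (2 * t) := by
    rw [hn]; exact_mod_cast Nat.choose_le_two_pow _ _
  refine (mul_le_mul_left h3 _).trans (le_of_eq ?_)
  -- there are at most `4 ^ t` sets of `t` positions, each covered with probability `16 ^ (-t)`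
  rw [← pow_mul, show 4 * t = 2 * t + 2 * t by ring, pow_add, ← mul_assoc, ← mul_pow,
    ENNReal.mul_inv_cancel (by simp) (by simp), one_pow, one_mul]

/-- The sets of at most `N / 16` keys. -/
def smallSets (N : ℕ) : Finset (Finset (Fin N)) :=
  Finset.univ.filter fun C => C.card ≤ N / 16

namespace LHEParams

variable {S : LHEParams}

/-- For some small set of keys there are at least `m` PINs whose clusters have at least `t`
positions in the set. -/
def Crowded (S : LHEParams) (m : ℕ) (H : S.Salt × S.Pin → Fin S.n → Fin S.N) (salt : S.Salt) :
    Prop :=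
  ∃ C ∈ smallSets S.N, ∃ T : Finset S.Pin, T.card = m ∧
    ∀ pin ∈ T, S.t ≤ (covered C (H (salt, pin))).card

/-- The union bound over the small sets and the sets of `m` PINs; clusters of different PINs are
independent. -/
theorem pr_crowded_le (hn : S.n = 2 * S.t) (m : ℕ) (salt : S.Salt) :
    pr (unif (S.Salt × S.Pin → Fin S.n → Fin S.N)) (fun H => S.Crowded m H salt) ≤
      (smallSets S.N).card * ((Nat.card S.Pin : ℝ≥0∞) ^ m * ((2⁻¹ : ℝ≥0∞) ^ (2 * S.t)) ^ m) := by
  classical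
  have := Fintype.ofFinite S.Pin
  have h1 : ∀ C ∈ smallSets S.N, ∀ T ∈ (Finset.univ : Finset S.Pin).powersetCard m,
      pr (unif (S.Salt × S.Pin → Fin S.n → Fin S.N))
        (fun H => ∀ pin ∈ T, S.t ≤ (covered C (H (salt, pin))).card) ≤
        ((2⁻¹ : ℝ≥0∞) ^ (2 * S.t)) ^ m := by
    intro C hC T hT
    have hinj : Function.Injective fun pin : S.Pin => (salt, pin) := fun a b h => (Prod.mk.inj h).2
    have := pr_unif_forall (T.map ⟨_, hinj⟩)
      fun loc : Fin S.n → Fin S.N => S.t ≤ (covered C loc).card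
    rw [Finset.card_map, (Finset.mem_powersetCard.1 hT).2] at this
    refine le_trans (le_of_eq ?_) (this.le.trans (pow_le_pow_left'
      (pr_covered_le hn C (Finset.mem_filter.1 hC).2) m))
    congr 1
    funext H
    simp
  have h2 : ∀ C ∈ smallSets S.N, pr (unif (S.Salt × S.Pin → Fin S.n → Fin S.N))
      (fun H => ∃ T : Finset S.Pin, T.card = m ∧
        ∀ pin ∈ T, S.t ≤ (covered C (H (salt, pin))).card) ≤
        (Nat.card S.Pin : ℝ≥0∞) ^ m * ((2⁻¹ : ℝ≥0∞) ^ (2 * S.t)) ^ m := by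
    intro C hC
    refine (pr_mono (E' := fun H => ∃ T ∈ (Finset.univ : Finset S.Pin).powersetCard m,
      ∀ pin ∈ T, S.t ≤ (covered C (H (salt, pin))).card) fun H ⟨T, hT, h⟩ =>
      ⟨T, Finset.mem_powersetCard.2 ⟨Finset.subset_univ _, hT⟩, h⟩).trans ?_
    refine (pr_exists_le _ _ _).trans ((Finset.sum_le_card_nsmul _ _ _ (h1 C hC)).trans ?_)
    rw [Finset.card_powersetCard, Finset.card_univ, nsmul_eq_mul, Nat.card_eq_fintype_card]
    refine mul_le_mul_left ?_ _
    exact_mod_cast Nat.choose_le_pow _ _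
  refine (pr_exists_le _ _ _).trans ((Finset.sum_le_card_nsmul _ _ _ h2).trans ?_)
  rw [nsmul_eq_mul]

end LHEParams

/-- There are at most `2 ^ (3 N / 8)` sets of at most `N / 16` keys. -/
theorem card_smallSets_le (N : ℕ) : ((smallSets N).card : ℝ) ≤ (2 : ℝ) ^ (3 * (N : ℝ) / 8) := by
  -- the sets are weighted with `8 ^ (-card)`; the total weight of all sets is `(9 / 8) ^ N`
  have h1 : ((smallSets N).card : ℝ) * (1 / 8 : ℝ) ^ (N / 16) ≤ (9 / 8 : ℝ) ^ N := by
    have hsum : ∑ C : Finset (Fin N), (1 / 8 : ℝ) ^ C.card = (9 / 8 : ℝ) ^ N := by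
      have := Finset.sum_pow_mul_eq_add_pow (1 / 8 : ℝ) 1 (Finset.univ : Finset (Fin N))
      simp only [one_pow, mul_one, Finset.powerset_univ, Finset.card_univ, Fintype.card_fin] at this
      rw [this]; norm_num
    rw [← hsum, ← nsmul_eq_mul]
    refine (Finset.card_nsmul_le_sum (smallSets N) (fun C => (1 / 8 : ℝ) ^ C.card) _ ?_).trans
      (Finset.sum_le_sum_of_subset_of_nonneg (Finset.subset_univ _) fun _ _ _ => by positivity)
    intro C hC
    exact pow_le_pow_of_le_one (by norm_num) (by norm_num) (Finset.mem_filter.1 hC).2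
  have h2 : ((smallSets N).card : ℝ) ≤ (9 / 8 : ℝ) ^ N * 8 ^ (N / 16) := by
    have h8 : (0 : ℝ) < 8 ^ (N / 16) := by positivity
    rw [one_div, inv_pow, mul_inv_le_iff₀ h8] at h1
    exact h1
  refine h2.trans ?_
  have h3 : (9 / 8 : ℝ) ^ N ≤ (2 : ℝ) ^ (3 * (N : ℝ) / 16) := by
    have : (9 / 8 : ℝ) ≤ (2 : ℝ) ^ (3 / 16 : ℝ) := by
      rw [← Real.rpow_le_rpow_iff (z := 16) (by norm_num) (by positivity) (by norm_num),
        ← Real.rpow_mul (by norm_num)]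
      norm_num
    calc (9 / 8 : ℝ) ^ N ≤ ((2 : ℝ) ^ (3 / 16 : ℝ)) ^ N := by gcongr
      _ = _ := by rw [← Real.rpow_natCast, ← Real.rpow_mul (by norm_num)]; ring_nf
  have h4 : (8 : ℝ) ^ (N / 16) ≤ (2 : ℝ) ^ (3 * (N : ℝ) / 16) := by
    have h8 : (8 : ℝ) = 2 ^ (3 : ℝ) := by norm_num
    rw [h8, ← Real.rpow_natCast, ← Real.rpow_mul (by norm_num)]
    refine Real.rpow_le_rpow_of_exponent_le (by norm_num) ?_
    have : ((N / 16 : ℕ) : ℝ) ≤ (N : ℝ) / 16 := by exact_mod_cast Nat.cast_div_le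
    linarith
  calc (9 / 8 : ℝ) ^ N * 8 ^ (N / 16)
      ≤ (2 : ℝ) ^ (3 * (N : ℝ) / 16) * (2 : ℝ) ^ (3 * (N : ℝ) / 16) := by gcongr
    _ = _ := by rw [← Real.rpow_add (by norm_num)]; ring_nf
end

noncomputable section

/-! ### The probability that the shares reveal something -/

namespace LHEParams

variable {S : LHEParams}

theorem orderOf_g (S : LHEParams) : orderOf S.g = S.p := by
  rw [← S.card_G]; exact orderOf_eq_card_of_forall_mem_zpowers S.g_gen

theorem g_pow_eq_iff (S : LHEParams) (a b : ℕ) : S.g ^ a = S.g ^ b ↔ (a : ZMod S.p) = b := by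
  rw [pow_eq_pow_iff_modEq, orderOf_g, ZMod.natCast_eq_natCast_iff]

theorem pubKey_pow (x r : ZMod S.p) : S.pubKey x ^ r.val = S.g ^ (x * r).val := by
  rw [pubKey, ← pow_mul, g_pow_eq_iff]
  simp

theorem pubKey_injective : Function.Injective S.pubKey := fun x y h => by
  have := (S.g_pow_eq_iff _ _).1 h
  simpa using this

theorem padArg_eq (sk : Fin S.N → ZMod S.p) (loc : Fin S.n → Fin S.N) (r : Fin S.n → ZMod S.p)
    (j : Fin S.n) : padArg sk loc r j = S.g ^ (sk (loc j) * r j).val := pubKey_pow _ _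

theorem padArg_eq_iff (sk : Fin S.N → ZMod S.p) (loc : Fin S.n → Fin S.N) (r : Fin S.n → ZMod S.p)
    (j j' : Fin S.n) : padArg sk loc r j = padArg sk loc r j' ↔
      sk (loc j) * r j = sk (loc j') * r j' := by
  rw [padArg_eq, padArg_eq]
  exact pubKey_injective.eq_iff

/-- Two pads coincide with probability at most `2 / p`: the second one is uniform, given the first,
unless its secret key is zero. -/
theorem wp_pad_collision_le (loc : Fin S.n → Fin S.N) {j j' : Fin S.n} (hj : j ≠ j') :
    (wp (unif (Fin S.N → ZMod S.p)) fun sk => pr (unif (Fin S.n → ZMod S.p))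
      fun r => padArg sk loc r j = padArg sk loc r j') ≤ 2 * (S.p : ℝ≥0∞)⁻¹ := by
  classical
  have hinv : ∀ b : ZMod S.p, pr (unif (ZMod S.p)) (fun x => x = b) = (S.p : ℝ≥0∞)⁻¹ := fun b => by
    rw [pr_unif_eq, Nat.card_zmod]
  have h1 : ∀ sk : Fin S.N → ZMod S.p, pr (unif (Fin S.n → ZMod S.p))
      (fun r => padArg sk loc r j = padArg sk loc r j') ≤
      (S.p : ℝ≥0∞)⁻¹ + if sk (loc j) = 0 then 1 else 0 := by
    intro sk
    by_cases h0 : sk (loc j) = 0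
    · rw [if_pos h0]; exact le_add_left (pr_le_one _ _)
    · rw [if_neg h0, add_zero, pr, wp_unif_resample j, wp_comm]
      refine wp_le_const fun r => ?_
      rw [← hinv ((sk (loc j))⁻¹ * (sk (loc j') * r j'))]
      refine pr_mono fun x hx => ?_
      rw [padArg_eq_iff, Function.update_self, Function.update_of_ne hj.symm] at hx
      rw [← hx, inv_mul_cancel_left₀ h0]
  refine (wp_mono h1).trans ?_
  rw [wp_add, wp_const, wp_unif_resample (loc j), two_mul]
  refine add_le_add le_rfl ?_
  rw [wp_comm]
  refine wp_le_const fun sk => ?_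
  rw [← hinv 0]
  simp only [Function.update_self]
  exact wp_mono fun x => by congr!

/-- Some two pads coincide with probability at most `2 n² / p`. -/
theorem wp_not_injective_le (loc : Fin S.n → Fin S.N) :
    (wp (unif (Fin S.N → ZMod S.p)) fun sk => pr (unif (Fin S.n → ZMod S.p))
      fun r => ¬ Function.Injective (padArg sk loc r)) ≤
      (S.n * S.n : ℕ) * (2 * (S.p : ℝ≥0∞)⁻¹) := by
  classical
  have h1 : ∀ sk : Fin S.N → ZMod S.p, pr (unif (Fin S.n → ZMod S.p))
      (fun r => ¬ Function.Injective (padArg sk loc r)) ≤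
      ∑ jj ∈ Finset.univ.filter (fun jj : Fin S.n × Fin S.n => jj.1 ≠ jj.2),
        pr (unif (Fin S.n → ZMod S.p)) fun r => padArg sk loc r jj.1 = padArg sk loc r jj.2 := by
    intro sk
    refine le_trans (pr_mono fun r hr => ?_) (pr_exists_le _ _ _)
    simp only [Function.Injective, not_forall] at hr
    obtain ⟨j, j', h, hne⟩ := hr
    exact ⟨(j, j'), by simpa using hne, h⟩
  refine (wp_mono h1).trans ?_
  rw [wp_sum]
  refine (Finset.sum_le_card_nsmul _ _ (2 * (S.p : ℝ≥0∞)⁻¹) fun jj hjj =>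
    wp_pad_collision_le loc (Finset.mem_filter.1 hjj).2).trans ?_
  rw [nsmul_eq_mul]
  refine mul_le_mul_left ?_ _
  have := Finset.card_filter_le (Finset.univ : Finset (Fin S.n × Fin S.n)) fun jj => jj.1 ≠ jj.2
  rw [Finset.card_univ, Fintype.card_prod, Fintype.card_fin] at this
  exact_mod_cast this

section
variable (A : LHEAdversary S) (Q : ℕ) (β : Bool)

open Classical in
/-- The indicator of the event that the query number `ρ` is the argument of the pad at position `j`,
whose key is not corrupted. -/
def hitEv (c : Fin S.n → S.G) (loc : Fin S.n → Fin S.N) (ρ : ℕ) (j : Fin S.n) (_ : Bool)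
    (_ : Mem A.V) (st : ISt S.N) : ℝ≥0∞ :=
  if st.log[ρ]? = some (S.encG (c j)) ∧ loc j ∉ st.cor then 1 else 0

/-- The indicator of the event that at least `t` of the keys at the location are corrupted. -/
def coverEv (loc : Fin S.n → Fin S.N) (_ : Bool) (_ : Mem A.V) (st : ISt S.N) : ℝ≥0∞ :=
  if S.t ≤ (covered st.cor loc).card ∧ st.cor ∈ smallSets S.N then 1 else 0

theorem unifGame_mono (sk : Fin S.N → ZMod S.p) (H : S.Salt × S.Pin → Fin S.n → Fin S.N)
    (salt : S.Salt) (r : Fin S.n → ZMod S.p) (k : S.F)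
    {φ ψ : Bool → Mem A.V → ISt S.N → ℝ≥0∞}
    (hφ : ∀ e m s, s.log.length ≤ Q → s.cor.card ≤ S.N / 16 → φ e m s ≤ ψ e m s) :
    unifGame A Q β sk H salt r k φ ≤ unifGame A Q β sk H salt r k ψ := by
  classical
  refine wp_mono fun h => wp_mono fun u => ?_
  rw [core_congr_inv A Q _ _ _ _ _ _ _ _ (φ := φ) (ψ := fun e m s =>
    if s.log.length ≤ Q ∧ s.cor.card ≤ S.N / 16 then φ e m s else 0)
    fun e m s h1 h2 => (if_pos ⟨h1, h2⟩).symm]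
  refine core_mono _ _ _ _ _ _ _ _ _ _ fun e m s => ?_
  split
  · rename_i h; exact hφ _ _ _ h.1 h.2
  · exact bot_le

/-- If many pads are queried, then one of them belongs to a key that is not corrupted, or many keys
at the location are corrupted. -/
theorem unifGame_manyHits_le (sk : Fin S.N → ZMod S.p) (H : S.Salt × S.Pin → Fin S.n → Fin S.N)
    (salt : S.Salt) (r : Fin S.n → ZMod S.p) (k : S.F) (c : Fin S.n → S.G)
    (loc : Fin S.n → Fin S.N) :
    unifGame A Q β sk H salt r k (manyHits A c) ≤
      (∑ ρ : Fin Q, ∑ j, unifGame A Q β sk H salt r k (hitEv A c loc ρ j)) +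
        unifGame A Q β sk H salt r k (coverEv A loc) := by
  classical
  have : (∑ ρ : Fin Q, ∑ j, unifGame A Q β sk H salt r k (hitEv A c loc ρ j)) +
        unifGame A Q β sk H salt r k (coverEv A loc) = unifGame A Q β sk H salt r k fun e m st =>
      (∑ ρ : Fin Q, ∑ j, hitEv A c loc ρ j e m st) + coverEv A loc e m st := by
    simp only [unifGame, core_add, wp_add, core_sum, wp_sum]
  rw [this]
  refine unifGame_mono A Q β sk H salt r k fun e m st hlog hcor => ?_
  unfold manyHits
  split
  · rename_i hmany
    by_cases hall : ∀ j ∈ hits c st, loc j ∈ st.cor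
    · refine le_add_left ?_
      rw [coverEv, if_pos]
      refine ⟨hmany.2.trans (Finset.card_le_card fun j hj => ?_), ?_⟩
      · simpa [covered] using hall j hj
      · simpa [smallSets] using hcor
    · refine le_add_right ?_
      push Not at hall
      obtain ⟨j, hj, hnc⟩ := hall
      obtain ⟨ρ, hρ, hget⟩ := List.mem_iff_getElem.1 (mem_hits.1 hj)
      have h1 : hitEv A c loc ρ j e m st = 1 :=
        if_pos ⟨by rw [List.getElem?_eq_getElem hρ, hget], hnc⟩
      rw [← h1]
      refine le_trans ?_ (Finset.single_le_sum (f := fun ρ : Fin Q =>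
        ∑ j, hitEv A c loc ρ j e m st) (fun _ _ => bot_le) (Finset.mem_univ ⟨ρ, by omega⟩))
      exact Finset.single_le_sum (f := fun j => hitEv A c loc ρ j e m st) (fun _ _ => bot_le)
        (Finset.mem_univ j)
  · exact bot_le

/-- In the games with uniform pads the PIN is independent of the adversary's view, so that a
corrupted set covers the location only if many clusters are covered by a small set or the PIN is one
of few. -/
theorem avg_coverEv_le (m : ℕ) (hm : 0 < m) (hn : S.n = 2 * S.t) :
    S.avg (fun sk H salt pin r k => unifGame A Q β sk H salt r k (coverEv A (H (salt, pin)))) ≤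
      ((m - 1 : ℕ) : ℝ≥0∞) / Nat.card S.Pin +
      (smallSets S.N).card * ((Nat.card S.Pin : ℝ≥0∞) ^ m * ((2⁻¹ : ℝ≥0∞) ^ (2 * S.t)) ^ m) := by
  classical
  have := Fintype.ofFinite S.Pin
  unfold avg
  refine wp_le_const fun sk => ?_
  rw [wp_comm]
  refine wp_le_const fun salt => ?_
  refine le_trans ?_ (add_le_add_right (pr_crowded_le hn m salt) _)
  unfold pr
  rw [← wp_const (unif (S.Salt × S.Pin → Fin S.n → Fin S.N)) (((m - 1 : ℕ) : ℝ≥0∞) / _), ← wp_add]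
  refine wp_mono fun H => ?_
  rw [wp_comm]
  refine wp_le_const fun r => ?_
  rw [wp_comm]
  refine wp_le_const fun k => ?_
  unfold unifGame
  rw [wp_comm]
  refine wp_le_const fun h => ?_
  rw [wp_comm]
  refine wp_le_const fun u => ?_
  -- the PIN can be drawn at the end
  have hpull : (wp (unif S.Pin) fun pin => core A Q (encSel k β) (fun i => S.pubKey (sk i)) sk H h
      salt (fun j => S.g ^ (r j).val) u (coverEv A (H (salt, pin)))) =
      core A Q (encSel k β) (fun i => S.pubKey (sk i)) sk H h salt (fun j => S.g ^ (r j).val) u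
        fun e m st => wp (unif S.Pin) fun pin => coverEv A (H (salt, pin)) e m st := by
    refine (wp_comm _ _ _).trans (wp_congr fun x => (wp_comm _ _ _).trans (wp_congr fun y => ?_))
    exact wp_comm _ _ _
  rw [hpull]
  refine wp_le_const fun x => wp_le_const fun y => wp_le_const fun z => ?_
  generalize z.2 = st
  unfold coverEv
  by_cases hC : st.cor ∈ smallSets S.N
  swap
  · simp [hC, wp_const]
  by_cases hcr : S.Crowded m H salt
  · rw [if_pos hcr]
    exact le_add_left (wp_le_const fun pin => by split <;> simp)
  · rw [if_neg hcr, add_zero]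
    have hfew : (Finset.univ.filter fun pin : S.Pin =>
        S.t ≤ (covered st.cor (H (salt, pin))).card).card < m := by
      by_contra hge
      obtain ⟨T, hT, hTm⟩ := Finset.exists_subset_card_eq (not_lt.1 hge)
      exact hcr ⟨st.cor, hC, T, hTm, fun pin hp => (Finset.mem_filter.1 (hT hp)).2⟩
    simp only [hC, and_true]
    rw [wp_unif, Finset.sum_boole, Nat.card_eq_fintype_card]
    gcongr
    omega

open Classical in
/-- The probability that the reduction solves the Diffie–Hellman problem: the public key at position
`j` of the location and the `j`-th group element of the challenge are replaced by the given group
elements, and the query number `ρ` is the output. -/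
def cdhGame (ρ : ℕ) (j : Fin S.n) : ℝ≥0∞ :=
  wp (unif (ZMod S.p)) fun a => wp (unif (ZMod S.p)) fun b =>
    S.avg fun sk H salt pin r k => wp (unif (S.G → S.F)) fun h => wp (unif (Fin S.n → S.F)) fun u =>
      core A Q (encSel k β) (Function.update (fun i => S.pubKey (sk i)) (H (salt, pin) j)
        (S.g ^ a.val)) sk H h salt (Function.update (fun j => S.g ^ (r j).val) j (S.g ^ b.val)) u
        fun _ _ st => if st.log[ρ]? = some (S.encG (S.g ^ (a * b).val)) then 1 else 0

/-- A query for the pad of a key that is not corrupted solves the Diffie–Hellman problem. The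
reduction does not know the secret key of the public key that it replaces, but the answer to the
corruption of this key does not matter for the event. -/
theorem avg_hitEv_le (ρ : ℕ) (j : Fin S.n) :
    S.avg (fun sk H salt pin r k => unifGame A Q β sk H salt r k
      (hitEv A (padArg sk (H (salt, pin)) r) (H (salt, pin)) ρ j)) ≤ cdhGame A Q β ρ j := by
  classical
  -- the choices that the two sides have in common come first
  have hL : ∀ f : (Fin S.N → ZMod S.p) → (S.Salt × S.Pin → Fin S.n → Fin S.N) →
      S.Salt → S.Pin → (Fin S.n → ZMod S.p) → S.F → ℝ≥0∞, S.avg f =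
      wp (unif _) fun H => wp (unif _) fun salt => wp (unif _) fun pin => wp (unif _) fun sk =>
        wp (unif _) fun r => wp (unif _) fun k => f sk H salt pin r k := fun f =>
    (wp_comm _ _ _).trans <| wp_congr fun H => (wp_comm _ _ _).trans <| wp_congr fun salt =>
      wp_comm _ _ _
  have hR : ∀ f : ZMod S.p → ZMod S.p → (Fin S.N → ZMod S.p) →
      (S.Salt × S.Pin → Fin S.n → Fin S.N) →
      S.Salt → S.Pin → (Fin S.n → ZMod S.p) → S.F → ℝ≥0∞,
      (wp (unif _) fun a => wp (unif _) fun b => S.avg (f a b)) =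
      wp (unif _) fun H => wp (unif _) fun salt => wp (unif _) fun pin =>
        wp (unif _) fun a => wp (unif _) fun sk => wp (unif _) fun b =>
        wp (unif _) fun r => wp (unif _) fun k => f a b sk H salt pin r k := by
    intro f
    simp only [hL]
    symm
    trans wp (unif _) fun a => wp (unif _) fun H => wp (unif _) fun salt => wp (unif _) fun pin =>
        wp (unif _) fun b => wp (unif _) fun sk =>
        wp (unif _) fun r => wp (unif _) fun k => f a b sk H salt pin r k
    · symm
      exact (wp_comm _ _ _).trans <| wp_congr fun H => (wp_comm _ _ _).trans <|
        wp_congr fun salt => (wp_comm _ _ _).trans <| wp_congr fun pin => wp_congr fun a =>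
        wp_comm _ _ _
    · refine wp_congr fun a => Eq.symm ?_
      exact (wp_comm _ _ _).trans <| wp_congr fun H => (wp_comm _ _ _).trans <|
        wp_congr fun salt => wp_comm _ _ _
  rw [hL, cdhGame, hR]
  refine wp_mono fun H => wp_mono fun salt => wp_mono fun pin => ?_
  rw [wp_unif_resample (H (salt, pin) j)]
  refine wp_mono fun a => wp_mono fun sk => ?_
  rw [wp_unif_resample j]
  refine wp_mono fun b => wp_mono fun r => wp_mono fun k => wp_mono fun h => wp_mono fun u => ?_
  set i := H (salt, pin) j with hi
  have hpk : (fun l => S.pubKey (Function.update sk i a l)) =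
      Function.update (fun l => S.pubKey (sk l)) i (S.g ^ a.val) := by
    funext l
    by_cases hl : l = i
    · subst hl; simp [pubKey]
    · simp [hl]
  have hR' : (fun l => S.g ^ (Function.update r j b l).val) =
      Function.update (fun l => S.g ^ (r l).val) j (S.g ^ b.val) := by
    funext l
    by_cases hl : l = j
    · subst hl; simp
    · simp [hl]
  have hpad : padArg (Function.update sk i a) (H (salt, pin)) (Function.update r j b) j =
      S.g ^ (a * b).val := by
    rw [padArg_eq, ← hi]; simp
  rw [hpk, hR']
  refine le_of_eq_of_le (core_congr_local A Q _ _ _ H h salt _ u (sk' := sk) (h' := h) ?_) ?_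
  swap
  · refine core_mono _ _ _ _ _ _ _ _ _ _ fun e m st => ?_
    unfold hitEv
    rw [hpad]
    by_cases h' : st.log[ρ]? = some (S.encG (S.g ^ (a * b).val))
    · rw [if_pos h']; split <;> simp
    · rw [if_neg fun h'' => h' h''.1]; exact bot_le
  · intro e m st hst
    refine if_neg fun h' => hst ⟨fun _ _ => rfl, fun l hl => ?_⟩
    exact Function.update_of_ne (by rintro rfl; exact h'.2 hl) _ _

/-- The bound on the distance between the real and the simulated experiment. -/
theorem avg_badBound_le (m : ℕ) (hm : 0 < m) (hn : S.n = 2 * S.t) :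
    S.avg (fun sk H salt pin r k => badBound A Q β sk H salt pin r k) ≤
      (if 0 < Q then (S.n * S.n : ℕ) * (2 * (S.p : ℝ≥0∞)⁻¹) else 0) +
      ((∑ ρ : Fin Q, ∑ j, cdhGame A Q β ρ j) +
      (((m - 1 : ℕ) : ℝ≥0∞) / Nat.card S.Pin +
      (smallSets S.N).card * ((Nat.card S.Pin : ℝ≥0∞) ^ m * ((2⁻¹ : ℝ≥0∞) ^ (2 * S.t)) ^ m))) := by
  classical
  have hadd : ∀ f g : (Fin S.N → ZMod S.p) → (S.Salt × S.Pin → Fin S.n → Fin S.N) →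
      S.Salt → S.Pin → (Fin S.n → ZMod S.p) → S.F → ℝ≥0∞,
      S.avg (fun sk H salt pin r k => f sk H salt pin r k + g sk H salt pin r k) =
        S.avg f + S.avg g := fun f g => by simp only [avg, wp_add]
  have hsum : ∀ {ι : Type} (s : Finset ι) (f : ι → (Fin S.N → ZMod S.p) →
      (S.Salt × S.Pin → Fin S.n → Fin S.N) →
      S.Salt → S.Pin → (Fin S.n → ZMod S.p) → S.F → ℝ≥0∞),
      S.avg (fun sk H salt pin r k => ∑ i ∈ s, f i sk H salt pin r k) =
        ∑ i ∈ s, S.avg (f i) := fun s f => by simp only [avg, wp_sum]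
  unfold badBound
  rw [hadd]
  refine add_le_add ?_ ?_
  · by_cases hQ : 0 < Q
    · simp only [hQ, true_and, if_true]
      unfold avg
      rw [wp_comm]
      refine wp_le_const fun H => ?_
      rw [wp_comm]
      refine wp_le_const fun salt => ?_
      rw [wp_comm]
      refine wp_le_const fun pin => ?_
      refine le_trans (le_of_eq (wp_congr fun sk => ?_)) (wp_not_injective_le (H (salt, pin)))
      refine wp_congr fun r => ?_
      rw [wp_const]
      congr!
    · simp only [hQ, false_and, if_false, avg, wp_const, le_refl]
  · have h1 : S.avg (fun sk H salt pin r k =>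
        unifGame A Q β sk H salt r k (manyHits A (padArg sk (H (salt, pin)) r))) ≤
        S.avg fun sk H salt pin r k => (∑ ρ : Fin Q, ∑ j, unifGame A Q β sk H salt r k
          (hitEv A (padArg sk (H (salt, pin)) r) (H (salt, pin)) ρ j)) +
          unifGame A Q β sk H salt r k (coverEv A (H (salt, pin))) := by
      unfold avg
      exact wp_mono fun sk => wp_mono fun H => wp_mono fun salt => wp_mono fun pin =>
        wp_mono fun r => wp_mono fun k => unifGame_manyHits_le A Q β sk H salt r k _ _
    refine h1.trans ?_
    rw [hadd]
    refine add_le_add ?_ (avg_coverEv_le A Q β m hm hn)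
    simp only [hsum]
    exact Finset.sum_le_sum fun ρ _ => Finset.sum_le_sum fun j _ => avg_hitEv_le A Q β ρ j

end

end LHEParams
end

noncomputable section

/-! ### Loops and memory -/

theorem Mem.set_self {V : Type} (m : Mem V) (a : V) (i : List Str) (s : Str) :
    m.set a i s a i = s := by simp [Mem.set]

theorem Mem.set_of_ne {V : Type} (m : Mem V) {a b : V} (h : b ≠ a) (i j : List Str) (s : Str) :
    m.set a i s b j = m b j := by simp [Mem.set, h]

open Classical in
theorem Mem.setVec_apply {V : Type} (m : Mem V) (a : V) {k : ℕ} (v : Fin k → Str) (b : V)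
    (j : List Str) : m.setVec a v b j =
      if h : ∃ i, b = a ∧ j = [idxCode k i] then v h.choose else m b j := by
  have key : ∀ (l : List (Fin k)) (m : Mem V),
      (∀ i, b = a → j = [idxCode k i] →
        (l.foldl (fun m' i => m'.set a [idxCode k i] (v i)) m) b j =
          if i ∈ l then v i else m b j) ∧
      ((¬ ∃ i, b = a ∧ j = [idxCode k i]) →
        (l.foldl (fun m' i => m'.set a [idxCode k i] (v i)) m) b j = m b j) := by
    intro l
    induction l with
    | nil => intro m; simp
    | cons x l ih =>
        intro m
        refine ⟨fun i hb hj => ?_, fun hno => ?_⟩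
        · rw [List.foldl_cons, (ih _).1 i hb hj]
          by_cases hi : i ∈ l
          · simp [hi]
          · rw [if_neg hi]
            by_cases hx : i = x
            · subst hx; simp [Mem.set, hb, hj]
            · have : j ≠ [idxCode k x] := by
                rw [hj]; intro h
                exact hx ((idxCode k).injective (List.singleton_injective h))
              simp [Mem.set, this, hi, hx]
        · rw [List.foldl_cons, (ih _).2 hno]
          have : ¬ (b = a ∧ j = [idxCode k x]) := fun h => hno ⟨x, h⟩
          simp [Mem.set, this]
  unfold Mem.setVec
  split
  · rename_i h
    rw [(key _ m).1 h.choose h.choose_spec.1 h.choose_spec.2, if_pos (List.mem_finRange _)]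
  · rename_i h
    exact (key _ m).2 h

theorem Mem.setVec_self {V : Type} (m : Mem V) (a : V) {k : ℕ} (v : Fin k → Str) (i : Fin k) :
    m.setVec a v a [idxCode k i] = v i := by
  have h : ∃ i', a = a ∧ [idxCode k i] = [idxCode k i'] := ⟨i, rfl, rfl⟩
  rw [Mem.setVec_apply, dif_pos h]
  congr 1
  exact ((idxCode k).injective (List.singleton_injective h.choose_spec.2)).symm

theorem Mem.setVec_of_ne {V : Type} (m : Mem V) (a : V) {k : ℕ} (v : Fin k → Str) (b : V)
    (j : List Str) (h : ∀ i, ¬ (b = a ∧ j = [idxCode k i])) : m.setVec a v b j = m b j := by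
  rw [Mem.setVec_apply, dif_neg (not_exists.2 h)]

namespace Prog

variable {V P O σ : Type} {prim : P → List Str → PMF Str}
  {oracle : O → List Str → σ → PMF (List Str × σ)}

/-- A loop over a list, unrolled. -/
def loop {ι : Type} (l : List ι) (f : ι → Prog V P O) : Prog V P O :=
  l.foldr (fun i c => seq (f i) c) skip

/-- The composition of a list of programs. -/
def seqs (l : List (Prog V P O)) : Prog V P O := loop l id

@[simp] theorem seqs_nil : seqs ([] : List (Prog V P O)) = skip := rfl
@[simp] theorem seqs_cons (c : Prog V P O) (l : List (Prog V P O)) :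
    seqs (c :: l) = seq c (seqs l) := rfl
@[simp] theorem loop_nil {ι : Type} (f : ι → Prog V P O) : loop [] f = skip := rfl
@[simp] theorem loop_cons {ι : Type} (i : ι) (l : List ι) (f : ι → Prog V P O) :
    loop (i :: l) f = seq (f i) (loop l f) := rfl

theorem cost_loop_le {ι : Type} (l : List ι) (f : ι → Prog V P O) (C : ℕ)
    (h : ∀ i ∈ l, (f i).cost ≤ C) : (loop l f).cost ≤ l.length * C + 1 := by
  induction l with
  | nil => simp [cost]
  | cons i l ih =>
      have h1 := h i (by simp)
      have h2 := ih fun i hi => h i (by simp [hi])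
      simp only [loop_cons, cost, List.length_cons, add_mul, one_mul]
      omega

/-- A deterministic loop. -/
theorem ev_loop {ι : Type} (l : List ι) (f : ι → Prog V P O) (step : ι → Mem V → Mem V) (s : σ)
    (hf : ∀ i m ψ, (f i).ev prim oracle m s ψ = ψ (step i m) s) (m : Mem V)
    (ψ : Mem V → σ → ℝ≥0∞) :
    (loop l f).ev prim oracle m s ψ = ψ (l.foldl (fun m i => step i m) m) s := by
  induction l generalizing m with
  | nil => simp
  | cons i l ih => rw [loop_cons, ev_seq, hf, ih]; rfl

/-- A loop that draws a uniform element in each of its rounds. -/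
theorem ev_loop_sample {ι α : Type} [Finite ι] [Finite α] [Nonempty α] (l : List ι)
    (hl : l.Nodup) (f : ι → Prog V P O) (step : ι → α → Mem V → Mem V) (s : σ)
    (hf : ∀ i m ψ, (f i).ev prim oracle m s ψ = wp (unif α) fun x => ψ (step i x m) s)
    (m : Mem V) (ψ : Mem V → σ → ℝ≥0∞) :
    (loop l f).ev prim oracle m s ψ =
      wp (unif (ι → α)) fun v => ψ (l.foldl (fun m i => step i (v i) m) m) s := by
  classical
  induction l generalizing m with
  | nil => simp [wp_const]
  | cons i l ih =>
      rw [List.nodup_cons] at hl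
      rw [loop_cons, ev_seq, hf, wp_unif_resample i]
      refine wp_congr fun x => ?_
      rw [ih hl.2]
      refine wp_congr fun v => ?_
      rw [List.foldl_cons, Function.update_self]
      congr 1
      have : ∀ (l : List ι), i ∉ l → ∀ m : Mem V, l.foldl (fun m i => step i (v i) m) m =
          l.foldl (fun m i' => step i' (Function.update v i x i') m) m := by
        intro l
        induction l with
        | nil => intro _ m; rfl
        | cons j l ih =>
            intro hi m
            rw [List.mem_cons, not_or] at hi
            rw [List.foldl_cons, List.foldl_cons, Function.update_of_ne (Ne.symm hi.1), ih hi.2]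
      exact this l hl.1 _

end Prog

/-- Induction over a loop; `I l m` says what holds when the rounds in `l` are still to come. -/
theorem foldl_inv {ι β : Type} (step : β → ι → β) (I : List ι → β → Prop)
    (h : ∀ i l m, I (i :: l) m → I l (step m i)) (l : List ι) (m : β) (h0 : I l m) :
    I [] (l.foldl step m) := by
  induction l generalizing m with
  | nil => exact h0
  | cons i l ih => exact ih _ (h i l m h0)

/-! ### Lazy sampling -/

/-- The function `h`, overridden by the table `T`. -/
def ov {D R : Type} (T : D → Option R) (h : D → R) (z : D) : R := (T z).getD (h z)

theorem ov_of_some {D R : Type} {T : D → Option R} {z : D} {v : R} (h : T z = some v)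
    (f : D → R) : ov T f z = v := by simp [ov, h]

/-- A value that is not yet in the table may be drawn now. -/
theorem wp_ov_of_none {D R : Type} [DecidableEq D] [Finite D] [Finite R] [Nonempty R]
    {T : D → Option R} {z : D}
    (h : T z = none) (F : (D → R) → ℝ≥0∞) :
    (wp (unif (D → R)) fun f => F (ov T f)) =
      wp (unif R) fun v => wp (unif (D → R)) fun f => F (ov (Function.update T z (some v)) f) := by
  rw [wp_unif_resample z]
  refine wp_congr fun v => wp_congr fun f => ?_
  congr 1
  funext x
  by_cases hx : x = z
  · subst hx; simp [ov, h]
  · simp [ov, hx]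

namespace LHEParams

variable {S : LHEParams}

/-- The average over hash functions that extend the given tables. -/
def E2 (TH : S.Salt × S.Pin → Option (Fin S.n → Fin S.N)) (Th : S.G → Option S.F)
    (F : (S.Salt × S.Pin → Fin S.n → Fin S.N) → (S.G → S.F) → ℝ≥0∞) : ℝ≥0∞ :=
  wp (unif _) fun H => wp (unif _) fun h => F (ov TH H) (ov Th h)

open Classical in
theorem E2_hash_none {TH : S.Salt × S.Pin → Option (Fin S.n → Fin S.N)} {Th : S.G → Option S.F}
    {z : S.Salt × S.Pin} (h : TH z = none) (F) :
    E2 TH Th F = wp (unif _) fun loc => E2 (Function.update TH z (some loc)) Th F :=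
  wp_ov_of_none h fun H => wp (unif _) fun h => F H (ov Th h)

open Classical in
theorem E2_hash'_none {TH : S.Salt × S.Pin → Option (Fin S.n → Fin S.N)} {Th : S.G → Option S.F}
    {z : S.G} (h : Th z = none) (F) :
    E2 TH Th F = wp (unif _) fun v => E2 TH (Function.update Th z (some v)) F := by
  unfold E2
  rw [wp_comm]
  refine (wp_ov_of_none h fun h => wp (unif _) fun H => F (ov TH H) h).trans ?_
  refine wp_congr fun v => ?_
  rw [wp_comm]

theorem E2_congr {TH : S.Salt × S.Pin → Option (Fin S.n → Fin S.N)} {Th : S.G → Option S.F} {F G}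
    (h : ∀ H h, (∀ z v, TH z = some v → H z = v) → (∀ z v, Th z = some v → h z = v) →
      F H h = G H h) : E2 TH Th F = E2 TH Th G :=
  wp_congr fun _ => wp_congr fun _ => h _ _ (fun _ _ hz => ov_of_some hz _)
    fun _ _ hz => ov_of_some hz _

end LHEParams

/-! ### Simulation of the challenger by a program -/

/-- The registers and arrays of a simulator, besides those of the adversary. -/
inductive Own (n : ℕ) (K : Type)
  /-- scratch registers -/
  | ax | ay | tmp | val
  /-- a register that is always empty -/
  | nil
  /-- the marks of the queries in the table for the locations -/
  | hdef
  /-- the table for the locations, and the location found by the last query -/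
  | hT (j : Fin n) | o (j : Fin n)
  /-- the table for the hash function `G → F`; an entry is preceded by the bit `1` -/
  | hV
  /-- the answers to corruptions -/
  | skA
  /-- the number of corruptions and of queries `G → F` that are left, in unary -/
  | left | ql
  /-- the recorded queries -/
  | lg
  /-- registers that the simulation of the challenger does not use -/
  | keep (x : K)

namespace LHEParams

section
variable {S : LHEParams} {V K O : Type}

/-- The programs of simulators. -/
abbrev SimProg (S : LHEParams) (V K O : Type) : Type := Prog (V ⊕ Own S.n K) (Prim S.n) O

open Prog Own

/-- Find the location for the salt and the PIN in `ax` and `ay`, and draw it if necessary. -/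
def fetchLoc : SimProg S V K O := seqs [
  move (.inr tmp) [] (.inr hdef) [.inr ax, .inr ay],
  ifHead (.inr tmp) skip (seqs [
    loop (List.finRange S.n) fun j => seq (.prim (.sample .idx) [] (.inr tmp))
      (move (.inr (hT j)) [.inr ax, .inr ay] (.inr tmp) []),
    push true (.inr tmp),
    move (.inr hdef) [.inr ax, .inr ay] (.inr tmp) []]),
  loop (List.finRange S.n) fun j => move (.inr (o j)) [] (.inr (hT j)) [.inr ax, .inr ay]]

/-- Find the value of the hash function `G → F` at the group element in `ax`, and draw it if
necessary. -/
def fetchPad : SimProg S V K O := seqs [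
  move (.inr val) [] (.inr hV) [.inr ax],
  ifHead (.inr val) skip (seqs [
    .prim (.sample .fld) [] (.inr val),
    push true (.inr val),
    move (.inr hV) [.inr ax] (.inr val) []]),
  pop (.inr val)]

/-- Give the content of `val` as the answer to a query. -/
def give : List V → SimProg S V K O
  | [] => skip
  | d :: _ => move (.inl d) [] (.inr val) []

/-- The simulation of a query for a location. -/
def hashSim (ds : List V) : List V → SimProg S V K O
  | [x, y] => seqs [
      move (.inr ax) [] (.inl x) [],
      move (.inr ay) [] (.inl y) [],
      .prim (.valid .salt) [.inr ax] (.inr tmp),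
      ifHead (.inr tmp) (seqs [
        .prim (.valid .pin) [.inr ay] (.inr tmp),
        ifHead (.inr tmp) (seq fetchLoc
          (loop (ds.zip (List.finRange S.n)) fun q => move (.inl q.1) [] (.inr (o q.2)) [])) skip])
        skip]
  | _ => skip

/-- The simulation of a query to the hash function `G → F`. The unary counter `ql` of the queries
left is also the index under which the query is recorded. -/
def hash'Sim (ds : List V) (as : List V) : SimProg S V K O :=
  ifHead (.inr ql) (seqs [
    (match as with
      | [] => move (.inr ax) [] (.inr nil) []
      | x :: _ => move (.inr ax) [] (.inl x) []),
    move (.inr lg) [.inr ql] (.inr ax) [],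
    pop (.inr ql),
    (match as with
      | [_] => seqs [
          .prim (.valid .grp) [.inr ax] (.inr tmp),
          ifHead (.inr tmp) (seq fetchPad (give ds)) skip]
      | _ => skip)]) skip

/-- The simulation of a corruption. -/
def corruptSim (ds : List V) : List V → SimProg S V K O
  | [x] => seqs [
      move (.inr ax) [] (.inl x) [],
      .prim (.valid .idx) [.inr ax] (.inr tmp),
      ifHead (.inr tmp) (ifHead (.inr left) (seqs [
        pop (.inr left),
        move (.inr val) [] (.inr skA) [.inr ax],
        give ds]) skip) skip]
  | _ => skip

/-- The simulation of a query. -/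
def querySim : LHEQuery → List V → List V → SimProg S V K O
  | .hash, as, ds => hashSim ds as
  | .hash', as, ds => hash'Sim ds as
  | .corrupt, as, ds => corruptSim ds as

/-- The simulation of a program of the adversary. -/
def lift : Prog V (Prim S.n) LHEQuery → SimProg S V K O
  | skip => skip
  | seq c d => seq (lift c) (lift d)
  | push b x => push b (.inl x)
  | pop x => pop (.inl x)
  | move x is y js => move (.inl x) (is.map .inl) (.inl y) (js.map .inl)
  | ifHead x c d => ifHead (.inl x) (lift c) (lift d)
  | ifEq x y c d => ifEq (.inl x) (.inl y) (lift c) (lift d)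
  | .prim f args dst => .prim f (args.map .inl) (.inl dst)
  | query q args dsts => querySim q args dsts

/-- The memory `m'` of a simulator represents the memory `m` of the adversary, the tables `TH` and
`Th` for the hash functions, the answers `sk` to corruptions and the state `st` of the challenger;
the remaining registers have the content `κ`. The query number `ρ` is recorded under the index `Q -
ρ` in unary. -/
structure Rep (Q : ℕ) (m' : Mem (V ⊕ Own S.n K)) (m : Mem V)
    (TH : S.Salt × S.Pin → Option (Fin S.n → Fin S.N)) (Th : S.G → Option S.F)
    (sk : Fin S.N → ZMod S.p) (st : ISt S.N) (κ : Mem K) : Prop where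
  mem : ∀ v i, m' (.inl v) i = m v i
  nil : m' (.inr .nil) [] = []
  hdef_none : ∀ s p, TH (s, p) = none → m' (.inr .hdef) [saltCode _ s, S.encPin p] = []
  hdef_some : ∀ s p loc, TH (s, p) = some loc →
    (m' (.inr .hdef) [saltCode _ s, S.encPin p]).head? = some true
  hT : ∀ s p loc, TH (s, p) = some loc → ∀ j,
    m' (.inr (.hT j)) [saltCode _ s, S.encPin p] = idxCode S.N (loc j)
  hV_none : ∀ z, Th z = none → m' (.inr .hV) [S.encG z] = []
  hV_some : ∀ z v, Th z = some v → m' (.inr .hV) [S.encG z] = true :: S.encF v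
  skA : ∀ i, m' (.inr .skA) [idxCode S.N i] = sclCode S.p (sk i)
  left : m' (.inr .left) [] = List.replicate st.left true
  ql : m' (.inr .ql) [] = List.replicate (Q - st.count) true
  log_length : st.log.length = min st.count Q
  lg : ∀ ρ < Q, m' (.inr .lg) [List.replicate (Q - ρ) true] = st.log[ρ]?.getD []
  keep : ∀ x i, m' (.inr (.keep x)) i = κ x i

end

end LHEParams
end

noncomputable section

/-! ### Lazy sampling in the memory of the simulator -/

namespace LHEParams

section
variable {S : LHEParams} {V K O σ : Type}

open Prog Own

/-- Scratch registers: a query may change them at will. -/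
def IsScratch : V ⊕ Own S.n K → Prop
  | .inr .ax | .inr .ay | .inr .tmp | .inr .val | .inr (.o _) => True
  | _ => False

variable {Q : ℕ} {m' m'' : Mem (V ⊕ Own S.n K)} {m : Mem V}
    {TH : S.Salt × S.Pin → Option (Fin S.n → Fin S.N)} {Th : S.G → Option S.F}
    {sk : Fin S.N → ZMod S.p} {st : ISt S.N} {κ : Mem K}

theorem Rep.congr (R : Rep Q m' m TH Th sk st κ)
    (h : ∀ b i, ¬ IsScratch b → m'' b i = m' b i) : Rep Q m'' m TH Th sk st κ where
  mem v i := (h _ _ id).trans (R.mem v i)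
  nil := (h _ _ id).trans R.nil
  hdef_none s p hT := (h _ _ id).trans (R.hdef_none s p hT)
  hdef_some s p loc hT := by rw [h _ _ id]; exact R.hdef_some s p loc hT
  hT s p loc hT j := (h _ _ id).trans (R.hT s p loc hT j)
  hV_none z hz := (h _ _ id).trans (R.hV_none z hz)
  hV_some z v hz := (h _ _ id).trans (R.hV_some z v hz)
  skA i := (h _ _ id).trans (R.skA i)
  left := (h _ _ id).trans R.left
  ql := (h _ _ id).trans R.ql
  log_length := R.log_length
  lg ρ hs := (h _ _ id).trans (R.lg ρ hs)
  keep x i := (h _ _ id).trans (R.keep x i)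

theorem Rep.set_scratch (R : Rep Q m' m TH Th sk st κ) (b : V ⊕ Own S.n K) (hb : IsScratch b)
    (i : List Str) (s : Str) : Rep Q (m'.set b i s) m TH Th sk st κ :=
  R.congr fun b' j hb' => Mem.set_of_ne _ (by rintro rfl; exact hb' hb) _ _ _

theorem saltPin_ne {s s' : S.Salt} {p p' : S.Pin} (h : (s', p') ≠ (s, p)) :
    [saltCode S.saltLen s', S.encPin p'] ≠ [saltCode S.saltLen s, S.encPin p] := by
  intro he
  simp only [List.cons.injEq, and_true] at he
  exact h (by rw [(saltCode _).injective he.1, S.encPin.injective he.2])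

/-- Copying a location from the table to the output registers. -/
theorem copyLoc_spec (R : Rep Q m' m TH Th sk st κ) {s : S.Salt} {p : S.Pin}
    (hax : m' (.inr ax) [] = saltCode _ s) (hay : m' (.inr ay) [] = S.encPin p)
    {loc : Fin S.n → Fin S.N} (hloc : TH (s, p) = some loc) :
    let mf := (List.finRange S.n).foldl (fun m j => m.set (.inr (o j)) []
      (m (.inr (hT j)) (m.regs [.inr ax, .inr ay]))) m'
    Rep Q mf m TH Th sk st κ ∧ ∀ j, mf (.inr (o j)) [] = idxCode S.N (loc j) := by
  have := foldl_inv (fun (m : Mem (V ⊕ Own S.n K)) j => m.set (.inr (o j)) []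
      (m (.inr (hT j)) (m.regs [.inr ax, .inr ay])))
    (fun l m => (∀ b i, (∀ j, b ≠ .inr (o j)) → m b i = m' b i) ∧
      ∀ j ∉ l, m (.inr (o j)) [] = idxCode S.N (loc j)) ?_ (List.finRange S.n) m'
      ⟨fun _ _ _ => rfl, fun j hj => absurd (List.mem_finRange j) hj⟩
  · refine ⟨R.congr fun b i hb => this.1 b i ?_, fun j => this.2 j (by simp)⟩
    rintro j rfl
    exact hb trivial
  · rintro j l m₁ ⟨h1, h2⟩
    refine ⟨fun b i hb => ?_, fun j' hj' => ?_⟩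
    · rw [Mem.set_of_ne _ (hb j), h1 b i hb]
    · by_cases hjj : j' = j
      · subst hjj
        rw [Mem.set_self, h1 _ _ (by simp)]
        simp only [Mem.regs, List.map_cons, List.map_nil]
        rw [h1 _ _ (by simp), h1 _ _ (by simp), hax, hay, R.hT s p loc hloc j']
      · rw [Mem.set_of_ne _ (by simpa using hjj)]
        exact h2 j' (by simp [hjj, hj'])

variable {oracle : O → List Str → σ → PMF (List Str × σ)} {s₀ : σ}

/-- Fetching a location is a step of lazy sampling of the hash function for locations. -/
theorem ev_fetchLoc (R : Rep Q m' m TH Th sk st κ) {s : S.Salt} {p : S.Pin}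
    (hax : m' (.inr ax) [] = saltCode _ s) (hay : m' (.inr ay) [] = S.encPin p)
    (ψ : Mem (V ⊕ Own S.n K) → σ → ℝ≥0∞) (F)
    (hψ : ∀ m'' TH' loc, Rep Q m'' m TH' Th sk st κ → TH' (s, p) = some loc →
      (∀ j, m'' (.inr (o j)) [] = idxCode S.N (loc j)) → ψ m'' s₀ = E2 TH' Th F) :
    fetchLoc.ev S.primSem oracle m' s₀ ψ = E2 TH Th F := by
  classical
  have hcopy : ∀ (m₁ : Mem (V ⊕ Own S.n K)) (TH' : S.Salt × S.Pin → Option (Fin S.n → Fin S.N))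
      (loc : Fin S.n → Fin S.N), Rep Q m₁ m TH' Th sk st κ → m₁ (.inr ax) [] = saltCode _ s →
      m₁ (.inr ay) [] = S.encPin p → TH' (s, p) = some loc →
      (loop (List.finRange S.n) fun j => move (.inr (o j)) [] (.inr (hT j))
        [.inr ax, .inr ay]).ev S.primSem oracle m₁ s₀ ψ = E2 TH' Th F := by
    intro m₁ TH' loc R₁ hax₁ hay₁ hloc
    rw [ev_loop _ _ (fun j m => m.set (.inr (o j)) []
      (m (.inr (hT j)) (m.regs [.inr ax, .inr ay]))) s₀ (fun j m ψ => by simp [Mem.regs])]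
    obtain ⟨h1, h2⟩ := copyLoc_spec R₁ hax₁ hay₁ hloc
    exact hψ _ TH' loc h1 hloc h2
  unfold fetchLoc
  simp only [seqs_cons, seqs_nil, ev_seq, ev_skip, ev_move, ev_ifHead, Mem.set_self, Mem.regs,
    List.map_cons, List.map_nil, hax, hay]
  have hax₁ : ∀ x, (m'.set (.inr tmp) [] x) (.inr ax) [] = saltCode _ s := fun x => by
    rw [Mem.set_of_ne _ (by simp), hax]
  have hay₁ : ∀ x, (m'.set (.inr tmp) [] x) (.inr ay) [] = S.encPin p := fun x => by
    rw [Mem.set_of_ne _ (by simp), hay]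
  cases hTH : TH (s, p) with
  | some loc =>
      rw [if_pos (R.hdef_some s p loc hTH)]
      exact hcopy _ TH loc (R.set_scratch _ (by trivial) _ _) (hax₁ _) (hay₁ _) hTH
  | none =>
      rw [R.hdef_none s p hTH, if_neg (by simp)]
      rw [ev_loop_sample (α := Fin S.N) (List.finRange S.n) (List.nodup_finRange _) _
        (fun j x m => (m.set (.inr tmp) [] (idxCode S.N x)).set (.inr (hT j))
          [m (.inr ax) [], m (.inr ay) []] (idxCode S.N x)) s₀
        (fun j m ψ => by
          simp [primSem, sampleSem, wp_map, Mem.regs, Mem.set_self, Mem.set_of_ne]),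
        E2_hash_none hTH]
      refine wp_congr fun loc => ?_
      simp only [ev_push]
      have hinv := foldl_inv (fun (m : Mem (V ⊕ Own S.n K)) j =>
          (m.set (.inr tmp) [] (idxCode S.N (loc j))).set (.inr (hT j))
          [m (.inr ax) [], m (.inr ay) []] (idxCode S.N (loc j)))
        (fun l m => (∀ b i, b ≠ .inr tmp → (∀ j, b ≠ .inr (hT j)) → m b i = m' b i) ∧
          (∀ j i, i ≠ [saltCode S.saltLen s, S.encPin p] →
            m (.inr (hT j)) i = m' (.inr (hT j)) i) ∧
          ∀ j ∉ l, m (.inr (hT j)) [saltCode S.saltLen s, S.encPin p] = idxCode S.N (loc j)) ?_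
          (List.finRange S.n) (m'.set (.inr tmp) [] [])
          ⟨fun b i hb _ => Mem.set_of_ne _ hb _ _ _, fun j i _ => Mem.set_of_ne _ (by simp) _ _ _,
            fun j hj => absurd (List.mem_finRange j) hj⟩
      swap
      · rintro j l m₁ ⟨h1, h2, h3⟩
        have e1 : m₁ (.inr ax) [] = saltCode _ s := by rw [h1 _ _ (by simp) (by simp), hax]
        have e2 : m₁ (.inr ay) [] = S.encPin p := by rw [h1 _ _ (by simp) (by simp), hay]
        rw [e1, e2]
        refine ⟨fun b i hb hb' => ?_, fun j' i hi => ?_, fun j' hj' => ?_⟩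
        · rw [Mem.set_of_ne _ (hb' j), Mem.set_of_ne _ hb, h1 b i hb hb']
        · rw [← h2 j' i hi]
          simp [Mem.set, hi]
        · by_cases hjj : j' = j
          · subst hjj; rw [Mem.set_self]
          · rw [Mem.set_of_ne _ (by simpa using hjj), Mem.set_of_ne _ (by simp)]
            exact h3 j' (by simp [hjj, hj'])
      generalize (List.finRange S.n).foldl (fun (m : Mem (V ⊕ Own S.n K)) j =>
          (m.set (.inr tmp) [] (idxCode S.N (loc j))).set (.inr (hT j))
          [m (.inr ax) [], m (.inr ay) []] (idxCode S.N (loc j)))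
          (m'.set (.inr tmp) [] []) = m₂ at hinv ⊢
      obtain ⟨h1, h2, h3⟩ := hinv
      have e1 : m₂ (.inr ax) [] = saltCode _ s := by rw [h1 _ _ (by simp) (by simp), hax]
      have e2 : m₂ (.inr ay) [] = S.encPin p := by rw [h1 _ _ (by simp) (by simp), hay]
      have hne : ∀ (b : V ⊕ Own S.n K) i x y, b ≠ .inr tmp → b ≠ .inr hdef → (∀ j, b ≠ .inr (hT j)) →
          ((m₂.set (.inr tmp) [] x).set (.inr hdef)
            [saltCode S.saltLen s, S.encPin p] y) b i = m' b i := by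
        intro b i x y hb1 hb2 hb3
        rw [Mem.set_of_ne _ hb2, Mem.set_of_ne _ hb1, h1 b i hb1 hb3]
      refine hcopy _ _ loc ?_ ?_ ?_ (Function.update_self _ _ _)
      · simp only [Mem.set_of_ne _ (show (Sum.inr ax : V ⊕ Own S.n K) ≠ .inr tmp by simp),
          Mem.set_of_ne _ (show (Sum.inr ay : V ⊕ Own S.n K) ≠ .inr tmp by simp), e1, e2,
          Mem.set_self]
        constructor
        · intro v i; rw [hne _ _ _ _ (by simp) (by simp) (by simp)]; exact R.mem v i
        · rw [hne _ _ _ _ (by simp) (by simp) (by simp)]; exact R.nil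
        · intro s' p' hT'
          have hsp : (s', p') ≠ (s, p) := by rintro h; rw [h] at hT'; simp at hT'
          rw [Function.update_of_ne hsp] at hT'
          simp only [Mem.set, saltPin_ne hsp, and_false, if_false]
          rw [if_neg (by simp), h1 _ _ (by simp) (by simp)]
          exact R.hdef_none s' p' hT'
        · intro s' p' loc' hT'
          by_cases hsp : (s', p') = (s, p)
          · rw [Prod.mk.injEq] at hsp
            rw [hsp.1, hsp.2, Mem.set_self]; rfl
          · rw [Function.update_of_ne hsp] at hT'
            simp only [Mem.set, saltPin_ne hsp, and_false, if_false]
            rw [if_neg (by simp), h1 _ _ (by simp) (by simp)]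
            exact R.hdef_some s' p' loc' hT'
        · intro s' p' loc' hT' j
          rw [Mem.set_of_ne _ (by simp), Mem.set_of_ne _ (by simp)]
          by_cases hsp : (s', p') = (s, p)
          · rw [hsp, Function.update_self, Option.some.injEq] at hT'
            rw [Prod.mk.injEq] at hsp
            rw [hsp.1, hsp.2, ← hT']
            exact h3 j (by simp)
          · rw [Function.update_of_ne hsp] at hT'
            rw [h2 j _ (saltPin_ne hsp)]
            exact R.hT s' p' loc' hT' j
        · intro z hz; rw [hne _ _ _ _ (by simp) (by simp) (by simp)]; exact R.hV_none z hz
        · intro z v hz; rw [hne _ _ _ _ (by simp) (by simp) (by simp)]; exact R.hV_some z v hz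
        · intro i; rw [hne _ _ _ _ (by simp) (by simp) (by simp)]; exact R.skA i
        · rw [hne _ _ _ _ (by simp) (by simp) (by simp)]; exact R.left
        · rw [hne _ _ _ _ (by simp) (by simp) (by simp)]; exact R.ql
        · exact R.log_length
        · intro ρ hs; rw [hne _ _ _ _ (by simp) (by simp) (by simp)]; exact R.lg ρ hs
        · intro x i; rw [hne _ _ _ _ (by simp) (by simp) (by simp)]; exact R.keep x i
      · rw [Mem.set_of_ne _ (by simp), Mem.set_of_ne _ (by simp), e1]
      · rw [Mem.set_of_ne _ (by simp), Mem.set_of_ne _ (by simp), e2]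

/-- Fetching a pad is a step of lazy sampling of the hash function `G → F`. -/
theorem ev_fetchPad (R : Rep Q m' m TH Th sk st κ) {z : S.G}
    (hax : m' (.inr ax) [] = S.encG z) (ψ : Mem (V ⊕ Own S.n K) → σ → ℝ≥0∞) (F)
    (hψ : ∀ m'' Th' v, Rep Q m'' m TH Th' sk st κ → Th' z = some v → (∀ z' v', Th z' = some v' →
      Th' z' = some v') → m'' (.inr val) [] = S.encF v → ψ m'' s₀ = E2 TH Th' F) :
    fetchPad.ev S.primSem oracle m' s₀ ψ = E2 TH Th F := by
  classical
  unfold fetchPad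
  simp only [seqs_cons, seqs_nil, ev_seq, ev_skip, ev_move, ev_ifHead, Mem.set_self, Mem.regs,
    List.map_cons, List.map_nil, hax, ev_pop]
  cases hTh : Th z with
  | some v =>
      rw [R.hV_some z v hTh, if_pos (by simp)]
      exact hψ _ Th v ((R.set_scratch _ (by trivial) _ _).set_scratch _ (by trivial) _ _) hTh
        (fun _ _ h => h) (Mem.set_self _ _ _ _)
  | none =>
      rw [R.hV_none z hTh, if_neg (by simp), E2_hash'_none hTh]
      simp only [ev_prim, primSem, sampleSem, wp_map, ev_push, Mem.set_self]
      refine wp_congr fun v => ?_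
      refine hψ _ _ v ?_ (Function.update_self _ _ _) (fun z' v' h => ?_) ?_
      · refine Rep.set_scratch ?_ _ (by trivial) _ _
        have hne : ∀ (b : V ⊕ Own S.n K) i x y w w' j, b ≠ .inr val → b ≠ .inr hV →
            ((((m'.set (.inr val) [] x).set (.inr val) [] y).set (.inr val) [] w).set (.inr hV)
              j w') b i = m' b i := by
          intro b i x y w w' j hb1 hb2
          rw [Mem.set_of_ne _ hb2, Mem.set_of_ne _ hb1, Mem.set_of_ne _ hb1, Mem.set_of_ne _ hb1]
        have hcell : ∀ x y w, (((m'.set (.inr val) [] x).set (.inr val) [] y).set (.inr val) [] w)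
            (.inr ax) [] = S.encG z := by
          intro x y w
          rw [Mem.set_of_ne _ (by simp), Mem.set_of_ne _ (by simp), Mem.set_of_ne _ (by simp), hax]
        rw [hcell]
        have hvne : ∀ z', z' ≠ z → [S.encG z'] ≠ [S.encG z] := fun z' h h' =>
          h (S.encG.injective (List.singleton_injective h'))
        constructor
        · intro v i; rw [hne _ _ _ _ _ _ _ (by simp) (by simp)]; exact R.mem v i
        · rw [hne _ _ _ _ _ _ _ (by simp) (by simp)]; exact R.nil
        · intro s' p' h; rw [hne _ _ _ _ _ _ _ (by simp) (by simp)]; exact R.hdef_none s' p' h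
        · intro s' p' l h; rw [hne _ _ _ _ _ _ _ (by simp) (by simp)]; exact R.hdef_some s' p' l h
        · intro s' p' l h j; rw [hne _ _ _ _ _ _ _ (by simp) (by simp)]; exact R.hT s' p' l h j
        · intro z' hz'
          have hzz : z' ≠ z := by rintro rfl; simp at hz'
          rw [Function.update_of_ne hzz] at hz'
          simp only [Mem.set, hvne z' hzz, and_false, if_false]
          simpa using R.hV_none z' hz'
        · intro z' v' hz'
          by_cases hzz : z' = z
          · subst hzz
            rw [Function.update_self, Option.some.injEq] at hz'
            simp [Mem.set_self, hz']
          · rw [Function.update_of_ne hzz] at hz'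
            simp only [Mem.set, hvne z' hzz, and_false, if_false]
            simpa using R.hV_some z' v' hz'
        · intro i; rw [hne _ _ _ _ _ _ _ (by simp) (by simp)]; exact R.skA i
        · rw [hne _ _ _ _ _ _ _ (by simp) (by simp)]; exact R.left
        · rw [hne _ _ _ _ _ _ _ (by simp) (by simp)]; exact R.ql
        · exact R.log_length
        · intro ρ hs; rw [hne _ _ _ _ _ _ _ (by simp) (by simp)]; exact R.lg ρ hs
        · intro x i; rw [hne _ _ _ _ _ _ _ (by simp) (by simp)]; exact R.keep x i
      · rw [Function.update_of_ne]
        · exact h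
        · rintro rfl; rw [hTh] at h; cases h
      · rw [Mem.set_self, Mem.set_of_ne _ (by simp), Mem.set_self]; rfl

end
end LHEParams
end

noncomputable section

/-! ### Correctness of the simulation -/

namespace LHEParams

section
variable {S : LHEParams} {V K O σ : Type}

open Prog Own

variable {Q : ℕ} {m' m'' : Mem (V ⊕ Own S.n K)} {m : Mem V}
    {TH : S.Salt × S.Pin → Option (Fin S.n → Fin S.N)} {Th : S.G → Option S.F}
    {sk : Fin S.N → ZMod S.p} {st : ISt S.N} {κ : Mem K}

theorem Rep.regs (R : Rep Q m' m TH Th sk st κ) (xs : List V) :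
    m'.regs (xs.map .inl) = m.regs xs := by
  simp [Mem.regs, R.mem]

/-- A change of the adversary's part of the memory only. -/
theorem Rep.congr_mem (R : Rep Q m' m TH Th sk st κ) {m₂ : Mem V}
    (h : ∀ b i, m'' (.inr b) i = m' (.inr b) i) (h₂ : ∀ v i, m'' (.inl v) i = m₂ v i) :
    Rep Q m'' m₂ TH Th sk st κ where
  mem := h₂
  nil := (h _ _).trans R.nil
  hdef_none s p hT := (h _ _).trans (R.hdef_none s p hT)
  hdef_some s p loc hT := by rw [h]; exact R.hdef_some s p loc hT
  hT s p loc hT j := (h _ _).trans (R.hT s p loc hT j)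
  hV_none z hz := (h _ _).trans (R.hV_none z hz)
  hV_some z v hz := (h _ _).trans (R.hV_some z v hz)
  skA i := (h _ _).trans (R.skA i)
  left := (h _ _).trans R.left
  ql := (h _ _).trans R.ql
  log_length := R.log_length
  lg ρ hs := (h _ _).trans (R.lg ρ hs)
  keep x i := (h _ _).trans (R.keep x i)

theorem Rep.set_inl (R : Rep Q m' m TH Th sk st κ) (x : V) (i : List Str) (s : Str) :
    Rep Q (m'.set (.inl x) i s) (m.set x i s) TH Th sk st κ :=
  R.congr_mem (fun _ _ => Mem.set_of_ne _ (by simp) _ _ _) fun v j => by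
    by_cases h : v = x <;> simp [Mem.set, R.mem, h]

variable {oracle : O → List Str → σ → PMF (List Str × σ)} {s₀ : σ}

/-- The answers to a query for a location are copied to the adversary's registers. -/
theorem Rep.copyAns (R : Rep Q m' m TH Th sk st κ) {loc : Fin S.n → Fin S.N}
    (h : ∀ j, m' (.inr (o j)) [] = idxCode S.N (loc j)) (ds : List V) :
    Rep Q ((ds.zip (List.finRange S.n)).foldl (fun m q => m.set (.inl q.1) []
      (m (.inr (o q.2)) (m.regs []))) m') (m.setRegs ds (List.ofFn fun j => idxCode S.N (loc j)))
      TH Th sk st κ := by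
  rw [Mem.setRegs, List.ofFn_eq_map]
  generalize List.finRange S.n = l
  induction ds generalizing l m m' with
  | nil => simpa using R
  | cons d ds ih =>
      cases l with
      | nil => simpa using R
      | cons j l =>
          simp only [List.zip_cons_cons, List.foldl_cons, List.map_cons, h, Mem.regs, List.map_nil]
          exact ih (R.set_inl d [] _) (fun j => by rw [Mem.set_of_ne _ (by simp)]; exact h j) l

theorem ev_give (R : Rep Q m' m TH Th sk st κ) {s : Str} (hs : m' (.inr val) [] = s) (ds : List V)
    (ψ : Mem (V ⊕ Own S.n K) → σ → ℝ≥0∞) (x : ℝ≥0∞)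
    (hψ : ∀ m'', Rep Q m'' (m.setRegs ds [s]) TH Th sk st κ → ψ m'' s₀ = x) :
    (give ds).ev S.primSem oracle m' s₀ ψ = x := by
  cases ds with
  | nil => simpa [give] using hψ _ R
  | cons d ds =>
      simp only [give, ev_move, Mem.regs, List.map_nil, hs]
      refine hψ _ ?_
      simpa [Mem.setRegs] using R.set_inl d [] s

/-- A branch on the validity of a code. -/
theorem ev_ifValid {α : Type} (e : α ↪ Str) {k : Kind} (he : S.validSem k = strValid e)
    (x : V ⊕ Own S.n K) (c d : SimProg S V K O) (m' : Mem (V ⊕ Own S.n K))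
    (ψ : Mem (V ⊕ Own S.n K) → σ → ℝ≥0∞) :
    (Prog.prim (O := O) (.valid k) [x] (.inr tmp)).ev S.primSem oracle m' s₀
      (fun m s => (ifHead (.inr tmp) c d).ev S.primSem oracle m s ψ) =
    match decode e (m' x []) with
    | some _ => c.ev S.primSem oracle (m'.set (.inr tmp) [] [true]) s₀ ψ
    | none => d.ev S.primSem oracle (m'.set (.inr tmp) [] []) s₀ ψ := by
  simp only [ev_prim, primSem, wp_pure, he, Mem.regs, List.map_cons, List.map_nil]
  rw [ev_ifHead, Mem.set_self]
  cases h : decode e (m' x []) <;> simp [strValid, h]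

theorem ev_hashSim (R : Rep Q m' m TH Th sk st κ) (as ds : List V)
    (ψ : Mem (V ⊕ Own S.n K) → σ → ℝ≥0∞)
    (Φ : (S.Salt × S.Pin → Fin S.n → Fin S.N) → (S.G → S.F) → Mem V → ℝ≥0∞)
    (hψ : ∀ m'' m₂ TH', Rep Q m'' m₂ TH' Th sk st κ →
      ψ m'' s₀ = E2 TH' Th fun H h => Φ H h m₂) :
    (hashSim ds as).ev S.primSem oracle m' s₀ ψ =
      E2 TH Th fun H h => Φ H h (m.setRegs ds (S.hashAns H (m.regs as))) := by
  have hnil : ∀ m'', Rep Q m'' m TH Th sk st κ →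
      ψ m'' s₀ = E2 TH Th fun H h => Φ H h (m.setRegs ds []) := fun m'' R' => by
    simpa [Mem.setRegs] using hψ _ _ _ R'
  rcases as with _ | ⟨x, _ | ⟨y, _ | ⟨_, _⟩⟩⟩
  · simpa [hashSim, hashAns, corruptSim, corruptAns, Mem.regs] using hnil _ R
  · simpa [hashSim, hashAns, corruptSim, corruptAns, Mem.regs] using hnil _ R
  · have hm : ∀ b s v i, (m'.set (.inr b) [] s) (.inl v) i = m v i := fun b s v i => by
      rw [Mem.set_of_ne _ (by simp), R.mem]
    simp only [hashSim, seqs_cons, seqs_nil, ev_seq, ev_move, ev_skip, Mem.regs, List.map_nil]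
    rw [ev_ifValid (saltCode S.saltLen) rfl]
    simp only [hm, R.mem, Mem.set_self,
      Mem.set_of_ne _ (show (Sum.inr ax : V ⊕ Own S.n K) ≠ .inr ay by simp)]
    cases h1 : decode (saltCode S.saltLen) (m x []) with
    | none =>
        simp only [ev_skip]
        refine (hnil _ (((R.set_scratch _ (by trivial) _ _).set_scratch _ (by trivial) _ _).set_scratch
          _ (by trivial) _ _)).trans ?_
        simp only [hashAns, List.map_cons, List.map_nil, h1]
    | some s =>
        simp only [ev_seq]
        rw [ev_ifValid S.encPin rfl, Mem.set_of_ne _ (by simp), Mem.set_self]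
        cases h2 : decode S.encPin (m y []) with
        | none =>
            simp only [ev_skip]
            refine (hnil _ ((((R.set_scratch _ (by trivial) _ _).set_scratch _ (by trivial) _
              _).set_scratch _ (by trivial) _ _).set_scratch _ (by trivial) _ _)).trans ?_
            simp only [hashAns, List.map_cons, List.map_nil, h1, h2]
        | some p =>
            simp only [hashAns, List.map_cons, List.map_nil, h1, h2, ev_seq]
            refine ev_fetchLoc (s := s) (p := p) ((((R.set_scratch _ (by trivial) _ _).set_scratch _
              (by trivial) _ _).set_scratch _ (by trivial) _ _).set_scratch _ (by trivial) _ _)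
              ?_ ?_ _ _ ?_
            · simp only [Mem.set_of_ne _ (show (Sum.inr ax : V ⊕ Own S.n K) ≠ .inr tmp by simp),
                Mem.set_of_ne _ (show (Sum.inr ax : V ⊕ Own S.n K) ≠ .inr ay by simp), Mem.set_self]
              exact ((decode_eq_some _ _ _).1 h1).symm
            · simp only [Mem.set_of_ne _ (show (Sum.inr ay : V ⊕ Own S.n K) ≠ .inr tmp by simp),
                Mem.set_self]
              exact ((decode_eq_some _ _ _).1 h2).symm
            · intro m'' TH' loc R' hloc ho
              rw [ev_loop _ _ (fun (q : V × Fin S.n) m => m.set (.inl q.1) []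
                (m (.inr (o q.2)) (m.regs []))) s₀ (fun j m ψ => by simp [Mem.regs]), ev_skip,
                hψ _ _ _ (R'.copyAns ho ds)]
              exact E2_congr fun H h hH _ => by rw [hH _ _ hloc]
  · simpa [hashSim, hashAns, corruptSim, corruptAns, Mem.regs] using hnil _ R

theorem ev_corruptSim (R : Rep Q m' m TH Th sk st κ) (as ds : List V)
    (ψ : Mem (V ⊕ Own S.n K) → σ → ℝ≥0∞) (Φ : Mem V → ISt S.N → ℝ≥0∞)
    (hψ : ∀ m'' m₂ st', Rep Q m'' m₂ TH Th sk st' κ → ψ m'' s₀ = Φ m₂ st') :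
    (corruptSim ds as).ev S.primSem oracle m' s₀ ψ =
      Φ (m.setRegs ds (S.corruptAns sk st (m.regs as)).1) (S.corruptAns sk st (m.regs as)).2 := by
  have hnil : ∀ m'', Rep Q m'' m TH Th sk st κ →
      ψ m'' s₀ = Φ (m.setRegs ds []) st := fun m'' R' => by
    simpa [Mem.setRegs] using hψ _ _ _ R'
  rcases as with _ | ⟨x, _ | ⟨_, _⟩⟩
  · simpa [hashSim, hashAns, corruptSim, corruptAns, Mem.regs] using hnil _ R
  · simp only [corruptSim, seqs_cons, seqs_nil, ev_seq, ev_move, ev_skip, Mem.regs, List.map_nil]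
    rw [ev_ifValid (idxCode S.N) rfl]
    simp only [R.mem, Mem.set_self]
    cases h1 : decode (idxCode S.N) (m x []) with
    | none =>
        simp only [ev_skip]
        refine (hnil _ ((R.set_scratch _ (by trivial) _ _).set_scratch _ (by trivial) _ _)).trans ?_
        simp only [corruptAns, List.map_cons, List.map_nil, h1]
    | some i =>
        simp only [ev_ifHead, Mem.set_of_ne _ (show (Sum.inr left : V ⊕ Own S.n K) ≠ .inr tmp by simp),
          Mem.set_of_ne _ (show (Sum.inr left : V ⊕ Own S.n K) ≠ .inr ax by simp), R.left]
        cases hc : st.left with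
        | zero =>
            rw [if_neg (by simp), ev_skip]
            refine (hnil _ ((R.set_scratch _ (by trivial) _ _).set_scratch _ (by trivial) _ _)).trans ?_
            simp only [corruptAns, List.map_cons, List.map_nil, h1, hc]
        | succ c =>
            rw [if_pos (by simp [List.replicate_succ])]
            simp only [corruptAns, List.map_cons, List.map_nil, h1, hc, ev_seq, ev_pop, ev_move,
              Mem.regs, Mem.set_of_ne _ (show (Sum.inr left : V ⊕ Own S.n K) ≠ .inr tmp by simp),
              Mem.set_of_ne _ (show (Sum.inr left : V ⊕ Own S.n K) ≠ .inr ax by simp), R.left]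
            have hi := (decode_eq_some _ _ _).1 h1
            refine ev_give (m := m) (TH := TH) (Th := Th) (sk := sk) (κ := κ) (Q := Q) (s := sclCode S.p (sk i))
              (st := { st with left := c, cor := insert i st.cor }) ?_ ?_ ds _ _
              (fun m'' R' => by rw [ev_skip]; exact hψ _ _ _ R')
            · refine Rep.set_scratch ?_ _ (by trivial) _ _
              have R' := (R.set_scratch (.inr ax) (by trivial) [] (m x [])).set_scratch (.inr tmp)
                (by trivial) [] ([true])
              have hne : ∀ b i s, b ≠ .inr left → (((m'.set (.inr ax) [] (m x [])).set (.inr tmp) []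
                  ([true])).set (.inr left) [] s) b i =
                  ((m'.set (.inr ax) [] (m x [])).set (.inr tmp) []
                  ([true])) b i := fun b i s hb => Mem.set_of_ne _ hb _ _ _
              exact {
                mem := fun v i => by rw [hne _ _ _ (by simp)]; exact R'.mem v i
                nil := by rw [hne _ _ _ (by simp)]; exact R'.nil
                hdef_none := fun s p h => by rw [hne _ _ _ (by simp)]; exact R'.hdef_none s p h
                hdef_some := fun s p l h => by rw [hne _ _ _ (by simp)]; exact R'.hdef_some s p l h
                hT := fun s p l h j => by rw [hne _ _ _ (by simp)]; exact R'.hT s p l h j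
                hV_none := fun z h => by rw [hne _ _ _ (by simp)]; exact R'.hV_none z h
                hV_some := fun z v h => by rw [hne _ _ _ (by simp)]; exact R'.hV_some z v h
                skA := fun i => by rw [hne _ _ _ (by simp)]; exact R'.skA i
                left := by rw [Mem.set_self]; simp [List.replicate_succ]
                ql := by rw [hne _ _ _ (by simp)]; exact R'.ql
                log_length := R'.log_length
                lg := fun ρ h => by rw [hne _ _ _ (by simp)]; exact R'.lg ρ h
                keep := fun x i => by rw [hne _ _ _ (by simp)]; exact R'.keep x i }
            · rw [Mem.set_self, Mem.set_of_ne _ (by simp), Mem.set_of_ne _ (by simp),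
                Mem.set_of_ne _ (by simp)]
              rw [Mem.set_of_ne (b := Sum.inr ax) _ (by simp), Mem.set_of_ne (b := Sum.inr ax) _ (by simp),
                Mem.set_self, ← hi]
              exact R.skA i
  · simpa [hashSim, hashAns, corruptSim, corruptAns, Mem.regs] using hnil _ R

/-- Recording a query. -/
theorem Rep.record (R : Rep Q m' m TH Th sk st κ) (hc : st.count < Q) (s : Str) :
    Rep Q ((m'.set (.inr Own.lg) [List.replicate (Q - st.count) true] s).set (.inr Own.ql) []
      (List.replicate (Q - st.count) true).tail) m TH Th sk
      { st with count := st.count + 1, log := st.log ++ [s] } κ := by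
  have hne : ∀ b i x y j, b ≠ .inr Own.lg → b ≠ .inr Own.ql →
      ((m'.set (.inr Own.lg) j x).set (.inr Own.ql) [] y) b i = m' b i := fun b i x y j h1 h2 => by
    rw [Mem.set_of_ne _ h2, Mem.set_of_ne _ h1]
  have hl := R.log_length
  exact {
    mem := fun v i => by rw [hne _ _ _ _ _ (by simp) (by simp)]; exact R.mem v i
    nil := by rw [hne _ _ _ _ _ (by simp) (by simp)]; exact R.nil
    hdef_none := fun s p h => by
      rw [hne _ _ _ _ _ (by simp) (by simp)]; exact R.hdef_none s p h
    hdef_some := fun s p l h => by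
      rw [hne _ _ _ _ _ (by simp) (by simp)]; exact R.hdef_some s p l h
    hT := fun s p l h j => by rw [hne _ _ _ _ _ (by simp) (by simp)]; exact R.hT s p l h j
    hV_none := fun z h => by rw [hne _ _ _ _ _ (by simp) (by simp)]; exact R.hV_none z h
    hV_some := fun z v h => by rw [hne _ _ _ _ _ (by simp) (by simp)]; exact R.hV_some z v h
    skA := fun i => by rw [hne _ _ _ _ _ (by simp) (by simp)]; exact R.skA i
    left := by rw [hne _ _ _ _ _ (by simp) (by simp)]; exact R.left
    ql := by rw [Mem.set_self, List.tail_replicate]; congr 1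
    log_length := by simp only [List.length_append, List.length_singleton]; omega
    lg := fun ρ hρ => by
      rw [Mem.set_of_ne _ (by simp)]
      by_cases h : ρ = st.count
      · subst h
        rw [Mem.set_self, List.getElem?_append_right (by omega),
          show st.count - st.log.length = 0 by omega]
        rfl
      · have h' : Q - ρ ≠ Q - st.count := by omega
        have : m' (.inr Own.lg) [List.replicate (Q - ρ) true] = (st.log ++ [s])[ρ]?.getD [] := by
          rw [R.lg ρ hρ, List.getElem?_append]
          split
          · rfl
          · rw [List.getElem?_eq_none (by omega), List.getElem?_eq_none (by simp; omega)]
        simpa [Mem.set, h'] using this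
    keep := fun x i => by rw [hne _ _ _ _ _ (by simp) (by simp)]; exact R.keep x i }

theorem ev_hash'Sim (R : Rep Q m' m TH Th sk st κ) (as ds : List V)
    (ψ : Mem (V ⊕ Own S.n K) → σ → ℝ≥0∞)
    (Φ : (S.Salt × S.Pin → Fin S.n → Fin S.N) → (S.G → S.F) → Mem V → ISt S.N → ℝ≥0∞)
    (hψ : ∀ m'' m₂ Th' st', Rep Q m'' m₂ TH Th' sk st' κ →
      ψ m'' s₀ = E2 TH Th' fun H h => Φ H h m₂ st') :
    (hash'Sim ds as).ev S.primSem oracle m' s₀ ψ =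
      E2 TH Th fun H h => Φ H h (m.setRegs ds (S.iStep Q H h sk .hash' (m.regs as) st).1)
        (S.iStep Q H h sk .hash' (m.regs as) st).2 := by
  unfold hash'Sim
  rw [ev_ifHead, R.ql]
  by_cases hc : st.count < Q
  swap
  · rw [if_neg (by simp [Nat.sub_eq_zero_of_le (not_lt.1 hc)]), ev_skip]
    simp only [iStep, if_neg hc]
    have R' : Rep Q m' m TH Th sk { st with count := st.count + 1 } κ := {
      R with
      ql := by rw [R.ql]; congr 1; simp only; omega
      log_length := by rw [R.log_length]; simp only; omega }
    simpa [Mem.setRegs] using hψ _ _ _ _ R'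
  have hhead : (List.replicate (Q - st.count) true).head? = some true := by
    obtain ⟨c, hc'⟩ := Nat.exists_eq_succ_of_ne_zero (Nat.sub_ne_zero_of_lt hc)
    rw [hc', List.replicate_succ]; rfl
  rw [if_pos hhead]
  simp only [iStep, if_pos hc]
  set st' : ISt S.N := { st with count := st.count + 1, log := st.log ++ [(m.regs as).headD []] }
    with hst'
  have hrec : ∀ m₁ : Mem (V ⊕ Own S.n K), Rep Q m₁ m TH Th sk st κ →
      m₁ (.inr ax) [] = (m.regs as).headD [] →
      (Rep Q ((m₁.set (.inr lg) [m₁ (.inr ql) []] (m₁ (.inr ax) [])).set (.inr ql) []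
        (m₁ (.inr ql) []).tail) m TH Th sk st' κ) := by
    intro m₁ R₁ h₁
    rw [h₁, R₁.ql]
    exact R₁.record hc _
  have hnil : ∀ m'', Rep Q m'' m TH Th sk st' κ →
      ψ m'' s₀ = E2 TH Th fun H h => Φ H h (m.setRegs ds []) st' := fun m'' R' => by
    simpa [Mem.setRegs] using hψ _ _ _ _ R'
  have hqa : ∀ m₁ : Mem (V ⊕ Own S.n K), ∀ x, (m₁.set (.inr ax) [] x) (.inr ql) [] =
    m₁ (.inr ql) [] := fun m₁ x => Mem.set_of_ne _ (by simp) _ _ _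
  rcases as with _ | ⟨x, _ | ⟨y, l⟩⟩
  · simp only [seqs_cons, seqs_nil, ev_seq, ev_move, ev_skip, ev_pop, Mem.regs, List.map_cons,
      List.map_nil]
    have := hrec (m'.set (.inr ax) [] (m' (.inr Own.nil) [])) (R.set_scratch _ (by trivial) _ _)
      (by rw [Mem.set_self, R.nil]; rfl)
    refine hnil _ ?_
    rw [Mem.set_of_ne (m'.set _ _ _) (show (Sum.inr ql : V ⊕ Own S.n K) ≠ .inr lg by simp)]
    exact this
  · simp only [seqs_cons, seqs_nil, ev_seq, ev_move, ev_skip, ev_pop, Mem.regs, List.map_cons,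
      List.map_nil]
    have R₁ := hrec (m'.set (.inr ax) [] (m' (.inl x) [])) (R.set_scratch _ (by trivial) _ _)
      (by rw [Mem.set_self, R.mem]; rfl)
    rw [ev_ifValid S.encG rfl]
    have hax : ∀ (m₁ : Mem (V ⊕ Own S.n K)) i a b, ((m₁.set (.inr lg) i a).set (.inr ql) [] b)
        (.inr ax) [] = m₁ (.inr ax) [] := fun m₁ i a b => by
      rw [Mem.set_of_ne _ (by simp), Mem.set_of_ne _ (by simp)]
    have hql : ∀ (m₁ : Mem (V ⊕ Own S.n K)) i a, (m₁.set (.inr lg) i a) (.inr ql) [] =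
        m₁ (.inr ql) [] := fun m₁ i a => Mem.set_of_ne _ (by simp) _ _ _
    simp only [hax, hql, Mem.set_self, R.mem] at R₁ ⊢
    cases hd : decode S.encG (m x []) with
    | none =>
        simp only [ev_skip]
        refine (hnil _ (R₁.set_scratch _ (by trivial) _ _)).trans ?_
        simp only [hash'Ans, hd]
    | some z =>
        simp only [hash'Ans, hd, ev_seq]
        refine ev_fetchPad (z := z) (R₁.set_scratch _ (by trivial) _ _) ?_ _ _ ?_
        · rw [Mem.set_of_ne _ (by simp), Mem.set_of_ne _ (by simp), Mem.set_of_ne _ (by simp),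
            Mem.set_self]
          exact ((decode_eq_some _ _ _).1 hd).symm
        · intro m'' Th' v R' hv _ hval
          refine ev_give R' hval ds _ _ fun m₃ R₃ => ?_
          rw [hψ _ _ _ _ R₃]
          exact E2_congr fun H h _ hh => by rw [hh _ _ hv]
  · simp only [seqs_cons, seqs_nil, ev_seq, ev_move, ev_skip, ev_pop, Mem.regs, List.map_cons,
      List.map_nil]
    have := hrec (m'.set (.inr ax) [] (m' (.inl x) [])) (R.set_scratch _ (by trivial) _ _)
      (by rw [Mem.set_self, R.mem]; rfl)
    refine hnil _ ?_
    rw [Mem.set_of_ne (m'.set _ _ _) (show (Sum.inr ql : V ⊕ Own S.n K) ≠ .inr lg by simp)]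
    exact this

theorem E2_wp {α : Type} (p : PMF α) (F : (S.Salt × S.Pin → Fin S.n → Fin S.N) → (S.G → S.F) →
    α → ℝ≥0∞) : (wp p fun a => E2 TH Th fun H h => F H h a) =
      E2 TH Th fun H h => wp p (F H h) := by
  unfold E2
  rw [wp_comm]
  exact wp_congr fun H => wp_comm _ _ _

/-- A program with its challenger has the same effect as its simulation, which draws the values of
the hash functions when they are needed. -/
theorem ev_lift (c : Prog V (Prim S.n) LHEQuery) (R : Rep Q m' m TH Th sk st κ)
    (ψ : Mem (V ⊕ Own S.n K) → σ → ℝ≥0∞)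
    (Φ : (S.Salt × S.Pin → Fin S.n → Fin S.N) → (S.G → S.F) → Mem V → ISt S.N → ℝ≥0∞)
    (hψ : ∀ m'' m₂ TH' Th' st', Rep Q m'' m₂ TH' Th' sk st' κ →
      ψ m'' s₀ = E2 TH' Th' fun H h => Φ H h m₂ st') :
    (lift c).ev S.primSem oracle m' s₀ ψ =
      E2 TH Th fun H h => c.ev S.primSem (S.iOracle Q H h sk) m st (Φ H h) := by
  induction c generalizing m' m TH Th st ψ Φ with
  | skip => simpa [lift] using hψ _ _ _ _ _ R
  | seq c d ihc ihd =>
      simp only [lift, ev_seq]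
      exact ihc R _ _ fun m'' m₂ TH' Th' st' R' => ihd R' _ _ hψ
  | push b x =>
      simp only [lift, ev_push, R.mem]
      exact hψ _ _ _ _ _ (R.set_inl _ _ _)
  | pop x =>
      simp only [lift, ev_pop, R.mem]
      exact hψ _ _ _ _ _ (R.set_inl _ _ _)
  | move x is y js =>
      simp only [lift, ev_move, R.mem, R.regs]
      exact hψ _ _ _ _ _ (R.set_inl _ _ _)
  | ifHead x c d ihc ihd =>
      simp only [lift, ev_ifHead, R.mem]
      split
      · exact ihc R _ _ hψ
      · exact ihd R _ _ hψ
  | ifEq x y c d ihc ihd =>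
      simp only [lift, ev_ifEq, R.mem]
      split
      · exact ihc R _ _ hψ
      · exact ihd R _ _ hψ
  | prim f args dst =>
      simp only [lift, ev_prim, R.regs]
      rw [← E2_wp]
      exact wp_congr fun s => hψ _ _ _ _ _ (R.set_inl _ _ _)
  | query q args dsts =>
      simp only [ev_query, iOracle, wp_pure]
      cases q with
      | hash =>
          exact ev_hashSim R args dsts ψ (fun H h m => Φ H h m st) fun m'' m₂ TH' R' =>
            hψ _ _ _ _ _ R'
      | hash' => exact ev_hash'Sim R args dsts ψ Φ fun m'' m₂ Th' st' R' => hψ _ _ _ _ _ R'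
      | corrupt =>
          exact ev_corruptSim R args dsts ψ (fun m₂ st' => E2 TH Th fun H h => Φ H h m₂ st')
            fun m'' m₂ st' R' => hψ _ _ _ _ _ R'

/-! ### Cost and oracle queries of the simulation -/

theorem cost_fetchLoc_le : (fetchLoc : SimProg S V K O).cost ≤ 7 * S.n + 15 := by
  have h1 := cost_loop_le (P := Prim S.n) (O := O) (List.finRange S.n)
    (fun j => seq (.prim (.sample .idx) [] (.inr (tmp : Own S.n K)))
      (move (Sum.inr (hT j) : V ⊕ Own S.n K) [.inr ax, .inr ay] (.inr tmp) [])) 4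
    (fun i _ => by simp [cost])
  have h2 := cost_loop_le (P := Prim S.n) (O := O) (List.finRange S.n)
    (fun j => (move (Sum.inr (o j) : V ⊕ Own S.n K) [] (.inr (hT j)) [.inr ax, .inr ay])) 3
    (fun i _ => by simp [cost])
  simp only [List.length_finRange] at h1 h2
  simp only [fetchLoc, seqs_cons, seqs_nil, cost, List.length_cons, List.length_nil]
  omega

theorem cost_fetchPad : (fetchPad : SimProg S V K O).cost = 11 := by
  simp [fetchPad, cost]

theorem cost_give_le (ds : List V) : (give ds : SimProg S V K O).cost ≤ 1 := by
  cases ds <;> simp [give, cost]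

theorem cost_querySim_le (q : LHEQuery) (as ds : List V) :
    (querySim q as ds : SimProg S V K O).cost ≤ (7 * S.n + 35) * (1 + as.length + ds.length) := by
  have hgive := cost_give_le (S := S) (K := K) (O := O) ds
  have hbase : 7 * S.n + 35 + ds.length ≤ (7 * S.n + 35) * (1 + as.length + ds.length) := by
    nlinarith [Nat.zero_le (S.n * as.length), Nat.zero_le (S.n * ds.length)]
  refine le_trans ?_ hbase
  cases q with
  | hash =>
      rcases as with _ | ⟨x, _ | ⟨y, _ | ⟨_, _⟩⟩⟩ <;> try (simp only [querySim, hashSim, cost]; omega)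
      have h1 := cost_fetchLoc_le (S := S) (V := V) (K := K) (O := O)
      have h2 := cost_loop_le (P := Prim S.n) (O := O) (ds.zip (List.finRange S.n))
        (fun q => (move (Sum.inl q.1 : V ⊕ Own S.n K) [] (.inr (o q.2)) [])) 1
        (fun i _ => by simp [cost])
      have h3 : (ds.zip (List.finRange S.n)).length ≤ ds.length := by simp
      simp only [querySim, hashSim, seqs_cons, seqs_nil, cost, List.length_cons, List.length_nil]
      omega
  | hash' =>
      rcases as with _ | ⟨x, _ | ⟨y, l⟩⟩ <;>
      simp only [querySim, hash'Sim, seqs_cons, seqs_nil, cost, List.length_cons, List.length_nil,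
        cost_fetchPad] <;> omega
  | corrupt =>
      rcases as with _ | ⟨x, _ | ⟨_, _⟩⟩ <;>
      simp only [querySim, corruptSim, seqs_cons, seqs_nil, cost, List.length_cons, List.length_nil]
      <;> omega

theorem cost_lift_le (c : Prog V (Prim S.n) LHEQuery) :
    (lift c : SimProg S V K O).cost ≤ (7 * S.n + 35) * c.cost := by
  induction c with
  | seq c d ihc ihd => simp only [lift, cost, mul_add]; omega
  | ifHead x c d ihc ihd => simp only [lift, cost, mul_add]; omega
  | ifEq x y c d ihc ihd => simp only [lift, cost, mul_add]; omega
  | query q args dsts => exact cost_querySim_le q args dsts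
  | _ =>
      simp only [lift, cost, List.length_map]
      exact Nat.le_mul_of_pos_left _ (by omega)

theorem calls_loop {ι : Type} [DecidableEq O] (q : O) (l : List ι) (f : ι → Prog V (Prim S.n) O)
    (h : ∀ i, (f i).calls q = 0) : (loop l f).calls q = 0 := by
  induction l with
  | nil => rfl
  | cons i l ih => simp [calls, h, ih]

theorem calls_fetchLoc [DecidableEq O] (q : O) : (fetchLoc : SimProg S V K O).calls q = 0 := by
  simp only [fetchLoc, seqs_cons, seqs_nil, calls]
  rw [calls_loop _ _ _ (fun _ => by simp [calls]), calls_loop _ _ _ (fun _ => by simp [calls])]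

theorem calls_fetchPad [DecidableEq O] (q : O) : (fetchPad : SimProg S V K O).calls q = 0 := by
  simp [fetchPad, calls]

/-- The simulation answers all queries itself. -/
theorem calls_lift [DecidableEq O] (q : O) (c : Prog V (Prim S.n) LHEQuery) :
    (lift c : SimProg S V K O).calls q = 0 := by
  induction c with
  | seq c d ihc ihd => simp [lift, calls, ihc, ihd]
  | ifHead x c d ihc ihd => simp [lift, calls, ihc, ihd]
  | ifEq x y c d ihc ihd => simp [lift, calls, ihc, ihd]
  | query p as ds =>
      have hgive : (give ds : SimProg S V K O).calls q = 0 := by cases ds <;> rfl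
      cases p with
      | hash =>
          rcases as with _ | ⟨x, _ | ⟨y, _ | ⟨_, _⟩⟩⟩ <;> try rfl
          simp only [lift, querySim, hashSim, seqs_cons, seqs_nil, calls, calls_fetchLoc]
          rw [calls_loop _ _ _ (fun _ => by simp [calls])]
      | hash' =>
          rcases as with _ | ⟨x, _ | ⟨y, l⟩⟩ <;>
          simp [lift, querySim, hash'Sim, calls, calls_fetchPad, hgive]
      | corrupt =>
          rcases as with _ | ⟨x, _ | ⟨_, _⟩⟩ <;>
          simp [lift, querySim, corruptSim, calls, hgive]
  | _ => rfl

end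
end LHEParams
end

noncomputable section

/-! ### Building blocks of the reductions -/

theorem Mem.set_get {V : Type} (m : Mem V) (x : V) (i : List Str) : m.set x i (m x i) = m := by
  funext b j
  by_cases h : b = x ∧ j = i
  · simp [Mem.set, h.1, h.2]
  · simp [Mem.set, h]

theorem Mem.set_set {V : Type} (m : Mem V) (x : V) (i : List Str) (s s' : Str) :
    (m.set x i s).set x i s' = m.set x i s' := by
  funext b j
  by_cases h : b = x ∧ j = i
  · simp [Mem.set, h.1, h.2]
  · simp [Mem.set, h]

namespace Prog

section
variable {V P O σ : Type} {prim : P → List Str → PMF Str}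
  {oracle : O → List Str → σ → PMF (List Str × σ)} {s₀ : σ}

/-- Put a string in front of a register. -/
def pushes (s : Str) (x : V) : Prog V P O := s.foldr (fun b c => seq c (push b x)) skip

theorem ev_pushes (s : Str) (x : V) (m : Mem V) (ψ : Mem V → σ → ℝ≥0∞) :
    (pushes s x : Prog V P O).ev prim oracle m s₀ ψ = ψ (m.set x [] (s ++ m x [])) s₀ := by
  induction s generalizing ψ with
  | nil => simp [pushes, Mem.set_get]
  | cons b s ih =>
      refine (ev_seq prim oracle m s₀ ψ (pushes s x) (push b x)).trans ((ih _).trans ?_)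
      rw [ev_push, Mem.set_self, Mem.set_set]; rfl

theorem cost_pushes (s : Str) (x : V) : (pushes s x : Prog V P O).cost = s.length + 1 := by
  induction s with
  | nil => rfl
  | cons b s ih => rw [List.length_cons, ← ih]; rfl

theorem calls_pushes [DecidableEq O] (q : O) (s : Str) (x : V) :
    (pushes s x : Prog V P O).calls q = 0 := by
  induction s with
  | nil => rfl
  | cons b s ih => exact (add_zero _).trans ih

/-- A loop that keeps an invariant `I l m` between the list `l` of the rounds to come and the
memory. -/
theorem ev_loop_inv {ι : Type} {f : ι → Prog V P O} (I : List ι → Mem V → Prop)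
    (hstep : ∀ i l m ψ x, I (i :: l) m → (∀ m', I l m' → ψ m' s₀ = x) →
      (f i).ev prim oracle m s₀ ψ = x) (l : List ι) {m : Mem V} {ψ : Mem V → σ → ℝ≥0∞} {x : ℝ≥0∞}
    (h : I l m) (hψ : ∀ m', I [] m' → ψ m' s₀ = x) : (loop l f).ev prim oracle m s₀ ψ = x := by
  induction l generalizing m with
  | nil => simpa using hψ m h
  | cons i l ih =>
      rw [loop_cons, ev_seq]
      exact hstep i l m _ x h fun m' hm' => ih hm'

/-- A loop that draws a uniform value in each round; the invariant speaks of the values that have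
been drawn. -/
theorem ev_loop_sample_inv {ι α : Type} [Finite ι] [DecidableEq ι] [Finite α] [Nonempty α]
    {f : ι → Prog V P O} (I : (ι → α) → List ι → Mem V → Prop)
    (hstep : ∀ v i l m ψ g, I v (i :: l) m →
      (∀ x m', I (Function.update v i x) l m' → ψ m' s₀ = g x) →
      (f i).ev prim oracle m s₀ ψ = wp (unif α) g) (l : List ι) (hl : l.Nodup)
    (hl' : ∀ i, i ∈ l) {v₀ : ι → α} {m : Mem V} {ψ : Mem V → σ → ℝ≥0∞} {G : (ι → α) → ℝ≥0∞}
    (h : I v₀ l m) (hψ : ∀ v m', I v [] m' → ψ m' s₀ = G v) :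
    (loop l f).ev prim oracle m s₀ ψ = wp (unif (ι → α)) G := by
  have key : ∀ (l : List ι) (hl : l.Nodup) (v₀ : ι → α) (m : Mem V), I v₀ l m →
      (loop l f).ev prim oracle m s₀ ψ =
        wp (unif (ι → α)) fun v => G fun i => if i ∈ l then v i else v₀ i := by
    intro l
    induction l with
    | nil =>
        intro _ v₀ m h
        simpa [wp_const] using hψ v₀ m h
    | cons i l ih =>
        intro hl v₀ m h
        rw [List.nodup_cons] at hl
        rw [loop_cons, ev_seq, wp_unif_resample i]
        refine hstep v₀ i l m _ _ h fun x m' hm' => (ih hl.2 _ m' hm').trans ?_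
        refine wp_congr fun v => ?_
        congr 1
        funext j
        by_cases hj : j = i
        · subst hj; simp [hl.1]
        · simp [hj]
  simpa [hl'] using key l hl v₀ m h

end

end Prog

namespace LHEParams

section
variable {S : LHEParams} {V K O σ : Type}

open Prog Own

variable {Q : ℕ} {m' m'' : Mem (V ⊕ Own S.n K)} {m : Mem V}
    {TH : S.Salt × S.Pin → Option (Fin S.n → Fin S.N)} {Th : S.G → Option S.F}
    {sk : Fin S.N → ZMod S.p} {st : ISt S.N} {κ : Mem K}
    {oracle : O → List Str → σ → PMF (List Str × σ)} {s₀ : σ}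

theorem Rep.set_keep (R : Rep Q m' m TH Th sk st κ) (x : K) (i : List Str) (s : Str) :
    Rep Q (m'.set (.inr (Own.keep x)) i s) m TH Th sk st (κ.set x i s) := by
  have h : ∀ b j, b ≠ .inr (Own.keep x) → (m'.set (.inr (Own.keep x)) i s) b j = m' b j :=
    fun b j hb => Mem.set_of_ne _ hb _ _ _
  exact {
    mem := fun v i => (h _ _ (by simp)).trans (R.mem v i)
    nil := (h _ _ (by simp)).trans R.nil
    hdef_none := fun s p hT => (h _ _ (by simp)).trans (R.hdef_none s p hT)
    hdef_some := fun s p loc hT => by rw [h _ _ (by simp)]; exact R.hdef_some s p loc hT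
    hT := fun s p loc hT j => (h _ _ (by simp)).trans (R.hT s p loc hT j)
    hV_none := fun z hz => (h _ _ (by simp)).trans (R.hV_none z hz)
    hV_some := fun z v hz => (h _ _ (by simp)).trans (R.hV_some z v hz)
    skA := fun i => (h _ _ (by simp)).trans (R.skA i)
    left := (h _ _ (by simp)).trans R.left
    ql := (h _ _ (by simp)).trans R.ql
    log_length := R.log_length
    lg := fun ρ hs => (h _ _ (by simp)).trans (R.lg ρ hs)
    keep := fun y j => by by_cases hy : y = x <;> simp [Mem.set, hy, R.keep] }

theorem Rep.set_left (R : Rep Q m' m TH Th sk st κ) (c : ℕ) :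
    Rep Q (m'.set (.inr Own.left) [] (List.replicate c true)) m TH Th sk { st with left := c } κ := by
  have h : ∀ b j s, b ≠ .inr Own.left → (m'.set (.inr Own.left) [] s) b j = m' b j :=
    fun b j s hb => Mem.set_of_ne _ hb _ _ _
  exact {
    mem := fun v i => (h _ _ _ (by simp)).trans (R.mem v i)
    nil := (h _ _ _ (by simp)).trans R.nil
    hdef_none := fun s p hT => (h _ _ _ (by simp)).trans (R.hdef_none s p hT)
    hdef_some := fun s p loc hT => by rw [h _ _ _ (by simp)]; exact R.hdef_some s p loc hT
    hT := fun s p loc hT j => (h _ _ _ (by simp)).trans (R.hT s p loc hT j)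
    hV_none := fun z hz => (h _ _ _ (by simp)).trans (R.hV_none z hz)
    hV_some := fun z v hz => (h _ _ _ (by simp)).trans (R.hV_some z v hz)
    skA := fun i => (h _ _ _ (by simp)).trans (R.skA i)
    left := Mem.set_self _ _ _ _
    ql := (h _ _ _ (by simp)).trans R.ql
    log_length := R.log_length
    lg := fun ρ hs => (h _ _ _ (by simp)).trans (R.lg ρ hs)
    keep := fun y j => (h _ _ _ (by simp)).trans (R.keep y j) }

/-- Put a constant into a register. -/
def const (s : Str) (x : V ⊕ Own S.n K) : SimProg S V K O :=
  seq (move x [] (.inr nil) []) (pushes s x)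

theorem ev_const (s : Str) (x : V ⊕ Own S.n K) (h : m' (.inr nil) [] = [])
    (ψ : Mem (V ⊕ Own S.n K) → σ → ℝ≥0∞) :
    (const s x).ev S.primSem oracle m' s₀ ψ = ψ (m'.set x [] s) s₀ := by
  simp [const, ev_pushes, Mem.regs, Mem.set_self, Mem.set_set, h]

theorem cost_const (s : Str) (x : V ⊕ Own S.n K) :
    (const s x : SimProg S V K O).cost = s.length + 2 := by
  simp [const, cost, cost_pushes]; omega

theorem calls_const [DecidableEq O] (q : O) (s : Str) (x : V ⊕ Own S.n K) :
    (const s x : SimProg S V K O).calls q = 0 := by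
  simp [const, calls, calls_pushes]

section prim
variable {W : Type} {m : Mem W} {ψ : Mem W → σ → ℝ≥0∞} {a b d : W}

theorem ev_gen : (Prog.prim .gen [] d : Prog W (Prim S.n) O).ev S.primSem oracle m s₀ ψ =
    ψ (m.set d [] (S.encG S.g)) s₀ := by
  simp [primSem, wp_pure]

theorem ev_grpPow {X : S.G} {r : ZMod S.p} (ha : m a [] = S.encG X)
    (hb : m b [] = sclCode S.p r) :
    (Prog.prim .grpPow [a, b] d : Prog W (Prim S.n) O).ev S.primSem oracle m s₀ ψ =
      ψ (m.set d [] (S.encG (X ^ r.val))) s₀ := by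
  simp [primSem, wp_pure, strOp₂, Mem.regs, ha, hb, decode_apply]

theorem ev_grpMul {X Y : S.G} (ha : m a [] = S.encG X) (hb : m b [] = S.encG Y) :
    (Prog.prim .grpMul [a, b] d : Prog W (Prim S.n) O).ev S.primSem oracle m s₀ ψ =
      ψ (m.set d [] (S.encG (X * Y))) s₀ := by
  simp [primSem, wp_pure, strOp₂, Mem.regs, ha, hb, decode_apply]

theorem ev_grpInv {X : S.G} (ha : m a [] = S.encG X) :
    (Prog.prim .grpInv [a] d : Prog W (Prim S.n) O).ev S.primSem oracle m s₀ ψ =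
      ψ (m.set d [] (S.encG X⁻¹)) s₀ := by
  simp [primSem, wp_pure, strOp₁, Mem.regs, ha, decode_apply]

theorem ev_fldAdd {x y : S.F} (ha : m a [] = S.encF x) (hb : m b [] = S.encF y) :
    (Prog.prim .fldAdd [a, b] d : Prog W (Prim S.n) O).ev S.primSem oracle m s₀ ψ =
      ψ (m.set d [] (S.encF (x + y))) s₀ := by
  simp [primSem, wp_pure, strOp₂, Mem.regs, ha, hb, decode_apply]

theorem ev_fldMul {x y : S.F} (ha : m a [] = S.encF x) (hb : m b [] = S.encF y) :
    (Prog.prim .fldMul [a, b] d : Prog W (Prim S.n) O).ev S.primSem oracle m s₀ ψ =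
      ψ (m.set d [] (S.encF (x * y))) s₀ := by
  simp [primSem, wp_pure, strOp₂, Mem.regs, ha, hb, decode_apply]

theorem ev_fldNeg {x : S.F} (ha : m a [] = S.encF x) :
    (Prog.prim .fldNeg [a] d : Prog W (Prim S.n) O).ev S.primSem oracle m s₀ ψ =
      ψ (m.set d [] (S.encF (-x))) s₀ := by
  simp [primSem, wp_pure, strOp₁, Mem.regs, ha, decode_apply]

theorem ev_point {j : Fin S.n} :
    (Prog.prim (.point j) [] d : Prog W (Prim S.n) O).ev S.primSem oracle m s₀ ψ =
      ψ (m.set d [] (S.encF (S.point j))) s₀ := by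
  simp [primSem, wp_pure]

theorem ev_sample {k : Kind} :
    (Prog.prim (.sample k) [] d : Prog W (Prim S.n) O).ev S.primSem oracle m s₀ ψ =
      wp (S.sampleSem k) fun s => ψ (m.set d [] s) s₀ := by
  simp [primSem]

end prim

end

/-! ### The common part of the reductions -/

/-- The registers of the reductions besides those for the simulation of the challenger. -/
inductive Aux (S : LHEParams)
  /-- the index `i` in binary -/
  | ix (i : ℕ)
  /-- the inputs of a CDH adversary -/
  | x | y
  /-- the salt, the PIN and their location -/
  | salt | pin | loc (j : Fin S.n)
  /-- the nonces -/
  | r (j : Fin S.n)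
  /-- the components of the challenge -/
  | body | hd (j : Fin S.n) | pad (j : Fin S.n)
  /-- the key of the authenticated encryption -/
  | key
  /-- the coefficients of the polynomial of the secret sharing -/
  | cf (i : Fin (S.t - 1))

section
variable {S : LHEParams} {O σ : Type} (A : LHEAdversary S) (Q : ℕ)

open Prog Own

/-- The initial part of both reductions: index constants, key pairs, salt, PIN and location, and the
first components of the ElGamal ciphertexts. -/
def setup : SimProg S A.V (Aux S) O := seqs [
  loop (List.range (S.N + S.n)) fun i => const (Nat.bits i) (.inr (keep (.ix i))),
  const (List.replicate Q true) (.inr ql),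
  loop (List.finRange S.N) fun i => seq (.prim (.sample .scl) [] (.inr tmp))
    (move (.inr skA) [.inr (keep (.ix i))] (.inr tmp) []),
  loop (List.finRange S.N) fun i => seqs [
    .prim .gen [] (.inr val),
    move (.inr ax) [] (.inr skA) [.inr (keep (.ix i))],
    .prim .grpPow [.inr val, .inr ax] (.inr ax),
    move (.inl A.pkIn) [.inr (keep (.ix i))] (.inr ax) []],
  .prim (.sample .salt) [] (.inr (keep .salt)),
  .prim (.sample .pin) [] (.inr (keep .pin)),
  loop (List.finRange S.n) fun j => seqs [
    .prim (.sample .scl) [] (.inr (keep (.r j))),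
    .prim .gen [] (.inr val),
    .prim .grpPow [.inr val, .inr (keep (.r j))] (.inr (keep (.hd j)))],
  move (.inr ax) [] (.inr (keep .salt)) [],
  move (.inr ay) [] (.inr (keep .pin)) [],
  fetchLoc,
  loop (List.finRange S.n) fun j => move (.inr (keep (.loc j))) [] (.inr (o j)) []]

/-- The kept registers that are never changed after the beginning, up to the encryption of the
message. -/
structure Consts (X Y : Str) (κ : Mem (Aux S)) : Prop where
  ix : ∀ i < S.N + S.n, κ (.ix i) [] = Nat.bits i
  x : κ .x [] = X
  y : κ .y [] = Y
  body : κ .body [] = []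

variable {A Q} {X Y : Str} {κ : Mem (Aux S)}

/-- The registers that are set after the beginning. -/
def Aux.IsVar : Aux S → Prop
  | .ix _ | .x | .y | .body => False
  | _ => True

theorem Consts.set (h : Consts X Y κ) {z : Aux S} (hz : z.IsVar) (i : List Str) (s : Str) :
    Consts X Y (κ.set z i s) where
  ix j hj := (Mem.set_of_ne _ (by rintro rfl; exact hz) _ _ _).trans (h.ix j hj)
  x := (Mem.set_of_ne _ (by rintro rfl; exact hz) _ _ _).trans h.x
  y := (Mem.set_of_ne _ (by rintro rfl; exact hz) _ _ _).trans h.y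
  body := (Mem.set_of_ne _ (by rintro rfl; exact hz) _ _ _).trans h.body

variable {oracle : O → List Str → σ → PMF (List Str × σ)} {s₀ : σ}

/-- The state of the challenger at the beginning. -/
def ISt.init {N : ℕ} : ISt N := ⟨0, 0, [], ∅⟩

/-- The setup draws the secret keys, the salt, the PIN and the nonces. It looks up the location of
the challenge in advance; with lazy sampling this makes no difference. -/
theorem ev_setup {m' : Mem (A.V ⊕ Own S.n (Aux S))}
    (h0 : ∀ b i, (∀ z, b ≠ .inr (keep z)) → m' b i = [])
    (hx : m' (.inr (keep .x)) [] = X) (hy : m' (.inr (keep .y)) [] = Y)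
    (hbody : m' (.inr (keep .body)) [] = []) {ψ : Mem (A.V ⊕ Own S.n (Aux S)) → σ → ℝ≥0∞}
    {F : (Fin S.N → ZMod S.p) → S.Salt → S.Pin → (Fin S.n → ZMod S.p) →
      (S.Salt × S.Pin → Fin S.n → Fin S.N) → (S.G → S.F) → ℝ≥0∞}
    (hψ : ∀ sk salt pin r m'' TH loc κ,
      Rep Q m'' ((Mem.empty A.V).setVec A.pkIn fun i => S.encG (S.pubKey (sk i))) TH
        (fun _ => none) sk ISt.init κ → TH (salt, pin) = some loc → Consts X Y κ →
      κ .salt [] = saltCode S.saltLen salt → (∀ j, κ (.loc j) [] = idxCode S.N (loc j)) →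
      (∀ j, κ (.r j) [] = sclCode S.p (r j)) → (∀ j, κ (.hd j) [] = S.encG (S.g ^ (r j).val)) →
      ψ m'' s₀ = E2 TH (fun _ => none) (F sk salt pin r)) :
    (setup A Q).ev S.primSem oracle m' s₀ ψ =
      wp (unif _) fun sk => wp (unif _) fun salt => wp (unif _) fun pin => wp (unif _) fun r =>
        E2 (fun _ => none) (fun _ => none) (F sk salt pin r) := by
  classical
  unfold setup
  simp only [seqs_cons, seqs_nil, ev_seq, ev_skip]
  -- the index constants
  refine ev_loop_inv (fun l m => (∀ b i, (∀ z, b ≠ .inr (keep z)) → m b i = []) ∧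
    (∀ i < S.N + S.n, i ∉ l → m (.inr (keep (.ix i))) [] = Nat.bits i) ∧
    m (.inr (keep .x)) [] = X ∧ m (.inr (keep .y)) [] = Y ∧ m (.inr (keep .body)) [] = []) ?_ _
    ⟨h0, fun i hi hi' => absurd (List.mem_range.2 hi) hi', hx, hy, hbody⟩ ?_
  · rintro i l m ψ x ⟨h1, h2, h3, h4, h5⟩ hψ
    rw [ev_const _ _ (h1 _ _ (by simp))]
    refine hψ _ ⟨fun b i' hb => ?_, fun i' hi' hi'' => ?_, ?_, ?_, ?_⟩
    · rw [Mem.set_of_ne _ (hb _), h1 _ _ hb]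
    · by_cases hii : i' = i
      · subst hii; rw [Mem.set_self]
      · rw [Mem.set_of_ne _ (by simpa using hii)]; exact h2 i' hi' (by simp [hii, hi''])
    · rw [Mem.set_of_ne _ (by simp), h3]
    · rw [Mem.set_of_ne _ (by simp), h4]
    · rw [Mem.set_of_ne _ (by simp), h5]
  clear h0 hx hy hbody m'
  rintro m₁ ⟨h1, h2, h3, h4, h5⟩
  rw [ev_const _ _ (h1 _ _ (by simp))]
  -- the secret keys
  refine ev_loop_sample_inv (fun v l m => (∀ i ∉ l, m (.inr skA) [idxCode S.N i] =
      sclCode S.p (v i)) ∧ ∀ b i, b ≠ .inr skA → b ≠ .inr tmp →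
        m b i = (m₁.set (.inr ql) [] (List.replicate Q true)) b i) ?_ (List.finRange S.N)
      (List.nodup_finRange _) (fun i => List.mem_finRange i) (v₀ := 0)
      ⟨fun i hi => absurd (List.mem_finRange i) hi, fun _ _ _ _ => rfl⟩ ?_
  · rintro v i l m ψ g ⟨hA, hB⟩ hψ
    simp only [ev_seq, ev_sample, ev_move, sampleSem, wp_map, Mem.regs, List.map_cons,
      List.map_nil, Mem.set_self]
    refine wp_congr fun x => hψ x _ ⟨fun i' hi' => ?_, fun b i' hb hb' => ?_⟩
    · have e : (m.set (.inr tmp) [] (sclCode S.p x)) (.inr (keep (.ix i))) [] = Nat.bits i := by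
        rw [Mem.set_of_ne _ (by simp), hB _ _ (by simp) (by simp), Mem.set_of_ne _ (by simp),
          h2 i (by have := i.2; omega) (by simp)]
      rw [e]
      by_cases hii : i' = i
      · subst hii
        rw [Function.update_self]
        exact Mem.set_self _ _ _ _
      · rw [Function.update_of_ne hii, ← hA i' (by simp [hii, hi'])]
        have : ([idxCode S.N i'] : List Str) ≠ [Nat.bits i] := fun h =>
          hii ((idxCode S.N).injective (List.singleton_injective h))
        simp [Mem.set, this]
    · rw [Mem.set_of_ne _ hb, Mem.set_of_ne _ hb', hB _ _ hb hb']
  rintro sk m₂ ⟨hA, hB⟩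
  have hC : ∀ b i, b ≠ .inr skA → b ≠ .inr tmp → b ≠ .inr ql → m₂ b i = m₁ b i :=
    fun b i h h' h'' => by rw [hB b i h h', Mem.set_of_ne _ h'']
  have R₂ : Rep Q m₂ (Mem.empty A.V) (fun _ => none) (fun _ => none) sk ISt.init
      (fun z i => m₂ (.inr (keep z)) i) := by
    refine ⟨?_, ?_, ?_, ?_, ?_, ?_, ?_, ?_, ?_, ?_, ?_, ?_, ?_⟩
    · exact fun v i => (hC _ _ (by simp) (by simp) (by simp)).trans (h1 _ _ (by simp))
    · exact (hC _ _ (by simp) (by simp) (by simp)).trans (h1 _ _ (by simp))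
    · exact fun s p _ => (hC _ _ (by simp) (by simp) (by simp)).trans (h1 _ _ (by simp))
    · exact fun s p _ h => absurd h (by simp)
    · exact fun s p _ h => absurd h (by simp)
    · exact fun z _ => (hC _ _ (by simp) (by simp) (by simp)).trans (h1 _ _ (by simp))
    · exact fun z _ h => absurd h (by simp)
    · exact fun i => hA i (by simp)
    · exact (hC _ _ (by simp) (by simp) (by simp)).trans (h1 _ _ (by simp))
    · rw [hB _ _ (by simp) (by simp), Mem.set_self]; rfl
    · simp [ISt.init]
    · exact fun ρ _ => (hC _ _ (by simp) (by simp) (by simp)).trans (h1 _ _ (by simp))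
    · exact fun _ _ => rfl
  have hκ : Consts X Y (fun (z : Aux S) i => m₂ (.inr (keep z)) i) := by
    refine ⟨fun i hi => ?_, ?_, ?_, ?_⟩
    · rw [hC _ _ (by simp) (by simp) (by simp), h2 i hi (by simp)]
    all_goals rw [hC _ _ (by simp) (by simp) (by simp)]; assumption
  generalize (fun (z : Aux S) i => m₂ (.inr (keep z)) i) = κ at R₂ hκ
  clear h1 h2 h3 h4 h5 hA hB hC m₁
  -- the public keys
  refine ev_loop_inv (fun l m => ∃ mA, Rep Q m mA (fun _ => none) (fun _ => none) sk ISt.init κ ∧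
    l.foldl (fun m i => m.set A.pkIn [idxCode S.N i] (S.encG (S.pubKey (sk i)))) mA =
      (Mem.empty A.V).setVec A.pkIn fun i => S.encG (S.pubKey (sk i))) ?_ _ ⟨_, R₂, rfl⟩ ?_
  · rintro i l m ψ x ⟨mA, R, hm⟩ hψ
    have hix : κ (.ix i) [] = idxCode S.N i := hκ.ix i (by have := i.2; omega)
    simp only [ev_seq, ev_skip, ev_gen, ev_move, Mem.regs, List.map_cons, List.map_nil]
    rw [ev_grpPow (X := S.g) (r := sk i)]
    rotate_left
    · rw [Mem.set_of_ne _ (by simp), Mem.set_self]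
    · rw [Mem.set_self, Mem.set_of_ne _ (by simp), Mem.set_of_ne _ (by simp), R.keep, hix, R.skA]
    have R' := ((R.set_scratch (.inr val) (by trivial) [] (S.encG S.g)).set_scratch (.inr ax)
      (by trivial) [] ((m.set (.inr val) [] (S.encG S.g)) (.inr skA)
        [(m.set (.inr val) [] (S.encG S.g)) (.inr (keep (.ix i))) []])).set_scratch (.inr ax)
      (by trivial) [] (S.encG (S.g ^ (sk i).val))
    rw [Mem.set_self]
    refine hψ _ ⟨_, R'.set_inl _ _ _, ?_⟩
    rw [R'.keep, hix]
    exact hm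
  clear R₂ m₂
  rintro m₃ ⟨mA, R, hmA⟩
  change mA = _ at hmA
  -- salt, PIN and nonces
  simp only [ev_sample, sampleSem, wp_map]
  refine wp_congr fun salt => wp_congr fun pin => ?_
  refine ev_loop_sample_inv (fun v l m => ∃ κ', Rep Q m mA (fun _ => none) (fun _ => none) sk
    ISt.init κ' ∧ Consts X Y κ' ∧ κ' .salt [] = saltCode S.saltLen salt ∧
      κ' .pin [] = S.encPin pin ∧ (∀ j ∉ l, κ' (.r j) [] = sclCode S.p (v j)) ∧
      ∀ j ∉ l, κ' (.hd j) [] = S.encG (S.g ^ (v j).val)) ?_ (List.finRange S.n)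
      (List.nodup_finRange _) (fun i => List.mem_finRange i) (v₀ := 0)
      ⟨_, (R.set_keep _ _ _).set_keep _ _ _, (hκ.set (z := .salt) (by trivial) _ _).set (z := .pin)
        (by trivial) _ _, ?_, ?_,
        fun i hi => absurd (List.mem_finRange i) hi, fun i hi => absurd (List.mem_finRange i) hi⟩ ?_
  · rintro v j l m ψ g ⟨κ', R', c1, c2, c3, c4, c5⟩ hψ
    simp only [ev_seq, ev_skip, ev_gen, ev_sample, sampleSem, wp_map]
    refine wp_congr fun x => ?_
    rw [ev_grpPow (X := S.g) (r := x) (Mem.set_self _ _ _ _)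
      ((Mem.set_of_ne _ (by simp) _ _ _).trans (Mem.set_self _ _ _ _))]
    refine hψ x _ ⟨_, ((R'.set_keep _ _ _).set_scratch _ (by trivial) _ _).set_keep _ _ _,
      (c1.set (z := .r j) (by trivial) _ _).set (z := .hd j) (by trivial) _ _, ?_, ?_, ?_, ?_⟩
    · rw [Mem.set_of_ne _ (by simp), Mem.set_of_ne _ (by simp), c2]
    · rw [Mem.set_of_ne _ (by simp), Mem.set_of_ne _ (by simp), c3]
    · intro j' hj'
      rw [Mem.set_of_ne _ (by simp)]
      by_cases hjj : j' = j
      · subst hjj; rw [Mem.set_self, Function.update_self]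
      · rw [Mem.set_of_ne _ (by simpa using hjj), Function.update_of_ne hjj]
        exact c4 j' (by simp [hjj, hj'])
    · intro j' hj'
      by_cases hjj : j' = j
      · subst hjj; rw [Mem.set_self, Function.update_self]
      · rw [Mem.set_of_ne _ (by simpa using hjj), Function.update_of_ne hjj,
          Mem.set_of_ne _ (by simp)]
        exact c5 j' (by simp [hjj, hj'])
  · rw [Mem.set_of_ne _ (by simp), Mem.set_self]
  · rw [Mem.set_self]
  clear hκ R m₃
  -- the location
  rintro r m₄ ⟨κ', R, c1, c2, c3, c4, c5⟩
  simp only [ev_move, Mem.regs, List.map_nil]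
  refine ev_fetchLoc (s := salt) (p := pin) ((R.set_scratch _ (by trivial) _ _).set_scratch _
    (by trivial) _ _) ?_ ?_ _ _ ?_
  · rw [Mem.set_of_ne _ (by simp), Mem.set_self, R.keep, c2]
  · rw [Mem.set_self, Mem.set_of_ne _ (by simp), R.keep, c3]
  intro m₅ TH loc R₅ hTH ho
  refine ev_loop_inv (fun l m => (∀ j, m (.inr (o j)) [] = idxCode S.N (loc j)) ∧
    ∃ κ', Rep Q m mA TH (fun _ => none) sk
    ISt.init κ' ∧ Consts X Y κ' ∧ κ' .salt [] = saltCode S.saltLen salt ∧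
      (∀ j, κ' (.r j) [] = sclCode S.p (r j)) ∧
      (∀ j, κ' (.hd j) [] = S.encG (S.g ^ (r j).val)) ∧
      (∀ j ∉ l, κ' (.loc j) [] = idxCode S.N (loc j))) ?_ _
      ⟨ho, κ', R₅, c1, c2, fun j => c4 j (by simp), fun j => c5 j (by simp),
        fun i hi => absurd (List.mem_finRange i) hi⟩ ?_
  · rintro j l m ψ x ⟨ho, κ', R', c1, c2, c4, c5, c6⟩ hψ
    simp only [ev_move, Mem.regs, List.map_nil, ho]
    refine hψ _ ⟨fun j' => (Mem.set_of_ne _ (by simp) _ _ _).trans (ho j'), _,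
      R'.set_keep _ _ _, c1.set (z := .loc j) (by trivial) _ _, ?_, ?_, ?_, ?_⟩
    · rw [Mem.set_of_ne _ (by simp), c2]
    · intro j'; rw [Mem.set_of_ne _ (by simp), c4]
    · intro j'; rw [Mem.set_of_ne _ (by simp), c5]
    · intro j' hj'
      by_cases hjj : j' = j
      · subst hjj; rw [Mem.set_self]
      · rw [Mem.set_of_ne _ (by simpa using hjj)]
        exact c6 j' (by simp [hjj, hj'])
  · rintro m₆ ⟨_, κ₆, R₆, c1, c2, c4, c5, c6⟩
    rw [hmA] at R₆
    exact hψ sk salt pin r m₆ TH loc κ₆ R₆ hTH c1 c2 (fun j => c6 j (by simp)) c4 c5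

end
end LHEParams
end

noncomputable section

namespace LHEParams

section
variable {S : LHEParams} {O σ : Type} {A : LHEAdversary S} {Q : ℕ}

open Prog Own

/-! ### The simulated attack -/

theorem E2_const {TH : S.Salt × S.Pin → Option (Fin S.n → Fin S.N)} {Th : S.G → Option S.F}
    (x : ℝ≥0∞) : E2 TH Th (fun _ _ => x) = x := by
  simp [E2, wp_const]

variable (A) in
/-- Give the challenge to the adversary, and allow corruptions. -/
def challenge : SimProg S A.V (Aux S) O := seqs [
  move (.inl A.saltIn) [] (.inr (keep .salt)) [],
  move (.inl A.bodyIn) [] (.inr (keep .body)) [],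
  loop (List.finRange S.n) fun j =>
    move (.inl A.headIn) [.inr (keep (.ix j))] (.inr (keep (.hd j))) [],
  loop (List.finRange S.n) fun j =>
    move (.inl A.padIn) [.inr (keep (.ix j))] (.inr (keep (.pad j))) [],
  const (List.replicate (S.N / 16) true) (.inr left)]

variable (A) in
/-- The attack, with the program `E` for the encryption of one of the messages. -/
def attack (E : SimProg S A.V (Aux S) O) : SimProg S A.V (Aux S) O :=
  seqs [lift A.choose, E, challenge A, lift A.guess]

variable {m' : Mem (A.V ⊕ Own S.n (Aux S))} {m : Mem A.V}
    {TH : S.Salt × S.Pin → Option (Fin S.n → Fin S.N)} {Th : S.G → Option S.F}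
    {sk : Fin S.N → ZMod S.p} {st : ISt S.N} {κ : Mem (Aux S)}
    {oracle : O → List Str → σ → PMF (List Str × σ)} {s₀ : σ}

theorem ev_copyVec (R : Rep Q m' m TH Th sk st κ) (hix : ∀ j : Fin S.n, κ (.ix j) [] = idxCode S.n j)
    (a : A.V) (f : Fin S.n → Aux S) {v : Fin S.n → Str} (hf : ∀ j, κ (f j) [] = v j)
    {ψ : Mem (A.V ⊕ Own S.n (Aux S)) → σ → ℝ≥0∞} {x : ℝ≥0∞}
    (hψ : ∀ m'', Rep Q m'' (m.setVec a v) TH Th sk st κ → ψ m'' s₀ = x) :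
    (loop (List.finRange S.n) fun j => (move (.inl a) [.inr (keep (.ix j))]
      (.inr (keep (f j))) [] : SimProg S A.V (Aux S) O)).ev S.primSem oracle m' s₀ ψ = x := by
  refine ev_loop_inv (fun l m' => ∃ m₁, Rep Q m' m₁ TH Th sk st κ ∧
    l.foldl (fun m j => m.set a [idxCode S.n j] (v j)) m₁ = m.setVec a v) ?_ _ ⟨m, R, rfl⟩ ?_
  · rintro j l m' ψ x ⟨m₁, R, hm⟩ hψ
    simp only [ev_move, Mem.regs, List.map_cons, List.map_nil]
    refine hψ _ ⟨_, R.set_inl _ _ _, ?_⟩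
    rw [R.keep, R.keep, hix, hf]
    exact hm
  · rintro m'' ⟨m₁, R, hm⟩
    exact hψ m'' (hm ▸ R)

theorem ev_challenge (R : Rep Q m' m TH Th sk st κ)
    (hix : ∀ j : Fin S.n, κ (.ix j) [] = idxCode S.n j) {salt : S.Salt}
    (hsalt : κ .salt [] = saltCode S.saltLen salt) {M : Str} (hM : κ .body [] = M)
    {X : Fin S.n → S.G} (hX : ∀ j, κ (.hd j) [] = S.encG (X j))
    {u : Fin S.n → S.F} (hu : ∀ j, κ (.pad j) [] = S.encF (u j))
    {ψ : Mem (A.V ⊕ Own S.n (Aux S)) → σ → ℝ≥0∞} {x : ℝ≥0∞}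
    (hψ : ∀ m'', Rep Q m'' (inject A m salt M X u) TH Th sk { st with left := S.N / 16 } κ →
      ψ m'' s₀ = x) :
    (challenge A).ev S.primSem oracle m' s₀ ψ = x := by
  simp only [challenge, seqs_cons, seqs_nil, ev_seq, ev_move, ev_skip, Mem.regs, List.map_nil]
  have R' := (R.set_inl A.saltIn [] (κ .salt [])).set_inl A.bodyIn [] (κ .body [])
  rw [R.keep, Mem.set_of_ne _ (by simp), R.keep]
  refine ev_copyVec R' hix _ _ hX fun m₁ R₁ => ev_copyVec R₁ hix _ _ hu fun m₂ R₂ => ?_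
  rw [ev_const _ _ R₂.nil]
  refine hψ _ ?_
  rw [hsalt, hM] at R₂
  exact R₂.set_left _

/-- The simulated attack has the effect of the attack in the security game. -/
theorem ev_attack {X Y : Str} {pk : Fin S.N → S.G}
    (R : Rep Q m' ((Mem.empty A.V).setVec A.pkIn fun i => S.encG (pk i)) TH Th sk ISt.init κ)
    (hκ : Consts X Y κ) {salt : S.Salt} (hsalt : κ .salt [] = saltCode S.saltLen salt)
    {C : Fin S.n → S.G} (hC : ∀ j, κ (.hd j) [] = S.encG (C j))
    {u : Fin S.n → S.F} (hu : ∀ j, κ (.pad j) [] = S.encF (u j))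
    {E : SimProg S A.V (Aux S) O} {encM : Str → Str → PMF Str}
    (hE : ∀ m₁' m₁ TH Th st ψ' G, Rep Q m₁' m₁ TH Th sk st κ →
      (∀ M m'' s, Rep Q m'' m₁ TH Th sk st (κ.set .body [] M) → ψ' m'' s = G M) →
      E.ev S.primSem oracle m₁' s₀ ψ' = wp (encM (m₁ A.msg₀ []) (m₁ A.msg₁ [])) G)
    {ψ : Mem (A.V ⊕ Own S.n (Aux S)) → σ → ℝ≥0∞} {φ : Mem A.V → ISt S.N → ℝ≥0∞}
    (hψ : ∀ m'' m₂ TH' Th' st' s κ', Rep Q m'' m₂ TH' Th' sk st' κ' → ψ m'' s = φ m₂ st') :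
    (attack A E).ev S.primSem oracle m' s₀ ψ =
      E2 TH Th fun H h => core A Q encM pk sk H h salt C u fun _ => φ := by
  have hix : ∀ j : Fin S.n, κ (.ix j) [] = idxCode S.n j := fun j =>
    hκ.ix j (by have := j.2; omega)
  simp only [attack, seqs_cons, seqs_nil, ev_seq, ev_skip]
  refine ev_lift A.choose R _ (fun H h m₁ st₁ => wp (encM (m₁ A.msg₀ []) (m₁ A.msg₁ [])) fun M =>
        A.guess.ev S.primSem (S.iOracle Q H h sk) (inject A m₁ salt M C u)
          { st₁ with left := S.N / 16 } φ) fun m₁' m₁ TH₁ Th₁ st₁ R₁ => ?_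
  rw [← E2_wp]
  refine hE m₁' m₁ TH₁ Th₁ st₁ _ _ R₁ fun M m₂' s R₂ => ?_
  have hκ' : ∀ z, z ≠ .body → (κ.set .body [] M) z [] = κ z [] := fun z hz =>
    Mem.set_of_ne _ hz _ _ _
  refine ev_challenge R₂ (fun j => (hκ' _ (by simp)).trans (hix j))
    ((hκ' _ (by simp)).trans hsalt) (Mem.set_self _ _ _ _)
    (fun j => (hκ' _ (by simp)).trans (hC j)) (fun j => (hκ' _ (by simp)).trans (hu j))
    fun m₃' R₃ => ?_
  refine ev_lift A.guess R₃ ψ (fun _ _ => φ) fun m₄' m₄ TH₄ Th₄ st₄ R₄ => ?_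
  rw [E2_const, hψ _ _ _ _ _ _ _ R₄]

/-! ### The reduction to CDH -/

variable (A Q) in
/-- Embed the CDH challenge in the `j`-th ElGamal ciphertext and in the public key that it uses,
simulate the attack on the message for the bit `β`, and output the `ρ`-th query to the hash function
`G → F`. -/
def cdhProg (β : Bool) (ρ : ℕ) (j : Fin S.n) : SimProg S A.V (Aux S) O := seqs [
  setup A Q,
  move (.inl A.pkIn) [.inr (keep (.loc j))] (.inr (keep .x)) [],
  move (.inr (keep (.hd j))) [] (.inr (keep .y)) [],
  loop (List.finRange S.n) fun i => .prim (.sample .fld) [] (.inr (keep (.pad i))),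
  .prim (.sample .fld) [] (.inr (keep .key)),
  attack A (.prim .aeEnc [.inr (keep .key), .inl (if β then A.msg₁ else A.msg₀)]
    (.inr (keep .body))),
  const (List.replicate (Q - ρ) true) (.inr tmp),
  move (.inr val) [] (.inr lg) [.inr tmp]]

theorem Mem.setVec_update {V : Type} (m : Mem V) (a : V) {k : ℕ} (v : Fin k → Str) (i : Fin k)
    (s : Str) : (m.setVec a v).set a [idxCode k i] s = m.setVec a (Function.update v i s) := by
  funext b j
  by_cases h : ∃ l, b = a ∧ j = [idxCode k l]
  · obtain ⟨l, rfl, rfl⟩ := h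
    rw [Mem.setVec_self]
    by_cases hl : l = i
    · subst hl; rw [Mem.set_self, Function.update_self]
    · have : ([idxCode k l] : List Str) ≠ [idxCode k i] := fun h =>
        hl ((idxCode k).injective (List.singleton_injective h))
      rw [Function.update_of_ne hl, ← Mem.setVec_self m b v l]
      simp [Mem.set, this]
  · have h' := not_exists.1 h
    rw [Mem.setVec_of_ne _ _ _ _ _ h', ← Mem.setVec_of_ne m a v b j h']
    simp [Mem.set, h' i]

variable (A Q) in
/-- The reduction to CDH produces the game with uniform pads and the given group elements in place
of a public key and of a head of the challenge. -/
theorem ev_cdhProg (β : Bool) (ρ : ℕ) (hρ : ρ < Q) (j : Fin S.n) (X Y Z : S.G)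
    (h0 : ∀ b i, (∀ z, b ≠ .inr (keep z)) → m' b i = [])
    (hx : m' (.inr (keep .x)) [] = S.encG X) (hy : m' (.inr (keep .y)) [] = S.encG Y)
    (hbody : m' (.inr (keep .body)) [] = []) :
    (cdhProg A Q β ρ j).ev S.primSem oracle m' s₀
      (fun m _ => if m (.inr val) [] = S.encG Z then 1 else 0) =
    wp (unif (Fin S.N → ZMod S.p)) fun sk => wp (unif S.Salt) fun salt =>
      wp (unif S.Pin) fun pin => wp (unif (Fin S.n → ZMod S.p)) fun r =>
      wp (unif (S.Salt × S.Pin → Fin S.n → Fin S.N)) fun H => wp (unif (S.G → S.F)) fun h =>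
      wp (unif (Fin S.n → S.F)) fun u => wp (unif S.F) fun k =>
        core A Q (encSel k β) (Function.update (fun i => S.pubKey (sk i)) (H (salt, pin) j) X)
          sk H h salt (Function.update (fun l => S.g ^ (r l).val) j Y) u
          fun _ _ st => if st.log[ρ]?.getD [] = S.encG Z then 1 else 0 := by
  classical
  simp only [cdhProg, seqs_cons, seqs_nil, ev_seq, ev_skip]
  refine ev_setup (F := fun sk salt pin r H h => wp (unif (Fin S.n → S.F)) fun u =>
        wp (unif S.F) fun k =>
        core A Q (encSel k β) (Function.update (fun i => S.pubKey (sk i)) (H (salt, pin) j) X)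
          sk H h salt (Function.update (fun l => S.g ^ (r l).val) j Y) u
          fun _ _ st => if st.log[ρ]?.getD [] = S.encG Z then 1 else 0) h0 hx hy hbody ?_
  intro sk salt pin r m₁ TH loc κ R hTH hκ hsalt hloc _ hhd
  simp only [ev_move, Mem.regs, List.map_cons, List.map_nil, R.keep, hloc, hκ.x,
    Mem.set_of_ne _ (show (Sum.inr (keep .y) : A.V ⊕ Own S.n (Aux S)) ≠ .inl A.pkIn by simp), hκ.y]
  have R₁ := (R.set_inl A.pkIn [idxCode S.N (loc j)] (S.encG X)).set_keep (.hd j) [] (S.encG Y)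
  have hκ₁ := hκ.set (z := .hd j) (by trivial) [] (S.encG Y)
  have hhd₁ : ∀ l, (κ.set (.hd j) [] (S.encG Y)) (.hd l) [] =
      S.encG (Function.update (fun l => S.g ^ (r l).val) j Y l) := by
    intro l
    by_cases hl : l = j
    · subst hl; rw [Mem.set_self, Function.update_self]
    · rw [Mem.set_of_ne _ (by simpa using hl), Function.update_of_ne hl, hhd]
  have hsalt₁ : (κ.set (.hd j) [] (S.encG Y)) .salt [] = saltCode S.saltLen salt :=
    (Mem.set_of_ne _ (by simp) _ _ _).trans hsalt
  rw [Mem.setVec_update] at R₁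
  have hpk : (Function.update (fun i => S.encG (S.pubKey (sk i))) (loc j) (S.encG X)) =
      fun i => S.encG (Function.update (fun i => S.pubKey (sk i)) (loc j) X i) := by
    funext i
    by_cases hi : i = loc j
    · subst hi; simp
    · simp [hi]
  rw [hpk] at R₁
  generalize κ.set (.hd j) [] (S.encG Y) = κ₁ at R₁ hκ₁ hhd₁ hsalt₁
  rw [← E2_wp]
  refine ev_loop_sample_inv (fun v l m => ∃ κ', Rep Q m ((Mem.empty A.V).setVec A.pkIn fun i =>
      S.encG (Function.update (fun i => S.pubKey (sk i)) (loc j) X i)) TH (fun _ => none) sk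
      ISt.init κ' ∧ Consts (S.encG X) (S.encG Y) κ' ∧ κ' .salt [] = saltCode S.saltLen salt ∧
      (∀ l, κ' (.hd l) [] =
        S.encG (Function.update (fun l => S.g ^ (r l).val) j Y l)) ∧
      ∀ j ∉ l, κ' (.pad j) [] = S.encF (v j)) ?_ (List.finRange S.n)
      (List.nodup_finRange _) (fun i => List.mem_finRange i) (v₀ := 0)
      ⟨_, R₁, hκ₁, hsalt₁, hhd₁, fun i hi => absurd (List.mem_finRange i) hi⟩ ?_
  · rintro v i l m ψ g ⟨κ', R', c1, c2, c3, c4⟩ hψ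
    simp only [ev_sample, sampleSem, wp_map]
    refine wp_congr fun x => hψ x _ ⟨_, R'.set_keep _ _ _, c1.set (z := .pad i) (by trivial) _ _,
      ?_, ?_, ?_⟩
    · rw [Mem.set_of_ne _ (by simp), c2]
    · intro j'; rw [Mem.set_of_ne _ (by simp), c3]
    · intro j' hj'
      by_cases hjj : j' = i
      · subst hjj; rw [Mem.set_self, Function.update_self]
      · rw [Mem.set_of_ne _ (by simpa using hjj), Function.update_of_ne hjj]
        exact c4 j' (by simp [hjj, hj'])
  rintro u m₂ ⟨κ₂, R₂, c1, c2, c3, c4⟩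
  rw [← E2_wp]
  simp only [ev_sample, sampleSem, wp_map]
  refine wp_congr fun k => ?_
  refine (ev_attack (encM := encSel k β) (u := u)
    (C := Function.update (fun l => S.g ^ (r l).val) j Y) (R₂.set_keep .key [] (S.encF k))
    (c1.set (by trivial) _ _) ((Mem.set_of_ne _ (by simp) _ _ _).trans c2)
    (fun l => (Mem.set_of_ne _ (by simp) _ _ _).trans (c3 l))
    (fun l => (Mem.set_of_ne _ (by simp) _ _ _).trans (c4 l (by simp)))
    (φ := fun _ st => if st.log[ρ]?.getD [] = S.encG Z then 1 else 0) ?_ ?_).trans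
    (E2_congr fun H h hH _ => by rw [hH _ _ hTH])
  · intro m₁' mA TH' Th' st' ψ' G R' hψ'
    have hk : m₁' (.inr (keep .key)) [] = S.encF k := by rw [R'.keep, Mem.set_self]
    simp only [ev_prim, primSem, Mem.regs, List.map_cons, List.map_nil, hk, decode_apply, R'.mem,
      encSel]
    have : mA (if β = true then A.msg₁ else A.msg₀) [] =
        if β = true then mA A.msg₁ [] else mA A.msg₀ [] := by split <;> rfl
    rw [this]
    exact wp_congr fun M => hψ' M _ _ (R'.set_keep _ _ _)
  · intro m'' mA TH' Th' st' s κ' R'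
    rw [ev_const _ _ R'.nil]
    simp only [Mem.set_self,
      Mem.set_of_ne _ (show (Sum.inr lg : A.V ⊕ Own S.n (Aux S)) ≠ .inr tmp by simp), R'.lg ρ hρ]

variable (A Q) in
/-- The CDH adversary that runs `cdhProg`. -/
def cdhAdversary (β : Bool) (ρ : ℕ) (j : Fin S.n) : CDHAdversary S where
  V := A.V ⊕ Own S.n (Aux S)
  xIn := .inr (keep .x)
  yIn := .inr (keep .y)
  out := .inr val
  prog := cdhProg A Q β ρ j

theorem cdhExperiment_eq (B : CDHAdversary S) : S.cdhExperiment B true =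
    wp (unif (ZMod S.p)) fun a => wp (unif (ZMod S.p)) fun b =>
      B.prog.ev (σ := Unit) S.primSem (fun q _ _ => q.elim)
        (((Mem.empty B.V).set B.xIn [] (S.encG (S.g ^ a.val))).set B.yIn []
          (S.encG (S.g ^ b.val))) () fun m _ =>
          if m B.out [] = S.encG (S.g ^ (a * b).val) then 1 else 0 := by
  rw [apply_true_eq_wp]
  simp only [cdhExperiment, monad_bind_eq, monad_pure_eq, wp_bind, wp_pure, decide_eq_true_eq]
  rfl

/-- The CDH adversary wins its experiment whenever the event of the game occurs. -/
theorem cdhGame_le (β : Bool) (ρ : ℕ) (hρ : ρ < Q) (j : Fin S.n) :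
    cdhGame A Q β ρ j ≤ S.cdhExperiment (cdhAdversary A Q β ρ j) true := by
  rw [cdhExperiment_eq]
  refine wp_mono fun a => wp_mono fun b => ?_
  refine le_of_le_of_eq ?_ (ev_cdhProg A Q β ρ hρ j (S.g ^ a.val) (S.g ^ b.val)
    (S.g ^ (a * b).val) ?_ ?_ ?_ ?_).symm
  · have hswap : ∀ f : (Fin S.N → ZMod S.p) → (S.Salt × S.Pin → Fin S.n → Fin S.N) →
        S.Salt → S.Pin → (Fin S.n → ZMod S.p) → S.F → (S.G → S.F) → (Fin S.n → S.F) → ℝ≥0∞,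
        (S.avg fun sk H salt pin r k => wp (unif _) fun h => wp (unif _) fun u =>
          f sk H salt pin r k h u) =
        wp (unif _) fun sk => wp (unif _) fun salt => wp (unif _) fun pin => wp (unif _) fun r =>
          wp (unif _) fun H => wp (unif _) fun h => wp (unif _) fun u => wp (unif _) fun k =>
            f sk H salt pin r k h u := by
      intro f
      unfold avg
      refine wp_congr fun sk => (wp_comm _ _ _).trans <| wp_congr fun salt =>
        (wp_comm _ _ _).trans <| wp_congr fun pin => (wp_comm _ _ _).trans <|
        wp_congr fun r => wp_congr fun H => (wp_comm _ _ _).trans <|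
        wp_congr fun h => wp_comm _ _ _
    rw [hswap]
    refine wp_mono fun sk => wp_mono fun salt => wp_mono fun pin => wp_mono fun r =>
      wp_mono fun H => wp_mono fun h => wp_mono fun u => wp_mono fun k =>
      core_mono _ _ _ _ _ _ _ _ _ _ fun e m st => ?_
    split
    · rename_i h; rw [h]; simp
    · exact bot_le
  · intro b i hb
    simp only [cdhAdversary]
    rw [Mem.set_of_ne _ (hb _), Mem.set_of_ne _ (hb _)]; rfl
  · simp only [cdhAdversary]
    rw [Mem.set_of_ne _ (by simp), Mem.set_self]
  · simp only [cdhAdversary]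
    rw [Mem.set_self]
  · simp only [cdhAdversary]
    rw [Mem.set_of_ne _ (by simp), Mem.set_of_ne _ (by simp)]; rfl

end
end LHEParams
end

noncomputable section

namespace LHEParams

section
variable {S : LHEParams} {O σ : Type} {A : LHEAdversary S} {Q : ℕ}

open Prog Own

/-! ### The reduction to authenticated encryption -/

/-- The encryption that the left-or-right oracle performs; a pair of messages of different lengths
gets no answer. -/
def encLR (k : S.F) (β : Bool) (m₀ m₁ : Str) : PMF Str :=
  if m₀.length = m₁.length then encSel k β m₀ m₁ else PMF.pure []

variable (A) in
/-- Compute the pads of the ElGamal ciphertexts. -/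
def padsProg : SimProg S A.V (Aux S) O :=
  loop (List.finRange S.n) fun j => seqs [
    move (.inr ax) [] (.inl A.pkIn) [.inr (keep (.loc j))],
    .prim .grpPow [.inr ax, .inr (keep (.r j))] (.inr ax),
    fetchPad,
    move (.inr (keep (.pad j))) [] (.inr val) []]

variable (A) in
/-- Evaluate the polynomial of the secret sharing at the `j`-th point, by Horner's rule. -/
def hornerProg (j : Fin S.n) : SimProg S A.V (Aux S) O := seqs [
  .prim (.point j) [] (.inr ax),
  .prim .fldNeg [.inr ax] (.inr ay),
  .prim .fldAdd [.inr ax, .inr ay] (.inr val),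
  loop (List.finRange (S.t - 1)).reverse fun i => seqs [
    .prim .fldAdd [.inr val, .inr (keep (.cf i))] (.inr val),
    .prim .fldMul [.inr val, .inr ax] (.inr val)]]

variable (A) in
/-- Add shares of zero to the pads. -/
def sharesProg : SimProg S A.V (Aux S) O := seqs [
  loop (List.finRange (S.t - 1)) fun i => .prim (.sample .fld) [] (.inr (keep (.cf i))),
  loop (List.finRange S.n) fun j => seqs [
    hornerProg A j,
    .prim .fldAdd [.inr (keep (.pad j)), .inr val] (.inr (keep (.pad j)))]]

variable (A Q) in
/-- Simulate the attack with shares of zero and with an encryption from the left-or-right oracle. -/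
def aeProg : SimProg S A.V (Aux S) AEQuery := seqs [
  setup A Q, padsProg A, sharesProg A,
  attack A (query .lr [.inl A.msg₀, .inl A.msg₁] [.inr (keep .body)])]

variable {m' : Mem (A.V ⊕ Own S.n (Aux S))} {m mA : Mem A.V}
    {TH : S.Salt × S.Pin → Option (Fin S.n → Fin S.N)} {Th : S.G → Option S.F}
    {sk : Fin S.N → ZMod S.p} {st : ISt S.N} {κ : Mem (Aux S)}
    {oracle : O → List Str → σ → PMF (List Str × σ)} {s₀ : σ}

theorem horner_eq {R : Type} [CommRing R] (k : ℕ) (a : Fin k → R) (x : R) :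
    (List.finRange k).reverse.foldl (fun s i => (s + a i) * x) 0 =
      ∑ i, a i * x ^ (i.val + 1) := by
  rw [List.foldl_reverse]
  induction k with
  | zero => simp
  | succ k ih =>
      rw [List.finRange_succ, List.foldr_cons, List.foldr_map, ih (fun i => a i.succ),
        Fin.sum_univ_succ, add_mul, Finset.sum_mul, add_comm]
      congr 1
      · simp
      · refine Finset.sum_congr rfl fun i _ => ?_
        simp [pow_succ, mul_assoc]

theorem ev_hornerProg (R : Rep Q m' mA TH Th sk st κ) {a : Fin (S.t - 1) → S.F}
    (ha : ∀ i, κ (.cf i) [] = S.encF (a i)) (j : Fin S.n)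
    {ψ : Mem (A.V ⊕ Own S.n (Aux S)) → σ → ℝ≥0∞} {x : ℝ≥0∞}
    (hψ : ∀ m'', Rep Q m'' mA TH Th sk st κ → m'' (.inr val) [] = S.encF (poly a j) →
      ψ m'' s₀ = x) :
    (hornerProg A j).ev S.primSem oracle m' s₀ ψ = x := by
  simp only [hornerProg, seqs_cons, seqs_nil, ev_seq, ev_skip, ev_point]
  rw [ev_fldNeg (Mem.set_self _ _ _ _), ev_fldAdd (x := S.point j) (y := -S.point j)
    ((Mem.set_of_ne _ (by simp) _ _ _).trans (Mem.set_self _ _ _ _)) (Mem.set_self _ _ _ _)]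
  refine ev_loop_inv (fun l m => ∃ s, Rep Q m mA TH Th sk st κ ∧ m (.inr ax) [] =
    S.encF (S.point j) ∧ m (.inr val) [] = S.encF s ∧
    l.foldl (fun s i => (s + a i) * S.point j) s = poly a j) ?_ _ ⟨0, ((R.set_scratch _
      (by trivial) _ _).set_scratch _ (by trivial) _ _).set_scratch _ (by trivial) _ _, ?_, ?_,
      horner_eq _ _ _⟩ ?_
  · rintro i l m ψ x ⟨s, R, h1, h2, h3⟩ hψ
    simp only [ev_seq, ev_skip]
    rw [ev_fldAdd h2 ((R.keep _ _).trans (ha i)), ev_fldMul (Mem.set_self _ _ _ _)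
      ((Mem.set_of_ne _ (by simp) _ _ _).trans h1)]
    refine hψ _ ⟨_, (R.set_scratch _ (by trivial) _ _).set_scratch _ (by trivial) _ _, ?_,
      Mem.set_self _ _ _ _, h3⟩
    rw [Mem.set_of_ne _ (by simp), Mem.set_of_ne _ (by simp), h1]
  · rw [Mem.set_of_ne _ (by simp), Mem.set_of_ne _ (by simp), Mem.set_self]
  · rw [Mem.set_self, add_neg_cancel]
  · rintro m'' ⟨s, R, _, h2, rfl⟩
    exact hψ m'' R h2

/-- What the kept registers contain after the setup. -/
structure SetupFacts (salt : S.Salt) (loc : Fin S.n → Fin S.N) (r : Fin S.n → ZMod S.p)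
    (κ : Mem (Aux S)) : Prop where
  consts : Consts [] [] κ
  salt : κ .salt [] = saltCode S.saltLen salt
  loc : ∀ j, κ (.loc j) [] = idxCode S.N (loc j)
  hd : ∀ j, κ (.hd j) [] = S.encG (S.g ^ (r j).val)
  nonce : ∀ j, κ (.r j) [] = sclCode S.p (r j)

variable {salt : S.Salt} {loc : Fin S.n → Fin S.N} {r : Fin S.n → ZMod S.p}

/-- The registers that are set after the setup. -/
def Aux.IsLate : Aux S → Prop
  | .pad _ | .cf _ => True
  | _ => False

theorem SetupFacts.set (h : SetupFacts salt loc r κ) {z : Aux S} (hz : z.IsLate) (i : List Str)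
    (s : Str) : SetupFacts salt loc r (κ.set z i s) where
  consts := h.consts.set (by cases z <;> trivial) i s
  salt := (Mem.set_of_ne _ (by rintro rfl; exact hz) _ _ _).trans h.salt
  loc j := (Mem.set_of_ne _ (by rintro rfl; exact hz) _ _ _).trans (h.loc j)
  nonce j := (Mem.set_of_ne _ (by rintro rfl; exact hz) _ _ _).trans (h.nonce j)
  hd j := (Mem.set_of_ne _ (by rintro rfl; exact hz) _ _ _).trans (h.hd j)

theorem ev_padsProg (R : Rep Q m' mA TH Th sk st κ) (hκ : SetupFacts salt loc r κ)
    (hpk : ∀ i, mA A.pkIn [idxCode S.N i] = S.encG (S.pubKey (sk i)))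
    {ψ : Mem (A.V ⊕ Own S.n (Aux S)) → σ → ℝ≥0∞}
    {F : (S.Salt × S.Pin → Fin S.n → Fin S.N) → (S.G → S.F) → ℝ≥0∞}
    (hψ : ∀ m'' Th' κ' (v : Fin S.n → S.F), Rep Q m'' mA TH Th' sk st κ' → SetupFacts salt loc r κ' →
      (∀ j, Th' (padArg sk loc r j) = some (v j)) → (∀ j, κ' (.pad j) [] = S.encF (v j)) →
      ψ m'' s₀ = E2 TH Th' F) :
    (padsProg A).ev S.primSem oracle m' s₀ ψ = E2 TH Th F := by
  have key : ∀ (l : List (Fin S.n)) (m' : Mem (A.V ⊕ Own S.n (Aux S))) (Th : S.G → Option S.F)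
      (κ : Mem (Aux S)), Rep Q m' mA TH Th sk st κ → SetupFacts salt loc r κ →
      (∀ j ∉ l, ∃ v, Th (padArg sk loc r j) = some v ∧ κ (.pad j) [] = S.encF v) →
      (loop l fun j => (seqs [
        move (.inr ax) [] (.inl A.pkIn) [.inr (keep (.loc j))],
        .prim .grpPow [.inr ax, .inr (keep (.r j))] (.inr ax),
        fetchPad,
        move (.inr (keep (.pad j))) [] (.inr val) []] : SimProg S A.V (Aux S) O)).ev S.primSem
          oracle m' s₀ ψ = E2 TH Th F := by
    intro l
    induction l with
    | nil =>
        intro m' Th κ R hκ hl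
        choose v hv using fun j => hl j (by simp)
        rw [loop_nil, ev_skip]
        exact hψ m' Th κ v R hκ (fun j => (hv j).1) fun j => (hv j).2
    | cons j l ih =>
        intro m' Th κ R hκ hl
        simp only [loop_cons, seqs_cons, seqs_nil, ev_seq, ev_skip, ev_move, Mem.regs,
          List.map_cons, List.map_nil, R.keep, hκ.loc, R.mem, hpk]
        rw [ev_grpPow (Mem.set_self _ _ _ _)
          ((Mem.set_of_ne _ (by simp) _ _ _).trans ((R.keep _ _).trans (hκ.nonce j)))]
        refine ev_fetchPad (z := padArg sk loc r j) ((R.set_scratch _ (by trivial) _ _).set_scratch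
          _ (by trivial) _ _) (Mem.set_self _ _ _ _) _ _ fun m'' Th' v R' hv hmono hval => ?_
        rw [hval]
        refine ih _ Th' _ (R'.set_keep _ _ _) (hκ.set (by trivial) _ _) fun j' hj' => ?_
        by_cases hjj : j' = j
        · subst hjj; exact ⟨v, hv, Mem.set_self _ _ _ _⟩
        · obtain ⟨v', hv', hpad⟩ := hl j' (by simp [hjj, hj'])
          exact ⟨v', hmono _ _ hv', (Mem.set_of_ne _ (by simpa using hjj) _ _ _).trans hpad⟩
  exact key _ _ _ κ R hκ fun j hj => absurd (List.mem_finRange j) hj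

theorem ev_sharesProg (R : Rep Q m' mA TH Th sk st κ) (hκ : SetupFacts salt loc r κ)
    {v : Fin S.n → S.F} (hv : ∀ j, κ (.pad j) [] = S.encF (v j))
    {ψ : Mem (A.V ⊕ Own S.n (Aux S)) → σ → ℝ≥0∞} {G : (Fin (S.t - 1) → S.F) → ℝ≥0∞}
    (hψ : ∀ a m'' κ', Rep Q m'' mA TH Th sk st κ' → SetupFacts salt loc r κ' →
      (∀ j, κ' (.pad j) [] = S.encF (v j + poly a j)) → ψ m'' s₀ = G a) :
    (sharesProg A).ev S.primSem oracle m' s₀ ψ = wp (unif (Fin (S.t - 1) → S.F)) G := by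
  simp only [sharesProg, seqs_cons, seqs_nil, ev_seq, ev_skip]
  refine ev_loop_sample_inv (fun a l m => ∃ κ', Rep Q m mA TH Th sk st κ' ∧
      SetupFacts salt loc r κ' ∧ (∀ j, κ' (.pad j) [] = S.encF (v j)) ∧
      ∀ i ∉ l, κ' (.cf i) [] = S.encF (a i)) ?_ (List.finRange (S.t - 1))
      (List.nodup_finRange _) (fun i => List.mem_finRange i) (v₀ := 0)
      ⟨κ, R, hκ, hv, fun i hi => absurd (List.mem_finRange i) hi⟩ ?_
  · rintro a i l m ψ g ⟨κ', R', c1, c2, c3⟩ hψ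
    simp only [ev_sample, sampleSem, wp_map]
    refine wp_congr fun x => hψ x _ ⟨_, R'.set_keep _ _ _, c1.set (z := .cf i) (by trivial) _ _,
      ?_, ?_⟩
    · intro j'; rw [Mem.set_of_ne _ (by simp), c2]
    · intro j' hj'
      by_cases hjj : j' = i
      · subst hjj; rw [Mem.set_self, Function.update_self]
      · rw [Mem.set_of_ne _ (by simpa using hjj), Function.update_of_ne hjj]
        exact c3 j' (by simp [hjj, hj'])
  rintro a m₁ ⟨κ₁, R₁, c1, c2, c3⟩
  refine ev_loop_inv (fun l m => l.Nodup ∧ ∃ κ', Rep Q m mA TH Th sk st κ' ∧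
      SetupFacts salt loc r κ' ∧ (∀ i, κ' (.cf i) [] = S.encF (a i)) ∧
      (∀ j ∈ l, κ' (.pad j) [] = S.encF (v j)) ∧
      ∀ j ∉ l, κ' (.pad j) [] = S.encF (v j + poly a j)) ?_ (List.finRange S.n)
      ⟨List.nodup_finRange _, κ₁, R₁, c1, fun i => c3 i (by simp), fun j _ => c2 j,
        fun i hi => absurd (List.mem_finRange i) hi⟩ ?_
  · rintro j l m ψ x ⟨hl, κ', R', c1, c2, c3, c4⟩ hψ
    rw [List.nodup_cons] at hl
    rw [ev_seq]
    refine ev_hornerProg R' c2 j fun m₂ R₂ hval => ?_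
    simp only [ev_seq, ev_skip]
    rw [ev_fldAdd ((R₂.keep _ _).trans (c3 j (by simp))) hval]
    refine hψ _ ⟨hl.2, _, R₂.set_keep _ _ _, c1.set (z := .pad j) (by trivial) _ _, ?_, ?_, ?_⟩
    · intro i; rw [Mem.set_of_ne _ (by simp), c2]
    · intro j' hj'
      have : j' ≠ j := by rintro rfl; exact hl.1 hj'
      rw [Mem.set_of_ne _ (by simpa using this), c3 j' (by simp [hj'])]
    · intro j' hj'
      by_cases hjj : j' = j
      · subst hjj; rw [Mem.set_self]
      · rw [Mem.set_of_ne _ (by simpa using hjj)]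
        exact c4 j' (by simp [hjj, hj'])
  · rintro m₂ ⟨_, κ₂, R₂, c1, _, _, c4⟩
    exact hψ a m₂ κ₂ R₂ c1 fun j => c4 j (by simp)

/-- The indicator of the event that the output bit is `1`. -/
def outBit (A : LHEAdversary S) (_ : Bool) (m : Mem A.V) (_ : ISt S.N) : ℝ≥0∞ :=
  if (m A.out []).head? = some true then 1 else 0

variable (A Q) in
/-- The adversary against authenticated encryption that runs `aeProg`; its output bit is that of the
simulated adversary. -/
def aeAdversary : AEAdversary S where
  V := A.V ⊕ Own S.n (Aux S)
  out := .inl A.out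
  prog := aeProg A Q

variable (A Q) in
/-- The reduction to authenticated encryption produces the game with shares of zero. -/
theorem ev_aeProg (k : S.F) (β : Bool) :
    (aeProg A Q).ev S.primSem (S.aeOracle k β) (Mem.empty _) []
      (fun m _ => if (m (.inl A.out) []).head? = some true then 1 else 0) =
    wp (unif (Fin S.N → ZMod S.p)) fun sk => wp (unif S.Salt) fun salt =>
      wp (unif S.Pin) fun pin => wp (unif (Fin S.n → ZMod S.p)) fun r =>
      wp (unif (S.Salt × S.Pin → Fin S.n → Fin S.N)) fun H => wp (unif (S.G → S.F)) fun h =>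
      wp (unif (Fin (S.t - 1) → S.F)) fun a =>
        core A Q (encLR k β) (fun i => S.pubKey (sk i)) sk H h salt (fun j => S.g ^ (r j).val)
          (fun j => h (padArg sk (H (salt, pin)) r j) + poly a j) (outBit A) := by
  simp only [aeProg, seqs_cons, seqs_nil, ev_seq, ev_skip]
  refine ev_setup (F := fun sk salt pin r H h => wp (unif (Fin (S.t - 1) → S.F)) fun a =>
        core A Q (encLR k β) (fun i => S.pubKey (sk i)) sk H h salt (fun j => S.g ^ (r j).val)
          (fun j => h (padArg sk (H (salt, pin)) r j) + poly a j) (outBit A))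
    (fun _ _ _ => rfl) (X := []) (Y := []) rfl rfl rfl ?_
  intro sk salt pin r m₁ TH loc κ R hTH hκ hsalt hloc hr hhd
  refine ev_padsProg R ⟨hκ, hsalt, hloc, hhd, hr⟩ (fun i => Mem.setVec_self _ _ _ _) ?_
  intro m₂ Th κ₂ v R₂ hκ₂ hTh hpad
  rw [← E2_wp]
  refine ev_sharesProg R₂ hκ₂ hpad fun a m₃ κ₃ R₃ hκ₃ hpad₃ => ?_
  refine (ev_attack (encM := encLR k β) R₃ hκ₃.consts hκ₃.salt hκ₃.hd hpad₃
    (φ := fun m st => outBit A true m st) ?_ ?_).trans (E2_congr fun H h hH hh => ?_)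
  · intro m₁' mA TH' Th' st' ψ' G R' hψ'
    simp only [ev_query, Mem.regs, List.map_cons, List.map_nil, R'.mem, aeOracle, encLR, encSel]
    split
    · rw [wp_map]
      exact wp_congr fun M => hψ' M _ _ (R'.set_keep _ _ _)
    · rw [wp_pure, wp_pure]
      refine hψ' [] _ _ ?_
      rw [← hκ₃.consts.body, Mem.set_get]
      exact R'
  · intro m'' mA TH' Th' st' s κ' R'
    rw [R'.mem]
    rfl
  · simp only [hH _ _ hTH, hh _ _ (hTh _)]
    rfl

theorem aeExperiment_eq (D : AEAdversary S) (β : Bool) : S.aeExperiment D β true =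
    wp (unif S.F) fun k => D.prog.ev S.primSem (S.aeOracle k β) (Mem.empty D.V) [] fun m _ =>
      if (m D.out []).head? = some true then 1 else 0 := by
  rw [apply_true_eq_wp]
  simp only [aeExperiment, monad_bind_eq, monad_pure_eq, wp_bind, wp_pure, decide_eq_true_eq]
  rfl

/-- Runs in which the two messages have different lengths contribute equally to both experiments. -/
theorem aeExperiment_aeAdversary : ∃ W, ∀ β, S.aeExperiment (aeAdversary A Q) β true =
    (S.avg fun sk H salt pin r k => shiftGame A Q β sk H salt pin r k (fun _ => 0) (outOne A)) +
      W := by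
  classical
  let off : Bool → Mem A.V → ISt S.N → ℝ≥0∞ := fun e m _ =>
    if e = false ∧ (m A.out []).head? = some true then 1 else 0
  refine ⟨S.avg fun sk H salt pin r _ => wp (unif (S.G → S.F)) fun h =>
    wp (unif (Fin (S.t - 1) → S.F)) fun a => core A Q (fun _ _ => PMF.pure [])
      (fun i => S.pubKey (sk i)) sk H h salt (fun j => S.g ^ (r j).val)
      (fun j => h (padArg sk (H (salt, pin)) r j) + poly a j) off, fun β => ?_⟩
  rw [aeExperiment_eq]
  have hsplit : outBit A = fun e m st => outOne A e m st + off e m st := by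
    funext e m st
    cases e <;> simp [outBit, outOne, off]
  trans S.avg fun sk H salt pin r k => wp (unif (S.G → S.F)) fun h =>
    wp (unif (Fin (S.t - 1) → S.F)) fun a => core A Q (encLR k β)
      (fun i => S.pubKey (sk i)) sk H h salt (fun j => S.g ^ (r j).val)
      (fun j => h (padArg sk (H (salt, pin)) r j) + poly a j) (outBit A)
  · refine (wp_congr fun k => ev_aeProg A Q k β).trans ?_
    unfold avg
    refine (wp_comm _ _ _).trans <| wp_congr fun sk => Eq.symm <| (wp_comm _ _ _).trans <|
      Eq.symm <| (wp_comm _ _ _).trans <| wp_congr fun salt => ?_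
    refine Eq.trans ?_ (wp_comm _ _ _)
    refine (wp_comm _ _ _).trans <| wp_congr fun pin => ?_
    refine Eq.trans ?_ (wp_comm _ _ _)
    refine (wp_comm _ _ _).trans <| wp_congr fun r => ?_
    refine (wp_comm _ _ _).trans <| wp_congr fun H => rfl
  · unfold avg
    simp only [← wp_add, shiftGame]
    refine wp_congr fun sk => wp_congr fun H => wp_congr fun salt => wp_congr fun pin =>
      wp_congr fun r => wp_congr fun k => wp_congr fun h => wp_congr fun a => ?_
    rw [hsplit, core_add, core_congr_enc A Q (encLR k β) _ _ H h _ _ _ true (encSel k β),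
      core_congr_enc A Q (encLR k β) _ _ H h _ _ _ false (fun _ _ => PMF.pure [])]
    · simp only [zero_add]
    · intro m₀ m₁ h
      exact if_neg (by simpa using h)
    · intro e m st he
      exact if_neg fun h => he h.1
    · intro m₀ m₁ h
      exact if_pos (by simpa using h)
    · intro e m st he
      exact if_neg fun h => he h.1

end
end LHEParams
end

noncomputable section

namespace LHEParams

section
variable {S : LHEParams} {O : Type} (A : LHEAdversary S) (Q : ℕ)

open Prog Own

/-! ### Cost of the reductions -/

theorem length_bits_le (i : ℕ) : (Nat.bits i).length ≤ i := by
  rw [Nat.size_eq_bits_len]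
  exact Nat.size_le.2 Nat.lt_two_pow_self

theorem cost_setup_le : (setup A Q : SimProg S A.V (Aux S) O).cost ≤
    (S.N + S.n) * (S.N + S.n + 1) + Q + 12 * S.N + 14 * S.n + 30 := by
  have h1 := cost_loop_le (P := Prim S.n) (O := O) (List.range (S.N + S.n)) (fun i =>
    const (V := A.V) (K := Aux S) (Nat.bits i) (.inr (keep (.ix i)))) (S.N + S.n + 1) (fun i hi => by
      have := length_bits_le i
      have := List.mem_range.1 hi
      rw [cost_const]; omega)
  have h2 := cost_loop_le (P := Prim S.n) (O := O) (List.finRange S.N) (fun i =>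
    seq (.prim (.sample .scl) [] (.inr tmp))
    (move (Sum.inr skA : A.V ⊕ Own S.n (Aux S)) [.inr (keep (.ix i))] (.inr tmp) [])) 3
    (fun i _ => by simp [cost])
  have h3 := cost_loop_le (P := Prim S.n) (O := O) (List.finRange S.N) (fun i => seqs [
    .prim .gen [] (.inr val),
    move (.inr ax) [] (.inr skA) [.inr (keep (.ix i))],
    .prim .grpPow [.inr val, .inr ax] (.inr ax),
    move (Sum.inl A.pkIn : A.V ⊕ Own S.n (Aux S)) [.inr (keep (.ix i))] (.inr ax) []]) 9
    (fun i _ => by simp [cost])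
  have h4 := cost_loop_le (P := Prim S.n) (O := O) (List.finRange S.n) (fun j => seqs [
    .prim (.sample .scl) [] (.inr (keep (.r j))),
    .prim .gen [] (.inr val),
    .prim .grpPow [.inr val, .inr (keep (.r j))]
      (Sum.inr (keep (.hd j)) : A.V ⊕ Own S.n (Aux S))]) 6
    (fun i _ => by simp [cost])
  have h5 := cost_loop_le (P := Prim S.n) (O := O) (List.finRange S.n) (fun j =>
    move (Sum.inr (keep (.loc j)) : A.V ⊕ Own S.n (Aux S)) [] (.inr (o j)) []) 1
    (fun i _ => by simp [cost])
  have h6 := cost_fetchLoc_le (S := S) (V := A.V) (K := Aux S) (O := O)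
  simp only [List.length_finRange, List.length_range] at h1 h2 h3 h4 h5
  simp only [setup, seqs_cons, seqs_nil, cost, List.length_nil, cost_const,
    List.length_replicate] at h3 h4 ⊢
  omega

theorem cost_attack_le (E : SimProg S A.V (Aux S) O) : (attack A E).cost ≤
    (7 * S.n + 35) * A.cost + E.cost + 4 * S.n + S.N + 10 := by
  have h1 := cost_lift_le (K := Aux S) (O := O) A.choose
  have h2 := cost_lift_le (K := Aux S) (O := O) A.guess
  have h3 : ∀ (a : A.V) (f : Fin S.n → Aux S), _ := fun a f =>
    cost_loop_le (P := Prim S.n) (O := O) (List.finRange S.n) (fun j =>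
    move (Sum.inl a : A.V ⊕ Own S.n (Aux S)) [.inr (keep (.ix j))] (.inr (keep (f j))) []) 2
    (fun i _ => by simp [cost])
  have h4 := h3 A.headIn .hd
  have h5 := h3 A.padIn .pad
  have h6 := Nat.div_le_self S.N 16
  simp only [List.length_finRange] at h4 h5
  simp only [attack, challenge, seqs_cons, seqs_nil, cost, List.length_nil, cost_const,
    List.length_replicate, LHEAdversary.cost, mul_add]
  omega

theorem one_le_progCost {V P O : Type} (c : Prog V P O) : 1 ≤ c.cost := by
  induction c <;> simp only [Prog.cost] <;> omega

/-- The terms in the bounds for the costs of the reductions are dominated by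
`(N + n + saltLen)² * cost`. -/
theorem cost_terms_le (hC : 1 ≤ A.cost) :
    let K := (S.N + S.n + S.saltLen) ^ 2 * A.cost
    1 ≤ K ∧ (S.N + S.n) * (S.N + S.n + 1) ≤ 2 * K ∧ S.N ≤ K ∧ S.n ≤ K ∧ A.cost ≤ K ∧
      S.n * A.cost ≤ K ∧ S.n * S.n ≤ K := by
  have hn := S.n_pos
  have hN : 1 ≤ S.N := Nat.one_le_iff_ne_zero.2 S.N_ne.out
  have hL : S.N + S.n ≤ S.N + S.n + S.saltLen := by omega
  generalize S.N + S.n + S.saltLen = L at hL ⊢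
  have h1 : S.n ≤ L := by omega
  have h2 : S.N ≤ L := by omega
  have hLL : L ≤ L ^ 2 := Nat.le_self_pow (by norm_num) L
  have hK : ∀ x, x ≤ L ^ 2 → x ≤ L ^ 2 * A.cost := fun x hx =>
    hx.trans (Nat.le_mul_of_pos_right _ hC)
  refine ⟨hK _ (by nlinarith), ?_, hK _ (h2.trans hLL), hK _ (h1.trans hLL),
    Nat.le_mul_of_pos_left _ (by nlinarith), Nat.mul_le_mul_right _ (h1.trans hLL),
    hK _ (by rw [sq]; exact Nat.mul_le_mul h1 h1)⟩
  have : (S.N + S.n) * (S.N + S.n + 1) ≤ 2 * L ^ 2 := by nlinarith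
  calc _ ≤ 2 * L ^ 2 := this
    _ ≤ 2 * (L ^ 2 * A.cost) := Nat.mul_le_mul_left _ (Nat.le_mul_of_pos_right _ hC)

theorem one_le_lheCost : 1 ≤ A.cost := le_trans (one_le_progCost A.choose) (Nat.le_add_right _ _)

theorem cost_cdhAdversary_le (hQ : Q ≤ A.cost) (β : Bool) (ρ : ℕ) (j : Fin S.n) :
    (cdhAdversary A Q β ρ j).cost ≤ 200 * (S.N + S.n + S.saltLen) ^ 2 * A.cost := by
  have h1 := cost_setup_le (O := Empty) A Q
  have h2 := cost_attack_le (O := Empty) A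
    (.prim .aeEnc [.inr (keep .key), .inl (if β then A.msg₁ else A.msg₀)] (.inr (keep .body)))
  have h3 := cost_loop_le (P := Prim S.n) (O := Empty) (List.finRange S.n) (fun i =>
    .prim (.sample .fld) [] (Sum.inr (keep (.pad i)) : A.V ⊕ Own S.n (Aux S))) 1
    (fun i _ => by simp [cost])
  obtain ⟨k1, k2, k3, k4, k5, k6, k7⟩ := cost_terms_le A (one_le_lheCost A)
  rw [mul_assoc]
  generalize (S.N + S.n + S.saltLen) ^ 2 * A.cost = K at *
  rw [add_mul, mul_assoc] at h2
  simp only [CDHAdversary.cost, cdhAdversary, cdhProg, seqs_cons, seqs_nil, cost, List.length_cons,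
    List.length_nil, cost_const, List.length_replicate, List.length_finRange] at h2 h3 ⊢
  generalize (S.N + S.n) * (S.N + S.n + 1) = a at *
  generalize S.n * A.cost = b at *
  omega

theorem cost_aeAdversary_le (hQ : Q ≤ A.cost) (ht : S.t ≤ S.n) :
    (aeAdversary A Q).cost ≤ 200 * (S.N + S.n + S.saltLen) ^ 2 * A.cost := by
  have h1 := cost_setup_le (O := AEQuery) A Q
  have h2 := cost_attack_le (O := AEQuery) A
    (query .lr [.inl A.msg₀, .inl A.msg₁] [.inr (keep .body)])
  have h3 := cost_loop_le (P := Prim S.n) (O := AEQuery) (List.finRange (S.t - 1)) (fun i =>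
    .prim (.sample .fld) [] (Sum.inr (keep (.cf i)) : A.V ⊕ Own S.n (Aux S))) 1
    (fun i _ => by simp [cost])
  have h4 := cost_loop_le (P := Prim S.n) (O := AEQuery) (List.finRange S.n) (fun j => seqs [
    move (.inr ax) [] (.inl A.pkIn) [.inr (keep (.loc j))],
    .prim .grpPow [.inr ax, .inr (keep (.r j))] (.inr ax),
    fetchPad,
    move (Sum.inr (keep (.pad j)) : A.V ⊕ Own S.n (Aux S)) [] (.inr val) []]) 18
    (fun i _ => by simp [cost, cost_fetchPad])
  have h5 : ∀ j, (hornerProg A j : SimProg S A.V (Aux S) AEQuery).cost ≤ 7 * S.n + 8 := by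
    intro j
    have := cost_loop_le (P := Prim S.n) (O := AEQuery) (List.finRange (S.t - 1)).reverse
      (fun i => seqs [
      .prim .fldAdd [.inr val, .inr (keep (.cf i))] (Sum.inr val : A.V ⊕ Own S.n (Aux S)),
      .prim .fldMul [.inr val, .inr ax] (.inr val)]) 7 (fun i _ => by simp [cost])
    simp only [hornerProg, seqs_cons, seqs_nil, cost, List.length_cons, List.length_nil,
      List.length_finRange, List.length_reverse] at this ⊢
    omega
  have h6 := cost_loop_le (P := Prim S.n) (O := AEQuery) (List.finRange S.n) (fun j => seqs [
    hornerProg A j,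
    .prim .fldAdd [.inr (keep (.pad j)), .inr val]
      (Sum.inr (keep (.pad j)) : A.V ⊕ Own S.n (Aux S))]) (7 * S.n + 12)
    (fun j _ => by
      have := h5 j
      simp only [seqs_cons, seqs_nil, cost, List.length_cons, List.length_nil]; omega)
  obtain ⟨k1, k2, k3, k4, k5, k6, k7⟩ := cost_terms_le A (one_le_lheCost A)
  rw [mul_assoc]
  generalize (S.N + S.n + S.saltLen) ^ 2 * A.cost = K at *
  rw [add_mul, mul_assoc] at h2
  rw [mul_add, mul_left_comm] at h6
  simp only [AEAdversary.cost, aeAdversary, aeProg, padsProg, sharesProg, seqs_cons, seqs_nil, cost,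
    List.length_cons, List.length_nil, List.length_finRange] at h2 h3 h4 h6 ⊢
  generalize (S.N + S.n) * (S.N + S.n + 1) = a at *
  generalize S.n * A.cost = b at *
  generalize S.n * S.n = d at *
  omega

/-! ### Queries of the reduction to authenticated encryption -/

theorem calls_setup [DecidableEq O] (q : O) :
    (setup A Q : SimProg S A.V (Aux S) O).calls q = 0 := by
  simp only [setup, seqs_cons, seqs_nil, calls, calls_const, calls_fetchLoc]
  rw [calls_loop, calls_loop, calls_loop, calls_loop, calls_loop]
  all_goals
    intro i
    simp [calls, calls_const]

theorem calls_attack [DecidableEq O] (q : O) (E : SimProg S A.V (Aux S) O) :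
    (attack A E).calls q = E.calls q := by
  simp only [attack, challenge, seqs_cons, seqs_nil, calls, calls_const, calls_lift]
  rw [calls_loop, calls_loop] <;> simp [calls]

theorem calls_aeAdversary (q : AEQuery) :
    (aeAdversary A Q).prog.calls q = if .lr = q then 1 else 0 := by
  simp only [aeAdversary, aeProg, padsProg, sharesProg, hornerProg, seqs_cons, seqs_nil, calls,
    calls_setup, calls_attack]
  rw [calls_loop, calls_loop, calls_loop]
  · simp
  · intro j
    simp only [calls]
    rw [calls_loop]
    simp [calls]
  · simp [calls]
  · simp [calls, calls_fetchPad]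

end

/-! ### Exhaustive search -/

/-- The registers of the search for discrete logarithms. -/
inductive SearchReg
  /-- the inputs and the output -/
  | x | y | out
  /-- the generator, and the powers of the generator and of the second input -/
  | gen | pow | res

section
variable {S : LHEParams}

open Prog

variable (S) in
/-- Search for the discrete logarithm `i` of the first input among `0, …, L - 1`, and output the
`i`-th power of the second input. -/
def searchProg (L : ℕ) : Prog SearchReg (Prim S.n) Empty := seqs [
  .prim .gen [] .gen,
  .prim .grpInv [.gen] .pow,
  .prim .grpMul [.gen, .pow] .pow,
  move .res [] .pow [],
  loop (List.range L) fun _ => seqs [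
    ifEq .x .pow (move .out [] .res []) skip,
    .prim .grpMul [.pow, .gen] .pow,
    .prim .grpMul [.res, .y] .res]]

variable (S) in
/-- The CDH adversary that searches for the discrete logarithm. -/
def searchAdversary (L : ℕ) : CDHAdversary S where
  V := SearchReg
  xIn := .x
  yIn := .y
  out := .out
  prog := searchProg S L

theorem cost_searchAdversary_le (L : ℕ) : (searchAdversary S L).cost ≤ 10 * L + 9 := by
  have := cost_loop_le (P := Prim S.n) (O := Empty) (List.range L) (fun _ => seqs [
    ifEq SearchReg.x .pow (move .out [] .res []) skip,
    .prim .grpMul [.pow, .gen] .pow,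
    .prim .grpMul [.res, .y] .res]) 10 (fun i _ => by simp [cost])
  simp only [CDHAdversary.cost, searchAdversary, searchProg, seqs_cons, seqs_nil, cost,
    List.length_cons, List.length_nil, List.length_range] at this ⊢
  omega

/-- The search succeeds if the discrete logarithm is less than `L`. -/
theorem ev_searchProg {σ : Type} {oracle : Empty → List Str → σ → PMF (List Str × σ)} {s₀ : σ}
    {L : ℕ} {a b : ZMod S.p} (ha : a.val < L) {m : Mem SearchReg}
    (hx : m .x [] = S.encG (S.g ^ a.val)) (hy : m .y [] = S.encG (S.g ^ b.val)) :
    (searchProg S L).ev S.primSem oracle m s₀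
      (fun m _ => if m .out [] = S.encG (S.g ^ (a * b).val) then 1 else 0) = 1 := by
  classical
  simp only [searchProg, seqs_cons, seqs_nil, ev_seq, ev_skip, ev_gen]
  rw [ev_grpInv (Mem.set_self _ _ _ _), ev_grpMul (X := S.g) (Y := S.g⁻¹)
    ((Mem.set_of_ne _ (by simp) _ _ _).trans (Mem.set_self _ _ _ _)) (Mem.set_self _ _ _ _)]
  simp only [ev_move, Mem.regs, List.map_nil, Mem.set_self, mul_inv_cancel]
  refine ev_loop_inv (fun l m => ∃ i, i + l.length = L ∧ m .x [] = S.encG (S.g ^ a.val) ∧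
    m .y [] = S.encG (S.g ^ b.val) ∧ m .gen [] = S.encG S.g ∧ m .pow [] = S.encG (S.g ^ i) ∧
    m .res [] = S.encG ((S.g ^ b.val) ^ i) ∧
    (a.val < i → m .out [] = S.encG (S.g ^ (a * b).val))) ?_ _
    ⟨0, by simp, ?_, ?_, ?_, ?_, ?_, fun h => absurd h (by simp)⟩ ?_
  · rintro _ l m ψ x ⟨i, h1, h2, h3, h4, h5, h6, h7⟩ hψ
    have hout : S.g ^ a.val = S.g ^ i → (S.g ^ b.val) ^ i = S.g ^ (a * b).val := by
      intro h
      rw [← pow_mul, mul_comm, pow_mul, ← h, ← pow_mul, g_pow_eq_iff]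
      simp
    have step : ∀ m' : Mem SearchReg, (∀ r, r ≠ .out → m' r [] = m r []) →
        (a.val < i + 1 → m' .out [] = S.encG (S.g ^ (a * b).val)) →
        (Prog.prim (O := Empty) (.grpMul : Prim S.n) [.pow, .gen] SearchReg.pow).ev S.primSem
          oracle m' s₀ (fun m' s => (Prog.prim (O := Empty) (.grpMul : Prim S.n) [.res, .y]
            SearchReg.res).ev S.primSem oracle m' s ψ) = x := by
      intro m' hm' hout'
      rw [ev_grpMul ((hm' _ (by simp)).trans h5) ((hm' _ (by simp)).trans h4), ev_grpMul
        ((Mem.set_of_ne _ (by simp) _ _ _).trans ((hm' _ (by simp)).trans h6))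
        ((Mem.set_of_ne _ (by simp) _ _ _).trans ((hm' _ (by simp)).trans h3))]
      have hne : ∀ r s s', r ≠ .pow → r ≠ .res →
          ((m'.set .pow [] s).set .res [] s') r [] = m' r [] := fun r s s' h h' => by
        rw [Mem.set_of_ne _ h', Mem.set_of_ne _ h]
      refine hψ _ ⟨i + 1, by simp only [List.length_cons] at h1; omega, ?_, ?_, ?_, ?_, ?_, ?_⟩
      · rw [hne _ _ _ (by simp) (by simp), hm' _ (by simp), h2]
      · rw [hne _ _ _ (by simp) (by simp), hm' _ (by simp), h3]
      · rw [hne _ _ _ (by simp) (by simp), hm' _ (by simp), h4]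
      · rw [Mem.set_of_ne _ (by simp), Mem.set_self, pow_succ]
      · rw [Mem.set_self, pow_succ (S.g ^ b.val)]
      · rw [hne _ _ _ (by simp) (by simp)]; exact hout'
    simp only [ev_seq, ev_skip, ev_ifEq, ev_move, Mem.regs, List.map_nil]
    split
    · rename_i h
      have heq : S.g ^ a.val = S.g ^ i := S.encG.injective (by rw [← h2, h, h5])
      refine step _ (fun r hr => Mem.set_of_ne _ hr _ _ _) fun _ => ?_
      rw [Mem.set_self, h6, hout heq]
    · rename_i h
      refine step m (fun _ _ => rfl) fun hi => h7 ?_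
      refine lt_of_le_of_ne (by omega) fun h' => h ?_
      rw [h2, h5, h']
  · rw [Mem.set_of_ne _ (by simp), Mem.set_of_ne _ (by simp), Mem.set_of_ne _ (by simp),
      Mem.set_of_ne _ (by simp), hx]
  · rw [Mem.set_of_ne _ (by simp), Mem.set_of_ne _ (by simp), Mem.set_of_ne _ (by simp),
      Mem.set_of_ne _ (by simp), hy]
  · rw [Mem.set_of_ne _ (by simp), Mem.set_of_ne _ (by simp), Mem.set_of_ne _ (by simp),
      Mem.set_self]
  · rw [Mem.set_of_ne _ (by simp), Mem.set_self, pow_zero]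
  · rw [Mem.set_self, pow_zero]
  · rintro m' ⟨i, h1, _, _, _, _, _, h7⟩
    exact if_pos (h7 (by simp at h1; omega))

theorem searchAdversary_adv (L : ℕ) :
    ((min L S.p : ℕ) : ℝ≥0∞) / S.p ≤ S.cdhExperiment (searchAdversary S L) true := by
  classical
  rw [cdhExperiment_eq]
  have : Fintype (ZMod S.p) := ZMod.fintype S.p
  calc ((min L S.p : ℕ) : ℝ≥0∞) / S.p
      ≤ wp (unif (ZMod S.p)) fun a => if a.val < L then 1 else 0 := by
        rw [wp_unif, ZMod.card, Finset.sum_boole]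
        gcongr
        rw [← Finset.card_range (min L S.p)]
        refine Finset.card_le_card_of_injOn (fun i => (i : ZMod S.p)) ?_ ?_
        · intro i hi
          have hi' : i < min L S.p := by simpa using hi
          simp only [Finset.coe_filter, Finset.mem_univ, true_and, Set.mem_ofPred_eq]
          rw [ZMod.val_cast_of_lt (by omega)]; omega
        · intro i hi i' hi' h
          have hi : i < min L S.p := by simpa using hi
          have hi' : i' < min L S.p := by simpa using hi'
          have := congrArg ZMod.val h
          simpa only [ZMod.val_cast_of_lt (show i < S.p by omega),
            ZMod.val_cast_of_lt (show i' < S.p by omega)] using this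
    _ ≤ _ := by
        refine wp_mono fun a => ?_
        split
        · rename_i ha
          refine le_of_eq_of_le (wp_const (unif (ZMod S.p)) 1).symm
            (wp_mono fun b => le_of_eq (ev_searchProg ha ?_ ?_).symm)
          · simp only [searchAdversary]
            rw [Mem.set_of_ne _ (by simp), Mem.set_self]
          · simp only [searchAdversary]
            rw [Mem.set_self]
        · exact bot_le

end
end LHEParams
end

noncomputable section

namespace LHEParams

variable {S : LHEParams}

/-! ### The concrete bound -/

theorem run_hash'Count_le {V : Type} (H : S.Salt × S.Pin → Fin S.n → Fin S.N) (h : S.G → S.F)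
    (sk : Fin S.N → ZMod S.p) (c : Prog V (Prim S.n) LHEQuery) (m : Mem V) (st : LHEState) :
    ∀ r ∈ (c.run S.primSem (S.lheOracle H h sk) m st).support,
      r.2.hash'Count ≤ st.hash'Count + c.cost := by
  induction c generalizing m st with
  | seq c d hc hd =>
    intro r hr
    obtain ⟨r', h1, h2⟩ := (PMF.mem_support_bind_iff _ _ _).1 hr
    have h1 := hc m st r' h1
    have h2 := hd _ _ r h2
    simp only [Prog.cost]
    omega
  | ifHead x c d hc hd =>
    intro r hr
    simp only [Prog.run] at hr
    simp only [Prog.cost]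
    split at hr
    · have := hc _ _ r hr; omega
    · have := hd _ _ r hr; omega
  | ifEq x y c d hc hd =>
    intro r hr
    simp only [Prog.run] at hr
    simp only [Prog.cost]
    split at hr
    · have := hc _ _ r hr; omega
    · have := hd _ _ r hr; omega
  | prim f as dst =>
    intro r hr
    obtain ⟨s, _, rfl⟩ := (PMF.mem_support_map_iff _ _ _).1 hr
    exact Nat.le_add_right _ _
  | query q as dsts =>
    intro r hr
    obtain ⟨s, hs, rfl⟩ := (PMF.mem_support_map_iff _ _ _).1 hr
    have := (lheOracle_count_le H h sk q _ _ _ hs).2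
    simp only [Prog.cost]
    omega
  | _ =>
    intro r hr
    obtain rfl := (PMF.mem_support_pure_iff _ _).1 hr
    exact Nat.le_add_right _ _

/-- The cost of an adversary bounds its number of queries. -/
theorem queryBound_cost (A : LHEAdversary S) : S.QueryBound A A.cost := by
  intro β r hr
  simp only [lheExperiment, monad_bind_eq, monad_pure_eq, PMF.mem_support_bind_iff,
    Bool.false_eq_true, if_false, if_true] at hr
  obtain ⟨sk, _, H, _, h, _, salt, _, pin, _, r₁, h₁, hr⟩ := hr
  have h₁ := run_hash'Count_le H h sk _ _ _ r₁ h₁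
  simp only [zero_add] at h₁
  unfold LHEAdversary.cost
  split at hr
  · obtain rfl := (PMF.mem_support_pure_iff _ _).1 hr
    exact h₁.trans (Nat.le_add_right _ _)
  · simp only [PMF.mem_support_bind_iff, PMF.mem_support_pure_iff] at hr
    obtain ⟨ct, _, r₂, h₂, rfl⟩ := hr
    have h₂ := run_hash'Count_le H h sk _ _ _ r₂ h₂
    simp only at h₂ ⊢
    omega

theorem lheAdv_le_one (A : LHEAdversary S) : S.lheAdv A ≤ 1 := by
  have h : ∀ β, 0 ≤ S.lheProb A β ∧ S.lheProb A β ≤ 1 := fun β =>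
    ⟨ENNReal.toReal_nonneg, ENNReal.toReal_mono ENNReal.one_ne_top (PMF.coe_le_one _ _)⟩
  have h0 := h false
  have h1 := h true
  exact abs_le.2 ⟨by linarith, by linarith⟩

/-- The advantage of the reduction to authenticated encryption misses that of the adversary by the
probabilities of the bad events. -/
theorem lheAdv_le_aeAdv_add (A : LHEAdversary S) {Q : ℕ} (hQ : S.QueryBound A Q) {E : ℝ}
    (hE : 0 ≤ E) (hb : ∀ β, S.avg (fun sk H salt pin r k => badBound A Q β sk H salt pin r k) ≤
      ENNReal.ofReal E) :
    S.lheAdv A ≤ S.aeAdv (aeAdversary A Q) + 2 * E := by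
  obtain ⟨W, hW⟩ := aeExperiment_aeAdversary (A := A) (Q := Q)
  have havg : ∀ f g h : (Fin S.N → ZMod S.p) → (S.Salt × S.Pin → Fin S.n → Fin S.N) →
      S.Salt → S.Pin → (Fin S.n → ZMod S.p) → S.F → ℝ≥0∞,
      (∀ sk H salt pin r k, f sk H salt pin r k ≤ g sk H salt pin r k + h sk H salt pin r k) →
      S.avg f ≤ S.avg g + S.avg h := by
    intro f g h hle
    have : S.avg g + S.avg h =
        S.avg fun sk H salt pin r k => g sk H salt pin r k + h sk H salt pin r k := by
      simp only [avg, wp_add]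
    rw [this]
    exact wp_mono fun sk => wp_mono fun H => wp_mono fun salt => wp_mono fun pin =>
      wp_mono fun r => wp_mono fun k => hle sk H salt pin r k
  have key : ∀ β β', S.lheProb A β + (S.aeExperiment (aeAdversary A Q) β' true).toReal ≤
      S.lheProb A β' + (S.aeExperiment (aeAdversary A Q) β true).toReal + 2 * E := by
    intro β β'
    have h1 : ((S.lheExperiment A β).map Prod.fst) true + S.aeExperiment (aeAdversary A Q) β' true ≤
        ((S.lheExperiment A β').map Prod.fst) true + S.aeExperiment (aeAdversary A Q) β true +
          ENNReal.ofReal (2 * E) := by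
      have e1 := havg _ _ _ fun sk H salt pin r k => shiftGame_const_le A Q β sk H salt pin r k k 0
      have e2 := havg _ _ _ fun sk H salt pin r k => shiftGame_const_le A Q β' sk H salt pin r k 0 k
      rw [two_mul, ENNReal.ofReal_add hE hE, hW, hW, lheExperiment_eq_avg A hQ,
        lheExperiment_eq_avg A hQ]
      calc _ ≤ _ := add_le_add (e1.trans (add_le_add_right (hb β) _))
            (add_le_add_left (e2.trans (add_le_add_right (hb β') _)) _)
        _ = _ := by ring
    have hp : ∀ p : PMF Bool, p true ≠ ∞ := fun p => PMF.apply_ne_top _ _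
    have hs := ENNReal.add_ne_top.2 ⟨hp ((S.lheExperiment A β').map Prod.fst),
      hp (S.aeExperiment (aeAdversary A Q) β)⟩
    have h2 := ENNReal.toReal_mono (ENNReal.add_ne_top.2 ⟨hs, ENNReal.ofReal_ne_top⟩) h1
    rw [ENNReal.toReal_add (hp _) (hp _), ENNReal.toReal_add hs ENNReal.ofReal_ne_top,
      ENNReal.toReal_add (hp _) (hp _), ENNReal.toReal_ofReal (by positivity)] at h2
    exact h2
  have k1 := key false true
  have k2 := key true false
  unfold lheAdv aeAdv
  have := le_abs_self ((S.aeExperiment (aeAdversary A Q) false true).toReal -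
    (S.aeExperiment (aeAdversary A Q) true true).toReal)
  have := neg_abs_le ((S.aeExperiment (aeAdversary A Q) false true).toReal -
    (S.aeExperiment (aeAdversary A Q) true true).toReal)
  exact abs_le.2 ⟨by linarith, by linarith⟩

/-- The best one of finitely many Diffie–Hellman adversaries: the reductions for all queries,
positions and messages, and the search for small discrete logarithms. -/
theorem exists_cdhAdversary (A : LHEAdversary S) {Q : ℕ} (hQ : Q ≤ A.cost) :
    ∃ B : CDHAdversary S, B.cost ≤ 200 * (S.N + S.n + S.saltLen) ^ 2 * A.cost ∧
      (∀ β (ρ : Fin Q) j, cdhGame A Q β ρ j ≤ S.cdhExperiment B true) ∧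
      ((min (4 * S.n * S.n) S.p : ℕ) : ℝ≥0∞) / S.p ≤ S.cdhExperiment B true := by
  let B : Option (Bool × Fin Q × Fin S.n) → CDHAdversary S
    | none => searchAdversary S (4 * S.n * S.n)
    | some x => cdhAdversary A Q x.1 x.2.1 x.2.2
  obtain ⟨x, hx⟩ := Finite.exists_max fun x => S.cdhExperiment (B x) true
  refine ⟨B x, ?_, fun β ρ j => (cdhGame_le β ρ ρ.2 j).trans (hx (some (β, ρ, j))),
    (searchAdversary_adv _).trans (hx none)⟩
  rcases x with _ | x
  · obtain ⟨k1, -, -, -, -, -, k7⟩ := cost_terms_le A (one_le_lheCost A)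
    refine (cost_searchAdversary_le _).trans ?_
    rw [mul_assoc, mul_assoc]
    omega
  · exact cost_cdhAdversary_le A Q hQ _ _ _

/-- Twice the union bound over the sets of corrupted keys and the sets of `m ≥ 3 N / (2 n)` PINs:
the exponents add up to `1 + 3 N / 8 - 3 N / 4`. -/
theorem cover_term_le {N n t P m : ℕ} {s : ℝ} (hs : s ≤ 2 ^ (3 * (N : ℝ) / 8)) (hN : 8 ≤ N)
    (hn : n = 2 * t) (hP : (P : ℝ) < 2 ^ ((n : ℝ) / 2)) (hm : 3 * N ≤ 2 * n * m) :
    2 * (s * ((P : ℝ) ^ m * ((2⁻¹ : ℝ) ^ (2 * t)) ^ m)) ≤ 2 ^ (-(N : ℝ) / 4) := by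
  have hP' : (P : ℝ) ≤ 2 ^ t := by
    have : (n : ℝ) / 2 = (t : ℕ) := by rw [hn]; push_cast; ring
    rw [this, Real.rpow_natCast] at hP
    exact hP.le
  have h1 : (P : ℝ) * 2⁻¹ ^ (2 * t) ≤ 2 ^ (-(t : ℝ)) := by
    calc (P : ℝ) * 2⁻¹ ^ (2 * t) ≤ 2 ^ t * 2⁻¹ ^ (2 * t) := by gcongr
      _ = 2 ^ (-(t : ℝ)) := by
        rw [Real.rpow_neg zero_le_two, Real.rpow_natCast, two_mul, pow_add, ← mul_assoc, ← mul_pow]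
        simp
  have h2 : (P : ℝ) ^ m * (2⁻¹ ^ (2 * t)) ^ m ≤ 2 ^ (-(3 * (N : ℝ) / 4)) := by
    rw [← mul_pow]
    calc _ ≤ ((2 : ℝ) ^ (-(t : ℝ))) ^ m := by gcongr
      _ = 2 ^ (-(t : ℝ) * m) := by rw [Real.rpow_mul zero_le_two, Real.rpow_natCast]
      _ ≤ _ := by
        refine Real.rpow_le_rpow_of_exponent_le one_le_two ?_
        have : (3 * N : ℝ) ≤ 2 * (2 * t) * m := by rw [hn] at hm; exact_mod_cast hm
        linarith
  calc _ ≤ 2 * ((2 : ℝ) ^ (3 * (N : ℝ) / 8) * 2 ^ (-(3 * (N : ℝ) / 4))) := by gcongr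
    _ = 2 ^ (1 + (3 * (N : ℝ) / 8 + -(3 * (N : ℝ) / 4))) := by
      rw [Real.rpow_add two_pos, Real.rpow_add two_pos, Real.rpow_one]
    _ ≤ _ := by
      refine Real.rpow_le_rpow_of_exponent_le one_le_two ?_
      have : (8 : ℝ) ≤ N := by exact_mod_cast hN
      linarith

theorem Admissible.two_mul_lt (hS : S.Admissible) : 2 * S.n < S.N := by
  have h1 := hS.universe_gt
  have h2 : (2 : ℝ) < Real.exp 1 := by have := Real.exp_one_gt_d9; linarith
  have h3 : (2 : ℝ) * S.n ≤ Real.exp 1 * S.n := by gcongr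
  exact_mod_cast h3.trans_lt h1

theorem one_le_card_pin : (1 : ℝ) ≤ Nat.card S.Pin := by exact_mod_cast Nat.card_pos

/-- The concrete bound. The two halves of the game, for the two messages, contribute `2 n Q` times
the CDH advantage and `2 · 2 n² / p` for collisions of pads. The latter is at most the advantage of
the search for discrete logarithms less than `4 n²`, and `2 n + 1 ≤ N`. -/
theorem concrete_bound (hS : S.Admissible) (A : LHEAdversary S) {Q : ℕ} (hQ : S.QueryBound A Q) :
    ∃ (B : CDHAdversary S) (D : AEAdversary S),
      B.cost ≤ 200 * (S.N + S.n + S.saltLen) ^ 2 * A.cost ∧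
      D.cost ≤ 200 * (S.N + S.n + S.saltLen) ^ 2 * A.cost ∧
      D.prog.calls AEQuery.lr ≤ 1 ∧ D.prog.calls AEQuery.dec = 0 ∧
      S.lheAdv A ≤ (2 : ℝ) ^ (-(S.N : ℝ) / 4) + S.N * Q * S.cdhAdv B
        + 3 * S.N / (S.n * Nat.card S.Pin) + S.aeAdv D := by
  have hnN := hS.two_mul_lt
  have hn := S.n_pos
  have ht := hS.threshold
  -- the cost bounds the number of reductions, whatever the given bound on the queries is
  set Q' := min Q A.cost with hQ'
  have hQA : S.QueryBound A Q' := fun β r hr => le_min (hQ β r hr) (queryBound_cost A β r hr)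
  obtain ⟨B, hB, hBgame, hBsearch⟩ := exists_cdhAdversary A (min_le_right Q A.cost)
  refine ⟨B, aeAdversary A Q', hB, cost_aeAdversary_le A Q' (min_le_right _ _) (by omega),
    by rw [calls_aeAdversary]; simp, by rw [calls_aeAdversary]; simp, ?_⟩
  have hP := one_le_card_pin (S := S)
  have hadv : 0 ≤ S.cdhAdv B := ENNReal.toReal_nonneg
  have hae : 0 ≤ S.aeAdv (aeAdversary A Q') := abs_nonneg _
  have hpow : (0 : ℝ) < 2 ^ (-(S.N : ℝ) / 4) := by positivity
  have hn' : (0 : ℝ) < S.n := by exact_mod_cast hn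
  have hfrac : 0 ≤ 3 * (S.N : ℝ) / (S.n * Nat.card S.Pin) := by positivity
  -- for fewer than eight keys there is only one PIN
  by_cases hN8 : S.N < 8
  · have ht1 : S.t = 1 := by have := S.t_pos; omega
    have hn2 : S.n = 2 := by omega
    have hP1 : (Nat.card S.Pin : ℝ) = 1 := by
      have h := hS.pin_lt
      rw [hn2] at h
      norm_num at h
      have h1 : 1 ≤ Nat.card S.Pin := Nat.card_pos
      exact_mod_cast Nat.le_antisymm h h1
    have : (1 : ℝ) ≤ 3 * S.N / (S.n * Nat.card S.Pin) := by
      rw [hP1, hn2, le_div_iff₀ (by norm_num)]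
      have : (4 : ℝ) < S.N := by exact_mod_cast (by omega : 4 < S.N)
      norm_num; linarith
    have := lheAdv_le_one A
    have : 0 ≤ S.N * Q * S.cdhAdv B := by positivity
    linarith
  have hp0 : (0 : ℝ) < S.p := by exact_mod_cast S.p_prime.out.pos
  have hQle : (Q' : ℝ) ≤ Q := by exact_mod_cast min_le_left Q A.cost
  have hN1 : (2 * S.n + 1 : ℝ) ≤ S.N := by exact_mod_cast hnN
  have hsearch : ((min (4 * S.n * S.n) S.p : ℕ) : ℝ) / S.p ≤ S.cdhAdv B := by
    have := ENNReal.toReal_mono (PMF.apply_ne_top _ _) hBsearch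
    simpa [ENNReal.toReal_div, cdhAdv] using this
  -- the threshold for the number of PINs whose locations are corrupted
  set m := 3 * S.N / (2 * S.n) + 1 with hm
  have hm1 : 3 * S.N ≤ 2 * S.n * m := (Nat.lt_mul_div_succ _ (by omega)).le
  have hm2 : 2 * (((m - 1 : ℕ) : ℝ) / Nat.card S.Pin) ≤ 3 * S.N / (S.n * Nat.card S.Pin) := by
    have h1 : ((m - 1 : ℕ) : ℝ) ≤ ((3 * S.N : ℕ) : ℝ) / ((2 * S.n : ℕ) : ℝ) := Nat.cast_div_le
    push_cast at h1
    rw [← mul_div_assoc, ← div_div]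
    gcongr
    calc _ ≤ 2 * (3 * (S.N : ℝ) / (2 * S.n)) := by gcongr
      _ = _ := by field_simp
  -- `cov` bounds the probability of crowded locations, `coll` that of coinciding pads
  have hcover := cover_term_le (card_smallSets_le S.N) (not_lt.1 hN8) ht hS.pin_lt hm1
  set cov := ((smallSets S.N).card : ℝ) *
    ((Nat.card S.Pin : ℝ) ^ m * ((2⁻¹ : ℝ) ^ (2 * S.t)) ^ m) with hcov
  set coll : ℝ := if 0 < Q' then (S.n * S.n : ℕ) * (2 * (S.p : ℝ)⁻¹) else 0 with hcoll
  have hcoll0 : 0 ≤ coll := by rw [hcoll]; split <;> positivity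
  have hmain : S.lheAdv A ≤ S.aeAdv (aeAdversary A Q') + 2 * (coll + (Q' * S.n * S.cdhAdv B +
      (((m - 1 : ℕ) : ℝ) / Nat.card S.Pin + cov))) := by
    refine lheAdv_le_aeAdv_add A hQA (by positivity) fun β => ?_
    refine (avg_badBound_le A Q' β m (Nat.succ_pos _) ht).trans ?_
    rw [ENNReal.ofReal_add hcoll0 (by positivity), ENNReal.ofReal_add (by positivity)
      (by positivity), ENNReal.ofReal_add (by positivity) (by positivity)]
    refine add_le_add ?_ (add_le_add ?_ (add_le_add ?_ ?_))
    · rw [hcoll]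
      split
      · rw [ENNReal.ofReal_mul (by positivity), ENNReal.ofReal_mul (by positivity),
          ENNReal.ofReal_natCast, ENNReal.ofReal_inv_of_pos hp0, ENNReal.ofReal_natCast]
        simp
      · simp
    · rw [ENNReal.ofReal_mul (by positivity), ENNReal.ofReal_mul (by positivity),
        ENNReal.ofReal_natCast, ENNReal.ofReal_natCast, cdhAdv,
        ENNReal.ofReal_toReal (PMF.apply_ne_top _ _)]
      calc _ ≤ ∑ _ρ : Fin Q', ∑ _j : Fin S.n, S.cdhExperiment B true :=
            Finset.sum_le_sum fun ρ _ => Finset.sum_le_sum fun j _ => hBgame β ρ j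
        _ = _ := by simp [mul_assoc]
    · rw [ENNReal.ofReal_div_of_pos (by linarith), ENNReal.ofReal_natCast, ENNReal.ofReal_natCast]
    · rw [hcov, ENNReal.ofReal_mul (by positivity), ENNReal.ofReal_mul (by positivity),
        ENNReal.ofReal_pow (by positivity), ENNReal.ofReal_pow (by positivity),
        ENNReal.ofReal_pow (by positivity), ENNReal.ofReal_inv_of_pos two_pos,
        ENNReal.ofReal_natCast, ENNReal.ofReal_natCast]
      simp
  rcases Nat.eq_zero_or_pos Q' with h0 | hQpos
  · have h1 : coll = 0 := by rw [hcoll, h0]; rfl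
    have h2 : (Q' : ℝ) = 0 := by rw [h0, Nat.cast_zero]
    rw [h1, h2, zero_mul, zero_mul, zero_add, zero_add] at hmain
    have : 0 ≤ S.N * Q * S.cdhAdv B := by positivity
    linarith
  have hQ1 : (1 : ℝ) ≤ Q' := by exact_mod_cast hQpos
  rcases le_or_gt (4 * S.n * S.n) S.p with hp | hp
  · -- collisions are rarer than successes of the search
    rw [min_eq_left hp] at hsearch
    have hc : 2 * coll ≤ S.cdhAdv B := by
      refine le_of_eq_of_le ?_ hsearch
      rw [hcoll, if_pos hQpos]
      push_cast
      field_simp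
      ring
    have : (2 * S.n + 1) * Q' * S.cdhAdv B ≤ S.N * Q * S.cdhAdv B := by gcongr
    have : 1 * S.cdhAdv B ≤ Q' * S.cdhAdv B := by gcongr
    linarith
  · -- the search always succeeds
    rw [min_eq_right hp.le, div_self hp0.ne'] at hsearch
    have : (1 : ℝ) * 1 * 1 ≤ S.N * Q * S.cdhAdv B := by
      have : (1 : ℝ) ≤ S.N := by linarith
      gcongr
      linarith
    have := lheAdv_le_one A
    linarith

end LHEParams
end

/-! ### Asymptotic security -/

theorem Negligible.polynomial_mul {f : ℕ → ℝ} (hf : Negligible f) (q : Polynomial ℕ) :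
    Negligible fun l => (q.eval l : ℕ) * f l := by
  refine (SuperpolynomialDecay.polynomial_mul hf (q.map (Nat.castRingHom ℝ))).congr fun l => ?_
  rw [Polynomial.eval_natCast_map, Nat.coe_castRingHom, Nat.cast_id]

namespace LHEParams

/-- The term `2 ^ (-N / 4)` of the concrete bound is absorbed by `N / |Pin|`, because `|Pin|` is
less than `2 ^ (n / 2)`. -/
theorem Admissible.two_rpow_le {S : LHEParams} (hS : S.Admissible) :
    (2 : ℝ) ^ (-(S.N : ℝ) / 4) ≤ S.N / Nat.card S.Pin := by
  have hP := one_le_card_pin (S := S)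
  have hN : (2 * S.n : ℝ) ≤ S.N := by exact_mod_cast hS.two_mul_lt.le
  have hN1 : (1 : ℝ) ≤ S.N := by exact_mod_cast Nat.one_le_iff_ne_zero.2 S.N_ne.out
  calc (2 : ℝ) ^ (-(S.N : ℝ) / 4) ≤ 2 ^ (-((S.n : ℝ) / 2)) :=
        Real.rpow_le_rpow_of_exponent_le one_le_two (by linarith)
    _ = (2 ^ ((S.n : ℝ) / 2))⁻¹ := Real.rpow_neg zero_le_two _
    _ ≤ (Nat.card S.Pin : ℝ)⁻¹ := by
        have := hS.pin_lt.le
        gcongr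
    _ ≤ S.N / Nat.card S.Pin := by
        rw [inv_eq_one_div]
        gcongr

/-- Asymptotic security follows from the concrete bound, with the cost of the adversary as the bound
on the number of its queries. -/
theorem lheSecure {S : ℕ → LHEParams} (hS : ∀ l, (S l).Admissible) (hl : ∀ l, (S l).saltLen = l)
    (hN : PolyBounded fun l => (S l).N) (hn : PolyBounded fun l => (S l).n) (hcdh : CDHHard S)
    (hae : AESecure S) : LHESecure S := by
  intro A hA
  obtain ⟨qN, hqN⟩ := hN
  obtain ⟨qn, hqn⟩ := hn
  obtain ⟨qA, hqA⟩ := hA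
  choose B D hB hD _ _ hadv using fun l => concrete_bound (hS l) (A l) (queryBound_cost (A l))
  have hq : ∀ l, 200 * ((S l).N + (S l).n + (S l).saltLen) ^ 2 * (A l).cost ≤
      (200 * (qN + qn + Polynomial.X) ^ 2 * qA).eval l := by
    intro l
    have h1 := hqN l
    have h2 := hqn l
    have h3 := hqA l
    simp only [Polynomial.eval_mul, Polynomial.eval_pow, Polynomial.eval_add, Polynomial.eval_X,
      Polynomial.eval_ofNat, hl l]
    gcongr
  have hB := (hcdh B ⟨_, fun l => (hB l).trans (hq l)⟩).polynomial_mul (qN * qA)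
  have hD := hae D ⟨_, fun l => (hD l).trans (hq l)⟩
  refine ⟨4, fun l => ((qN * qA).eval l : ℕ) * (S l).cdhAdv (B l) + (S l).aeAdv (D l),
    hB.add hD, fun l => (hadv l).trans ?_⟩
  have h1 := (hS l).two_rpow_le
  have h2 : 3 * (S l).N / ((S l).n * Nat.card (S l).Pin) ≤
      3 * (((S l).N : ℝ) / Nat.card (S l).Pin) := by
    have hP := one_le_card_pin (S := S l)
    have hn1 : (1 : ℝ) ≤ (S l).n := by exact_mod_cast (S l).n_pos
    rw [← mul_div_assoc]
    gcongr
    exact le_mul_of_one_le_left (by linarith) hn1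
  have h3 : ((S l).N : ℝ) * (A l).cost * (S l).cdhAdv (B l) ≤
      ((qN * qA).eval l : ℕ) * (S l).cdhAdv (B l) := by
    have h : (S l).N * (A l).cost ≤ (qN * qA).eval l := by
      rw [Polynomial.eval_mul]; exact Nat.mul_le_mul (hqN l) (hqA l)
    have h' : ((S l).N : ℝ) * (A l).cost ≤ ((qN * qA).eval l : ℕ) := by exact_mod_cast h
    exact mul_le_mul_of_nonneg_right h' ENNReal.toReal_nonneg
  linarith

end LHEParams

theorem mainTheorem1 :
    (∃ c d : ℕ, ∀ S : LHEParams, S.Admissible →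
      ∀ (A : LHEAdversary S) (Q : ℕ), S.QueryBound A Q →
        ∃ (B : CDHAdversary S) (D : AEAdversary S),
          B.cost ≤ c * (S.N + S.n + S.saltLen) ^ d * A.cost ∧
          D.cost ≤ c * (S.N + S.n + S.saltLen) ^ d * A.cost ∧
          D.prog.calls AEQuery.lr ≤ 1 ∧ D.prog.calls AEQuery.dec = 0 ∧
          S.lheAdv A ≤ (2 : ℝ) ^ (-(S.N : ℝ) / 4) + S.N * Q * S.cdhAdv B
            + 3 * S.N / (S.n * Nat.card S.Pin) + S.aeAdv D) ∧
    (∀ S : ℕ → LHEParams, (∀ l, (S l).Admissible) → (∀ l, (S l).saltLen = l) →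
      PolyBounded (fun l => (S l).N) → PolyBounded (fun l => (S l).n) →
      CDHHard S → AESecure S → LHESecure S) :=
  ⟨⟨200, 2, fun _ hS A _ hQ => LHEParams.concrete_bound hS A hQ⟩,
    fun _ hS hl hN hn hcdh hae => LHEParams.lheSecure hS hl hN hn hcdh hae⟩
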